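/- **Setting.** Let $m=3$. For $j\in\mathbb Z/3=\{0,1,2\}$ let $n_j=(-\sin\frac{j\pi}{3},\cos\frac{j\pi}{3})$, let $f_j(z)=-z_1\sin\frac{j\pi}{3}+z_2\cos\frac{j\pi}{3}$ on $\mathbb C^2$, let $H_j=\ker f_j$, and let $s_j$ be the reflection in $H_j$. The $s_j$ are the reflections of the dihedral group $D_3\cong S_3$. Let $M=\mathbb C^2\setminus\bigcup_j H_j$, and let $p\in\mathbb R^2$ be a point of the open chamber of polar angle in $(0,\pi/3)$. On $V=\mathbb C v_0\oplus\mathbb C v_1\oplus\mathbb C v_2$ let $\iota(s_i)v_j=v_{2i-j}$ and, for $k,\alpha\in\mathbb C$, let $p_iv_i=\alpha v_i$ and $p_iv_j=kv_i$ $(j\ne i)$. For $\kappa\in\mathbb C$ the Lawrence–Krammer connection on $M\times V$ has flat sections given by $dy=\kappa\sum_{i}(k\,\iota(s_i)-p_i)\frac{df_i}{f_i}\,y$. It is flat and $D_3$-invariant, and for $i=0,1$ the monodromy of the standard generator $\sigma_i$ of $\pi_1(M/D_3)$ is $T_i=\iota(s_i)P_i$, where $P_i$ is parallel transport along the half-turn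 $t\mapsto p-(1-e^{\pi\sqrt{-1}t})f_i(p)n_i$, $t\in[0,1]$, from $p$ to $s_i(p)$. Put $$q=e^{\kappa k\pi\sqrt{-1}},\qquad l=e^{\kappa\alpha\pi\sqrt{-1}}/q,\qquad e_i=\frac{l}{q^{-1}-q}(T_i-q)(T_i+q^{-1})\quad(i=0,1).$$ Let $\Lambda$ be the free monoid on the letters $X_0,X_1,E_0,E_1$, and let $f:\Lambda\to\mathrm{End}(V)$ be the substitution $X_j\mapsto T_j$, $E_j\mapsto e_j$. The function $\Phi^i:\Lambda\to\mathbb C$ is defined by $e_if(w)e_i=\Phi^i(w)e_i$. The algebra $B_{D_3}(\Pi,\kappa)$, $\Pi=(k,\alpha)$, is the associative unital $\mathbb C$-algebra generated by $X_0^{\pm1},X_1^{\pm1},E_0,E_1$ with the relations, for $i=0,1$ and $w\in\Lambda$: $X_0X_1X_0=X_1X_0X_1$; $(q^{-1}-q)E_i=l(X_i-q)(X_i+q^{-1})$; $X_iE_i=E_iX_i=l^{-1}E_i$; $E_iwE_i=\Phi^i(w)E_i$. The classical BMW algebra $B_3(q,l)$ is the associative unital $\mathbb C$-algebra generated by $X_0,X_1,E_0,E_1$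 with the relations, for $\{i,j\}=\{0,1\}$, $\nu=q^{-1}-q$ and $\tau=1-\frac{l-l^{-1}}{\nu}$: $X_iX_jX_i=X_jX_iX_j$; $X_iX_jE_i=E_jX_iX_j$; $l(X_i^2+\nu X_i-1)=\nu E_i$; $X_iE_i=l^{-1}E_i$; $E_iX_jE_i=lE_i$; $E_i^2=\tau E_i$. **Proposition 4.2.** Let $k,\alpha,\kappa\in\mathbb C$ be generic, in the sense that $q^2\ne1$, $l^{-1}\notin\{q,-q^{-1}\}$ and $1+l(q^{-1}-q)\ne0$. Then the operators $T_0,T_1$ exist and are uniquely determined, and the functions $\Phi^0,\Phi^1$ are well defined: for each $i$ and $w$ there is exactly one scalar $\Phi^i(w)$ with $e_if(w)e_i=\Phi^i(w)e_i$. Moreover: 1. for $i=0,1$ and every word $w\in\Lambda$, the element $E_iwE_i$ of $B_3(q,l)$ is a scalar multiple $cE_i$ of $E_i$ for exactly one $c\in\mathbb C$, namely $c=\Phi^i(w)$; 2. there is an isomorphism of $\mathbb C$-algebras $B_{D_3}(\Pi,\kappa)\cong B_3(q,l)$ sending $X_i\mapsto X_i$ and $E_i\mapsto E_i$ for $i=0,1$.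 -/

import Mathlib

open Real Set

namespace DihedralBMW

noncomputable section

/-! ### The reflection arrangement of the dihedral group of order `2m` -/

/-- The angle `jπ/m` that the real trace of the line `H_j` makes with the `x`-axis. -/
def lineAngle (m : ℕ) (j : ZMod m) : ℝ := j.val * π / m

/-- The unit normal `(-sin(jπ/m), cos(jπ/m))` of the line `H_j`. -/
def lineNormal (m : ℕ) (j : ZMod m) : Fin 2 → ℂ :=
  ![((-Real.sin (lineAngle m j) : ℝ) : ℂ), ((Real.cos (lineAngle m j) : ℝ) : ℂ)]

/-- The linear form `f_j` on `ℂ²` with kernel the complexified line `H_j`. -/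
def lineForm (m : ℕ) (j : ZMod m) (z : Fin 2 → ℂ) : ℂ :=
  lineNormal m j 0 * z 0 + lineNormal m j 1 * z 1

/-- `p` lies in the open real chamber bounded by `H_0` (the `x`-axis) and `H_1`. -/
def InChamber (m : ℕ) (p : Fin 2 → ℝ) : Prop :=
  0 < p 1 ∧ Real.cos (π / m) * p 1 < Real.sin (π / m) * p 0

/-- The half-turn `t ↦ p - (1 - exp(iπt)) f_j(p) n_j` from `p` to its mirror image `s_j(p)`; it goes
once, counterclockwise, half-way around `H_j`. For `j = 0, 1` and `p` in the chamber it avoids all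
the lines and represents the standard generator `σ_j` of the fundamental group of the quotient of
the complement of the lines by the dihedral group. -/
def halfTurn (m : ℕ) (p : Fin 2 → ℝ) (j : ZMod m) (t : ℝ) : Fin 2 → ℂ :=
  fun a => (p a : ℂ) - (1 - Complex.exp (π * Complex.I * t)) *
    lineForm m j (fun b => (p b : ℂ)) * lineNormal m j a

/-! ### The Lawrence–Krammer connection (for odd `m`) and its monodromy

The space `V = ⨁_j ℂ v_j` has a basis indexed by the lines `H_j`, `j ∈ ℤ/m`. -/

/-- The permutation action `ι(s_i)` of the reflection `s_i` on `V`: reflecting in the line of angle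
`iπ/m` takes the line of angle `jπ/m` to the line of angle `(2i-j)π/m`. -/
def reflPerm (m : ℕ) (i : ZMod m) : Matrix (ZMod m) (ZMod m) ℂ :=
  Matrix.of fun a b => if a = 2 * i - b then 1 else 0

/-- The operator `p_i` on `V`: `p_i v_i = α v_i` and `p_i v_j = k v_i` for `j ≠ i`. -/
def lkProj (m : ℕ) (k α : ℂ) (i : ZMod m) : Matrix (ZMod m) (ZMod m) ℂ :=
  Matrix.of fun a b => if a = i then (if b = i then α else k) else 0

/-- The connection form `κ ∑_i (k ι(s_i) - p_i) d f_i / f_i` at the point `z`, evaluated on the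
tangent vector `u`. -/
def lkForm (m : ℕ) [NeZero m] (k α κ : ℂ) (z u : Fin 2 → ℂ) : Matrix (ZMod m) (ZMod m) ℂ :=
  κ • ∑ i : ZMod m, (lineForm m i u / lineForm m i z) • (k • reflPerm m i - lkProj m k α i)

/-- `P` is the parallel transport along `γ : [0,1] → ℂ²`, for flat sections `dy = Ω y` of the
connection form `Ω`. -/
def IsTransport {ι : Type*} [Fintype ι] (Ω : (Fin 2 → ℂ) → (Fin 2 → ℂ) → Matrix ι ι ℂ)
    (γ : ℝ → Fin 2 → ℂ) (P : Matrix ι ι ℂ) : Prop :=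
  ∀ v : ι → ℂ, ∃ y : ℝ → ι → ℂ,
    (∀ t ∈ Icc (0 : ℝ) 1,
      HasDerivWithinAt y ((Ω (γ t) (deriv γ t)).mulVec (y t)) (Icc (0 : ℝ) 1) t) ∧
    y 0 = v ∧ y 1 = P.mulVec v

/-- `T` is the monodromy of `σ_i` on the bundle `M ×_W V`: transport from `p` to `s_i(p)`, followed
by the identification `ι(s_i)⁻¹ = ι(s_i)` of the fibre over `s_i(p)` with the fibre over `p`. -/
def IsLKMonodromy (m : ℕ) [NeZero m] (k α κ : ℂ) (p : Fin 2 → ℝ) (i : Fin 2)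
    (T : Matrix (ZMod m) (ZMod m) ℂ) : Prop :=
  ∃ P, IsTransport (lkForm m k α κ) (halfTurn m p (i.val : ZMod m)) P ∧
    T = reflPerm m (i.val : ZMod m) * P

open Classical in
/-- The monodromy operator `T_LK(σ_i)`, `i = 0, 1`. -/
def lkT (m : ℕ) [NeZero m] (k α κ : ℂ) (p : Fin 2 → ℝ) (i : Fin 2) :
    Matrix (ZMod m) (ZMod m) ℂ :=
  if h : ∃ T, IsLKMonodromy m k α κ p i T then h.choose else 0

/-- `q = exp(κ k π √-1)`. -/
def qPar (k κ : ℂ) : ℂ := Complex.exp (κ * k * π * Complex.I)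

/-- `l = exp(κ α π √-1) / q`. -/
def lPar (k α κ : ℂ) : ℂ := Complex.exp (κ * α * π * Complex.I) / qPar k κ

/-- `e_i = l / (q⁻¹ - q) · (T_LK(σ_i) - q) (T_LK(σ_i) + q⁻¹)`. -/
def lkE (m : ℕ) [NeZero m] (k α κ : ℂ) (p : Fin 2 → ℝ) (i : Fin 2) :
    Matrix (ZMod m) (ZMod m) ℂ :=
  (lPar k α κ / ((qPar k κ)⁻¹ - qPar k κ)) •
    ((lkT m k α κ p i - qPar k κ • (1 : Matrix (ZMod m) (ZMod m) ℂ)) *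
      (lkT m k α κ p i + (qPar k κ)⁻¹ • (1 : Matrix (ZMod m) (ZMod m) ℂ)))

/-! ### Words and the functions `Φ` -/

/-- The letters `X_i`, `E_i`. -/
inductive Letter (I : Type) : Type
  | X (i : I) : Letter I
  | E (i : I) : Letter I

/-- The value of a word in the letters `X_i, E_i` after the substitution `X_i ↦ x i`,
`E_i ↦ e i`. -/
def evalWord {I : Type} {A : Type*} [Monoid A] (x e : I → A) : FreeMonoid (Letter I) →* A :=
  FreeMonoid.lift fun a => match a with
    | Letter.X i => x i
    | Letter.E i => e i

open Classical in
/-- The scalar `Φ^i(w)` with `e_i f(w) e_i = Φ^i(w) e_i`, where `f` is the substitution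
`X_j ↦ T_LK(σ_j)`, `E_j ↦ e_j`. -/
def Phi (m : ℕ) [NeZero m] (k α κ : ℂ) (p : Fin 2 → ℝ) (i : Fin 2)
    (w : FreeMonoid (Letter (Fin 2))) : ℂ :=
  if h : ∃ c : ℂ, lkE m k α κ p i * evalWord (lkT m k α κ p) (lkE m k α κ p) w * lkE m k α κ p i =
      c • lkE m k α κ p i
  then h.choose else 0

/-! ### The dihedral algebra `B_{D_m}(Π, κ)` for odd `m`, `Π = (k, α)` -/

/-- Generators `X_i`, `X_i⁻`, `E_i`, `i = 0, 1`. -/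
inductive DGen : Type
  | X (i : Fin 2) : DGen
  | Xinv (i : Fin 2) : DGen
  | E (i : Fin 2) : DGen

/-- The generator `X_i` in the free algebra. -/
def gX (i : Fin 2) : FreeAlgebra ℂ DGen := FreeAlgebra.ι ℂ (DGen.X i)

/-- The generator `X_i⁻` in the free algebra. -/
def gXinv (i : Fin 2) : FreeAlgebra ℂ DGen := FreeAlgebra.ι ℂ (DGen.Xinv i)

/-- The generator `E_i` in the free algebra. -/
def gE (i : Fin 2) : FreeAlgebra ℂ DGen := FreeAlgebra.ι ℂ (DGen.E i)

/-- The alternating product `[a b a ⋯]_n` with `n` factors. -/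
def altProd {A : Type*} [Monoid A] (a b : A) : ℕ → A
  | 0 => 1
  | n + 1 => a * altProd b a n

/-- The defining relations of `B_{D_m}(Π, κ)`, `m` odd. -/
inductive DRel (m : ℕ) [NeZero m] (k α κ : ℂ) (p : Fin 2 → ℝ) :
    FreeAlgebra ℂ DGen → FreeAlgebra ℂ DGen → Prop
  | mul_inv (i : Fin 2) : DRel m k α κ p (gX i * gXinv i) 1
  | inv_mul (i : Fin 2) : DRel m k α κ p (gXinv i * gX i) 1
  | braid : DRel m k α κ p (altProd (gX 0) (gX 1) m) (altProd (gX 1) (gX 0) m)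
  | quad (i : Fin 2) : DRel m k α κ p
      (((qPar k κ)⁻¹ - qPar k κ) • gE i)
      (lPar k α κ • ((gX i - algebraMap ℂ _ (qPar k κ)) * (gX i + algebraMap ℂ _ (qPar k κ)⁻¹)))
  | X_mul_E (i : Fin 2) : DRel m k α κ p (gX i * gE i) ((lPar k α κ)⁻¹ • gE i)
  | E_mul_X (i : Fin 2) : DRel m k α κ p (gE i * gX i) ((lPar k α κ)⁻¹ • gE i)
  | sandwich (i : Fin 2) (w : FreeMonoid (Letter (Fin 2))) : DRel m k α κ p
      (gE i * evalWord gX gE w * gE i) (Phi m k α κ p i w • gE i)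

/-- The algebra `B_{D_m}(Π, κ)`, `m` odd, `Π = (k, α)`. -/
abbrev DihedralAlg (m : ℕ) [NeZero m] (k α κ : ℂ) (p : Fin 2 → ℝ) : Type :=
  RingQuot (DRel m k α κ p)

/-- The element `X_i` of `B_{D_m}(Π, κ)`. -/
def dX (m : ℕ) [NeZero m] (k α κ : ℂ) (p : Fin 2 → ℝ) (i : Fin 2) : DihedralAlg m k α κ p :=
  RingQuot.mkAlgHom ℂ (DRel m k α κ p) (gX i)

/-- The element `E_i` of `B_{D_m}(Π, κ)`. -/
def dE (m : ℕ) [NeZero m] (k α κ : ℂ) (p : Fin 2 → ℝ) (i : Fin 2) : DihedralAlg m k α κ p :=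
  RingQuot.mkAlgHom ℂ (DRel m k α κ p) (gE i)

/-! ### The simply laced BMW algebras, and the classical algebra `B_3(q, l)` -/

/-- `ν = q⁻¹ - q`. -/
def nuPar (q : ℂ) : ℂ := q⁻¹ - q

/-- `τ`, determined by `ν (1 - τ) = l - l⁻¹`. -/
def tauPar (q l : ℂ) : ℂ := 1 - (l - l⁻¹) / nuPar q

/-- The generator `X_i` in the free algebra. -/
def bX {I : Type} (i : I) : FreeAlgebra ℂ (Letter I) := FreeAlgebra.ι ℂ (Letter.X i)

/-- The generator `E_i` in the free algebra. -/
def bE {I : Type} (i : I) : FreeAlgebra ℂ (Letter I) := FreeAlgebra.ι ℂ (Letter.E i)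

/-- The defining relations of the BMW algebra of a simply laced Dynkin diagram `Γ`. -/
inductive BMWRel {I : Type} (Γ : SimpleGraph I) (q l : ℂ) :
    FreeAlgebra ℂ (Letter I) → FreeAlgebra ℂ (Letter I) → Prop
  | braid {i j : I} (h : Γ.Adj i j) : BMWRel Γ q l (bX i * bX j * bX i) (bX j * bX i * bX j)
  | XXE {i j : I} (h : Γ.Adj i j) : BMWRel Γ q l (bX i * bX j * bE i) (bE j * bX i * bX j)
  | commXX {i j : I} (h : ¬ Γ.Adj i j) : BMWRel Γ q l (bX i * bX j) (bX j * bX i)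
  | quad (i : I) : BMWRel Γ q l (l • (bX i ^ 2 + nuPar q • bX i - 1)) (nuPar q • bE i)
  | XE (i : I) : BMWRel Γ q l (bX i * bE i) (l⁻¹ • bE i)
  | EXE {i j : I} (h : Γ.Adj i j) : BMWRel Γ q l (bE i * bX j * bE i) (l • bE i)
  | commXE {i j : I} (h : ¬ Γ.Adj i j) : BMWRel Γ q l (bX i * bE j) (bE j * bX i)
  | EE (i : I) : BMWRel Γ q l (bE i ^ 2) (tauPar q l • bE i)

/-- The simply laced BMW algebra of type `Γ`, over `ℂ`, at the parameters `q, l`. -/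
abbrev BMWAlg {I : Type} (Γ : SimpleGraph I) (q l : ℂ) : Type := RingQuot (BMWRel Γ q l)

/-- The classical BMW algebra `B_3(q, l)`: the diagram is `A_2`, two nodes joined by an edge. -/
abbrev BMW3 (q l : ℂ) : Type := BMWAlg (SimpleGraph.pathGraph 2) q l

/-- The element `X_i` of `B_3(q, l)`. -/
def cX (q l : ℂ) (i : Fin 2) : BMW3 q l := RingQuot.mkAlgHom ℂ (BMWRel _ q l) (bX i)

/-- The element `E_i` of `B_3(q, l)`. -/
def cE (q l : ℂ) (i : Fin 2) : BMW3 q l := RingQuot.mkAlgHom ℂ (BMWRel _ q l) (bE i)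

end

end DihedralBMW

open DihedralBMW

/-!
The connection is `κ ∑_j A_j d log f_j` with residues `A_j = k ι(s_j) - p_j`, and `∑_j A_j` is the
scalar `k - α`. In the coordinates `u = z_1 + i z_2`, `v = z_1 - i z_2` the lines are the three loci
`u / v = ω^j` with `ω = exp(2πi/3)`, so that after a power of `v` is split off the flat sections
solve a Fuchsian system in `w = u / v` with its singular points on the unit circle. On the plane
slit radially outwards from these points the system has a fundamental solution `Y` with `Y 0 = 1`
(`exists_isFundamental`). Because the connection is `D_3`-invariant, `Y` is equivariant under the
rotation of order three and, on a sector and up to a power of `w`, under a reflection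
(`IsFundamental.Y_rot`, `IsFundamental.Y_refl`). The half-turn around `H_0` stays in the closed unit
disc of the coordinate `w`, and the one around `H_1` is a mirror image of such a half-turn. Hence
(`isLKMonodromy_iff`) the monodromy operators are, up to a common conjugation, `T_0 = ζ J C` and
`T_1 = ζ C J` with a scalar `ζ`, a reflection `J` and a cyclic permutation matrix `C`, and the braid
relation is immediate.

The eigenvalues of `T_0` do not depend on the base point. As the base point approaches `H_0`, the
transport tends to `exp(iπκ A_0)` by Grönwall's inequality, which gives the eigenvalues `l⁻¹`, `q`,
`-q⁻¹` (`det_sub_monodromy`). As `l⁻¹` is a simple eigenvalue, `e_i`, which is a multiple of the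
adjugate of `T_i - l⁻¹`, has rank one and satisfies `e_i M e_i = tr(e_i M) e_i` for all `M`; this is
why `Φ^i` exists. The traces of words in `J` and `C` give `tr(e_0 T_1) = l` (`trace_e_mul`), so that
the `T_i` and `e_i` satisfy the relations of `B_3(q, l)` (`isBMWPair_lkT`).

In `B_3(q, l)` the left ideal generated by `E_i` is spanned by `E_i`, `X_j E_i` and `X_i X_j E_i`;
here `1 + l ν ≠ 0` is used to obtain `E_i E_j E_i = E_i`. So `E_i w E_i` is a multiple of `E_i`
(`exists_sandwich_eq_smul`), and the monodromy representation, in which `e_i ≠ 0`, shows that the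
scalar is `Φ^i(w)`. The relations of either algebra therefore hold in the other, which gives the
isomorphism (`exists_algEquiv_dihedral`).
-/

namespace DihedralBMW

/-! ### Holomorphic linear differential equations on star-shaped domains -/

section LinearODE

variable {E : Type*} [NormedAddCommGroup E] [NormedSpace ℂ E]

/-- Scaling `[0, 1]` times a small closed ball stays in a compact subset of a star-shaped domain. -/
theorem exists_compact_starShaped {D : Set ℂ} (hDo : IsOpen D) (hD : StarConvex ℝ 0 D) {w : ℂ}
    (hw : w ∈ D) :
    ∃ ε > 0, ∃ K ⊆ D, IsCompact K ∧ Metric.closedBall w ε ⊆ K ∧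
      ∀ z ∈ K, ∀ s ∈ Icc (0 : ℝ) 1, s • z ∈ K := by
  obtain ⟨ε, hε, hball⟩ := Metric.nhds_basis_closedBall.mem_iff.1 (hDo.mem_nhds hw)
  refine ⟨ε, hε, (fun x : ℝ × ℂ => x.1 • x.2) '' (Icc (0 : ℝ) 1 ×ˢ Metric.closedBall w ε),
    ?_, ?_, ?_, ?_⟩
  · rintro _ ⟨⟨s, z⟩, ⟨hs, hz⟩, rfl⟩
    exact hD.smul_mem (hball hz) hs.1 hs.2
  · exact (isCompact_Icc.prod (isCompact_closedBall w ε)).image (by fun_prop)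
  · intro z hz
    exact ⟨(1, z), ⟨by simp, hz⟩, by simp⟩
  · rintro _ ⟨⟨s, z⟩, ⟨hs, hz⟩, rfl⟩ t ht
    exact ⟨(t * s, z), ⟨⟨mul_nonneg ht.1 hs.1, mul_le_one₀ ht.2 hs.1 hs.2⟩, hz⟩, by
      simp [mul_smul]⟩

theorem continuousOn_comp_smul {F : Type*} [TopologicalSpace F] {D : Set ℂ}
    (hD : StarConvex ℝ 0 D) {g : ℂ → F}
    (hg : ContinuousOn g D) {z : ℂ} (hz : z ∈ D) :
    ContinuousOn (fun s : ℝ => g (s • z)) (Icc 0 1) :=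
  hg.comp (by fun_prop) fun _ hs => hD.smul_mem hz hs.1 hs.2

/-- On a star-shaped domain the integral along rays is a primitive of a holomorphic function. -/
theorem hasDerivAt_radialIntegral [CompleteSpace E] {D : Set ℂ} (hDo : IsOpen D)
    (hD : StarConvex ℝ 0 D)
    {g : ℂ → E} (hg : DifferentiableOn ℂ g D) {w : ℂ} (hw : w ∈ D) :
    HasDerivAt (fun z : ℂ => ∫ s in (0 : ℝ)..1, z • g (s • z)) (g w) w := by
  obtain ⟨ε, hε, K, hKD, hK, hball, hKs⟩ := exists_compact_starShaped hDo hD hw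
  have hg' : ContinuousOn (deriv g) D := (hg.deriv hDo).continuousOn
  have hd : ∀ z ∈ D, HasDerivAt g (deriv g z) z := fun z hz =>
    (hg.differentiableAt (hDo.mem_nhds hz)).hasDerivAt
  obtain ⟨C, hC⟩ := (hK.image_of_continuousOn
    ((hg.continuousOn.norm.add (continuousOn_id.norm.mul hg'.norm)).mono hKD)).bddAbove
  have hcont : ∀ z ∈ D, ContinuousOn (fun s : ℝ => z • g (s • z)) (Icc 0 1) := fun z hz =>
    (continuousOn_comp_smul hD hg.continuousOn hz).const_smul z
  have hcont' : ContinuousOn (fun s : ℝ => g (s • w) + (s : ℂ) • w • deriv g (s • w))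
      (Icc 0 1) :=
    (continuousOn_comp_smul hD hg.continuousOn hw).add
      (Complex.continuous_ofReal.continuousOn.smul
        ((continuousOn_comp_smul hD hg' hw).const_smul w))
  have key := intervalIntegral.hasDerivAt_integral_of_dominated_loc_of_deriv_le
    (μ := MeasureTheory.volume) (a := 0) (b := 1)
    (F := fun (z : ℂ) (s : ℝ) => z • g (s • z))
    (F' := fun (z : ℂ) (s : ℝ) => g (s • z) + (s : ℂ) • z • deriv g (s • z)) (x₀ := w)
    (s := Metric.ball w ε) (bound := fun _ => C) (Metric.ball_mem_nhds w hε)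
    (by
      filter_upwards [Metric.ball_mem_nhds w hε] with z hz
      rw [uIoc_of_le zero_le_one]
      exact ((hcont z (hKD (hball (Metric.ball_subset_closedBall hz)))).mono
        Ioc_subset_Icc_self).aestronglyMeasurable measurableSet_Ioc)
    (by
      apply ContinuousOn.intervalIntegrable
      rw [uIcc_of_le zero_le_one]
      exact hcont w hw)
    (by
      rw [uIoc_of_le zero_le_one]
      exact (hcont'.mono Ioc_subset_Icc_self).aestronglyMeasurable measurableSet_Ioc)
    (by
      refine Filter.Eventually.of_forall fun s hs z hz => ?_
      rw [uIoc_of_le zero_le_one] at hs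
      have hz' := hKs z (hball (Metric.ball_subset_closedBall hz)) s ⟨hs.1.le, hs.2⟩
      refine le_trans ?_ (hC (mem_image_of_mem _ hz'))
      refine (norm_add_le _ _).trans ?_
      simp only [Pi.add_apply, Pi.mul_apply, id, norm_smul, Complex.norm_real, mul_assoc, le_refl])
    (by simp)
    (by
      refine Filter.Eventually.of_forall fun s hs z hz => ?_
      rw [uIoc_of_le zero_le_one] at hs
      have hz' := hKD (hKs z (hball (Metric.ball_subset_closedBall hz)) s ⟨hs.1.le, hs.2⟩)
      have h1 : HasDerivAt (fun z : ℂ => g (s • z)) ((s : ℂ) • deriv g (s • z)) z := by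
        have h2 : HasDerivAt (fun z : ℂ => s • z) (s : ℂ) z := by
          simpa using (hasDerivAt_id z).const_mul (s : ℂ)
        exact (hd _ hz').scomp z h2
      have := (hasDerivAt_id z).smul h1
      refine HasDerivAt.congr_deriv this ?_
      simp only [id, one_smul]
      rw [add_comm, smul_comm])
  have hint : ∫ s in (0 : ℝ)..1, (g (s • w) + (s : ℂ) • w • deriv g (s • w)) = g w := by
    have := intervalIntegral.integral_eq_sub_of_hasDerivAt (a := 0) (b := 1)
      (f := fun s : ℝ => s • g (s • w))
      (f' := fun s : ℝ => g (s • w) + (s : ℂ) • w • deriv g (s • w)) ?_ ?_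
    · simpa using this
    · intro s hs
      rw [uIcc_of_le zero_le_one] at hs
      have h1 : HasDerivAt (fun s : ℝ => g (s • w)) (w • deriv g (s • w)) s := by
        have h2 : HasDerivAt (fun s : ℝ => s • w) w s := by
          simpa using (hasDerivAt_id s).smul_const w
        exact (hd _ (hD.smul_mem hw hs.1 hs.2)).scomp s h2
      have := (hasDerivAt_id s).smul h1
      refine HasDerivAt.congr_deriv this ?_
      simp only [id, one_smul, Complex.coe_smul]
      rw [add_comm]
    · apply ContinuousOn.intervalIntegrable
      rw [uIcc_of_le zero_le_one]
      exact hcont'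
  rw [← hint]
  exact key.2

/-- The `n`-th term of the Picard series of the linear equation `y' = L y`, `y 0 = e`. -/
noncomputable def picardTerm (L : ℂ → E →L[ℂ] E) (e : E) : ℕ → ℂ → E
  | 0 => fun _ => e
  | n + 1 => fun z => ∫ s in (0 : ℝ)..1, z • L (s • z) (picardTerm L e n (s • z))

variable {D : Set ℂ} {L : ℂ → E →L[ℂ] E} (e : E)

theorem differentiableOn_picardTerm [CompleteSpace E] (hDo : IsOpen D) (hD : StarConvex ℝ 0 D)
    (hL : DifferentiableOn ℂ L D) (n : ℕ) : DifferentiableOn ℂ (picardTerm L e n) D := by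
  induction n with
  | zero => exact differentiableOn_const e
  | succ n ih => exact fun w hw =>
      (hasDerivAt_radialIntegral hDo hD (hL.clm_apply ih)
        hw).differentiableAt.differentiableWithinAt

theorem hasDerivAt_picardTerm_succ [CompleteSpace E] (hDo : IsOpen D) (hD : StarConvex ℝ 0 D)
    (hL : DifferentiableOn ℂ L D) (n : ℕ) {w : ℂ} (hw : w ∈ D) :
    HasDerivAt (picardTerm L e (n + 1)) (L w (picardTerm L e n w)) w :=
  hasDerivAt_radialIntegral hDo hD (hL.clm_apply (differentiableOn_picardTerm e hDo hD hL n)) hw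

theorem norm_picardTerm_le {K : Set ℂ} (hKs : ∀ z ∈ K, ∀ s ∈ Icc (0 : ℝ) 1, s • z ∈ K)
    {M : ℝ} (hM : ∀ z ∈ K, ‖L z‖ ≤ M) (n : ℕ) {z : ℂ} (hz : z ∈ K) :
    ‖picardTerm L e n z‖ ≤ ‖e‖ * ((M * ‖z‖) ^ n / n.factorial) := by
  have hM0 : 0 ≤ M := (norm_nonneg _).trans (hM z hz)
  induction n generalizing z with
  | zero => simp [picardTerm]
  | succ n ih =>
    have hle := intervalIntegral.norm_integral_le_of_norm_le (a := 0) (b := 1)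
      (μ := MeasureTheory.volume)
      (f := fun s : ℝ => z • L (s • z) (picardTerm L e n (s • z)))
      (g := fun s : ℝ => ‖z‖ * (M * (‖e‖ * ((M * ‖z‖) ^ n / n.factorial))) * s ^ n)
      zero_le_one
      (by
        refine Filter.Eventually.of_forall fun s hs => ?_
        have hsz := hKs z hz s ⟨hs.1.le, hs.2⟩
        rw [norm_smul, mul_assoc]
        refine mul_le_mul_of_nonneg_left ?_ (norm_nonneg z)
        refine ((L (s • z)).le_opNorm _).trans ?_
        refine (mul_le_mul (hM _ hsz) (ih hsz) (norm_nonneg _) hM0).trans (le_of_eq ?_)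
        rw [norm_smul, Real.norm_of_nonneg hs.1.le]
        ring)
      (by apply Continuous.intervalIntegrable; fun_prop)
    refine hle.trans (le_of_eq ?_)
    rw [intervalIntegral.integral_const_mul, integral_pow, Nat.factorial_succ]
    have h1 : (n.factorial : ℝ) ≠ 0 := by positivity
    have h2 : (n : ℝ) + 1 ≠ 0 := by positivity
    push_cast
    simp only [one_pow, ne_eq, Nat.add_eq_zero_iff, one_ne_zero, and_false, not_false_eq_true,
      zero_pow, sub_zero]
    field_simp
    ring

/-- A linear differential equation `y' = L y` with holomorphic coefficient on a star-shaped domain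
has a holomorphic solution with any given initial value at the centre. The Picard series converges
locally uniformly because the estimate of its terms is uniform on star-shaped compact sets. -/
theorem exists_solution_linearODE [CompleteSpace E] (hDo : IsOpen D) (hD : StarConvex ℝ 0 D)
    (hL : DifferentiableOn ℂ L D) :
    ∃ y : ℂ → E, y 0 = e ∧ ∀ w ∈ D, HasDerivAt y (L w (y w)) w := by
  refine ⟨fun z => ∑' n, picardTerm L e n z, ?_, fun w hw => ?_⟩
  · refine (tsum_eq_single 0 ?_).trans rfl
    rintro (_ | n) hn
    · exact absurd rfl hn
    · simp [picardTerm]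
  · obtain ⟨ε, hε, K, hKD, hK, hball, hKs⟩ := exists_compact_starShaped hDo hD hw
    obtain ⟨M, hM⟩ := (hK.image_of_continuousOn (hL.continuousOn.norm.mono hKD)).bddAbove
    replace hM : ∀ z ∈ K, ‖L z‖ ≤ M := fun z hz => hM (mem_image_of_mem _ hz)
    obtain ⟨ρ, hρ⟩ := (hK.image_of_continuousOn continuous_norm.continuousOn).bddAbove
    replace hρ : ∀ z ∈ K, ‖z‖ ≤ ρ := fun z hz => hρ (mem_image_of_mem _ hz)
    have hM0 : 0 ≤ M := (norm_nonneg _).trans (hM w (hball (Metric.mem_closedBall_self hε.le)))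
    have hbound : ∀ n, ∀ z ∈ K,
        ‖picardTerm L e n z‖ ≤ ‖e‖ * ((M * ρ) ^ n / n.factorial) := fun n z hz =>
      (norm_picardTerm_le e hKs hM n hz).trans (by
        have := hρ z hz
        gcongr)
    have hsum : Summable fun n : ℕ => ‖e‖ * ((M * ρ) ^ n / n.factorial) :=
      (Real.summable_pow_div_factorial _).mul_left _
    have hsumE : ∀ z ∈ K, Summable fun n => picardTerm L e n z := fun z hz =>
      .of_norm_bounded hsum fun n => hbound n z hz
    have hwK : w ∈ K := hball (Metric.mem_closedBall_self hε.le)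
    let g' : ℕ → ℂ → E := fun n z => n.casesOn 0 fun m => L z (picardTerm L e m z)
    let b : ℕ → ℝ := fun n => n.casesOn 0 fun m => M * (‖e‖ * ((M * ρ) ^ m / m.factorial))
    have key := hasDerivAt_tsum_of_isPreconnected (g := picardTerm L e) (g' := g') (u := b)
      (t := Metric.ball w ε) (y₀ := w) (y := w)
      ((summable_nat_add_iff 1).1 (hsum.mul_left M)) Metric.isOpen_ball
      (convex_ball w ε).isPreconnected
      (by
        rintro (_ | n) z hz
        · exact hasDerivAt_const z e
        · exact hasDerivAt_picardTerm_succ e hDo hD hL n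
            (hKD (hball (Metric.ball_subset_closedBall hz))))
      (by
        rintro (_ | n) z hz
        · simp [g', b]
        · have hzK := hball (Metric.ball_subset_closedBall hz)
          exact ((L z).le_opNorm _).trans
            (mul_le_mul (hM z hzK) (hbound n z hzK) (norm_nonneg _) hM0))
      (Metric.mem_ball_self hε) (hsumE w hwK) (Metric.mem_ball_self hε)
    convert key using 1
    have hg'sum : Summable fun n => g' n w :=
      (summable_nat_add_iff 1).1 ((L w).summable (hsumE w hwK))
    rw [hg'sum.tsum_eq_zero_add, (L w).map_tsum (hsumE w hwK)]
    simp [g']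

end LinearODE

/-! ### The BMW relations of type `A₂` -/

/-- The elements `x, y, e, f` of a `ℂ`-algebra satisfy the relations of the generators
`X_i, X_j, E_i, E_j`, `i ≠ j`, of the classical BMW algebra `B_3(q, l)`. -/
structure IsBMWPair {A : Type*} [Ring A] [Algebra ℂ A] (q l : ℂ) (x y e f : A) : Prop where
  braid : x * y * x = y * x * y
  xye : x * y * e = f * x * y
  yxf : y * x * f = e * y * x
  quad_x : l • (x ^ 2 + nuPar q • x - 1) = nuPar q • e
  quad_y : l • (y ^ 2 + nuPar q • y - 1) = nuPar q • f
  xe : x * e = l⁻¹ • e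
  yf : y * f = l⁻¹ • f
  eye : e * y * e = l • e
  fxf : f * x * f = l • f
  ee : e ^ 2 = tauPar q l • e
  ff : f ^ 2 = tauPar q l • f

namespace IsBMWPair

variable {A : Type*} [Ring A] [Algebra ℂ A] {q l : ℂ} {x y e f : A}

theorem symm (h : IsBMWPair q l x y e f) : IsBMWPair q l y x f e :=
  ⟨h.braid.symm, h.yxf, h.xye, h.quad_y, h.quad_x, h.yf, h.xe, h.fxf, h.eye, h.ff, h.ee⟩

theorem x_mul_x (h : IsBMWPair q l x y e f) (hl : l ≠ 0) :
    x * x = 1 - nuPar q • x + (nuPar q * l⁻¹) • e := by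
  have h1 : x ^ 2 + nuPar q • x - 1 = (nuPar q * l⁻¹) • e := by
    rw [mul_comm, mul_smul, ← h.quad_x, smul_smul, inv_mul_cancel₀ hl, one_smul]
  rw [← h1, pow_two]
  abel

theorem e_eq (h : IsBMWPair q l x y e f) (hν : nuPar q ≠ 0) :
    e = ((nuPar q)⁻¹ * l) • (x * x + nuPar q • x - 1) := by
  rw [mul_smul, ← pow_two, h.quad_x, smul_smul, inv_mul_cancel₀ hν, one_smul]

theorem ex (h : IsBMWPair q l x y e f) (hν : nuPar q ≠ 0) : e * x = l⁻¹ • e := by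
  rw [← h.xe, h.e_eq hν]
  simp only [smul_mul_assoc, mul_smul_comm, sub_mul, mul_sub, add_mul, mul_add, mul_assoc,
    one_mul, mul_one]

/-- The inverse of `x` is `x + ν - ν e`. -/
theorem x_mul_inv (h : IsBMWPair q l x y e f) (hl : l ≠ 0) :
    x * (x + nuPar q • 1 - nuPar q • e) = 1 := by
  rw [mul_sub, mul_add, h.x_mul_x hl, mul_smul_comm, mul_smul_comm, h.xe, mul_one, mul_smul]
  abel

theorem inv_mul_x (h : IsBMWPair q l x y e f) (hl : l ≠ 0) (hν : nuPar q ≠ 0) :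
    (x + nuPar q • 1 - nuPar q • e) * x = 1 := by
  rw [sub_mul, add_mul, h.x_mul_x hl, smul_mul_assoc, smul_mul_assoc, h.ex hν, one_mul, mul_smul]
  abel

theorem e_mul_inv (h : IsBMWPair q l x y e f) (hl : l ≠ 0) (hν : nuPar q ≠ 0) :
    e * (x + nuPar q • 1 - nuPar q • e) = l • e := by
  have h1 := congrArg (· * (x + nuPar q • 1 - nuPar q • e)) (h.ex hν)
  simp only [mul_assoc, h.x_mul_inv hl, mul_one, smul_mul_assoc] at h1
  have h2 := congrArg (l • ·) h1
  simpa only [smul_smul, mul_inv_cancel₀ hl, one_smul] using h2.symm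

/-- `E_j E_i = X_i⁻¹ X_j⁻¹ E_i`. -/
theorem f_mul_e (h : IsBMWPair q l x y e f) (hl : l ≠ 0) (hν : nuPar q ≠ 0) :
    f * e = (x + nuPar q • 1 - nuPar q • e) * (y + nuPar q • 1 - nuPar q • f) * e := by
  have hx := h.x_mul_inv hl
  have hx' := h.inv_mul_x hl hν
  have hy := h.symm.x_mul_inv hl
  have hy' := h.symm.inv_mul_x hl hν
  have hfy := h.symm.e_mul_inv hl hν
  generalize x + nuPar q • 1 - nuPar q • e = xi at *
  generalize y + nuPar q • 1 - nuPar q • f = yi at *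
  have h1 : f * x * f = l • (f * e * y * x) :=
    calc f * x * f = f * (yi * y) * x * f := by rw [hy', mul_one]
      _ = f * yi * (y * x * f) := by simp only [mul_assoc]
      _ = l • (f * e * y * x) := by
        rw [hfy, h.yxf, smul_mul_assoc]; simp only [mul_assoc]
  have h2 : f * e * y * x = f := by
    rw [h.fxf] at h1
    exact (smul_right_injective A hl h1).symm
  calc f * e = f * e * (y * (x * xi) * yi) := by rw [hx, mul_one, hy, mul_one]
    _ = f * e * y * x * xi * yi := by simp only [mul_assoc]
    _ = xi * (yi * y) * x * f * xi * yi := by rw [h2, hy', mul_one, hx', one_mul]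
    _ = xi * yi * (y * x * f) * xi * yi := by simp only [mul_assoc]
    _ = xi * yi * e * (y * (x * xi) * yi) := by rw [h.yxf]; simp only [mul_assoc]
    _ = xi * yi * e := by rw [hx, mul_one, hy, mul_one]

/-- `E_i E_j E_i = E_i`; this is where `1 + l (q⁻¹ - q) ≠ 0` is needed. -/
theorem e_f_e (h : IsBMWPair q l x y e f) (hl : l ≠ 0) (hν : nuPar q ≠ 0)
    (hlν : 1 + l * nuPar q ≠ 0) : e * f * e = e := by
  have h1 : e * f * e = l • (l • e + (nuPar q * tauPar q l) • e - nuPar q • (e * f * e)) := by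
    calc e * f * e = e * (f * e) := mul_assoc _ _ _
      _ = e * (x + nuPar q • 1 - nuPar q • e) * (y + nuPar q • 1 - nuPar q • f) * e := by
        rw [h.f_mul_e hl hν]; simp only [mul_assoc]
      _ = l • (e * y * e + nuPar q • e ^ 2 - nuPar q • (e * f * e)) := by
        rw [h.e_mul_inv hl hν]
        simp only [smul_mul_assoc, mul_sub, mul_add, sub_mul, add_mul, mul_smul_comm, mul_one,
          pow_two, smul_sub, smul_add, smul_comm l]
      _ = _ := by rw [h.eye, h.ee, smul_smul]
  have h2 : (1 + l * nuPar q) • (e * f * e) = (1 + l * nuPar q) • e := by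
    have h3 : l * (l + nuPar q * tauPar q l) = 1 + l * nuPar q := by
      rw [tauPar]; field_simp; ring
    rw [add_smul, one_smul]
    nth_rewrite 1 [h1]
    rw [← h3]
    module
  exact smul_right_injective A hlν h2

theorem fe (h : IsBMWPair q l x y e f) (hl : l ≠ 0) (hν : nuPar q ≠ 0)
    (hlν : 1 + l * nuPar q ≠ 0) : f * e = x * y * e := by
  have h1 : x * (f * e) = y * e + nuPar q • e - nuPar q • (f * e) := by
    rw [h.f_mul_e hl hν, ← mul_assoc, ← mul_assoc, h.x_mul_inv hl, one_mul, sub_mul, add_mul,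
      smul_mul_assoc, smul_mul_assoc, one_mul, ← h.f_mul_e hl hν]
  have h2 : (x + nuPar q • 1 - nuPar q • e) * (f * e) = y * e := by
    rw [sub_mul, add_mul, h1, smul_mul_assoc, smul_mul_assoc, one_mul, ← mul_assoc e,
      h.e_f_e hl hν hlν]
    abel
  rw [mul_assoc, ← h2, ← mul_assoc, h.x_mul_inv hl, one_mul]

/-- The left ideal generated by `E_i` is spanned by `E_i`, `X_j E_i` and `X_i X_j E_i`. -/
theorem mul_mem_span (h : IsBMWPair q l x y e f) (hl : l ≠ 0) (hν : nuPar q ≠ 0)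
    (hlν : 1 + l * nuPar q ≠ 0) {z : A}
    (hz : z ∈ Submodule.span ℂ ({e, y * e, x * y * e} : Set A)) :
    x * z ∈ Submodule.span ℂ ({e, y * e, x * y * e} : Set A) ∧
      y * z ∈ Submodule.span ℂ ({e, y * e, x * y * e} : Set A) := by
  set L := Submodule.span ℂ ({e, y * e, x * y * e} : Set A)
  have m0 : e ∈ L := Submodule.subset_span (by simp)
  have m1 : y * e ∈ L := Submodule.subset_span (by simp)
  have m2 : x * y * e ∈ L := Submodule.subset_span (by simp)
  induction hz using Submodule.span_induction with
  | zero => simp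
  | add a b _ _ ha hb =>
    rw [mul_add, mul_add]
    exact ⟨L.add_mem ha.1 hb.1, L.add_mem ha.2 hb.2⟩
  | smul c a _ ha =>
    rw [mul_smul_comm, mul_smul_comm]
    exact ⟨L.smul_mem c ha.1, L.smul_mem c ha.2⟩
  | mem z hz =>
    rcases hz with rfl | rfl | rfl
    · exact ⟨by rw [h.xe]; exact L.smul_mem _ m0, m1⟩
    · refine ⟨by rwa [← mul_assoc], ?_⟩
      rw [← mul_assoc, h.symm.x_mul_x hl, add_mul, sub_mul, one_mul, smul_mul_assoc,
        smul_mul_assoc, h.fe hl hν hlν]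
      exact L.add_mem (L.sub_mem m0 (L.smul_mem _ m1)) (L.smul_mem _ m2)
    · constructor
      · have : x * (x * y * e) = x * x * (y * e) := by simp only [mul_assoc]
        rw [this, h.x_mul_x hl, add_mul, sub_mul, one_mul, smul_mul_assoc, smul_mul_assoc,
          ← mul_assoc, ← mul_assoc, h.eye]
        exact L.add_mem (L.sub_mem m1 (L.smul_mem _ m2)) (L.smul_mem _ (L.smul_mem _ m0))
      · have : y * (x * y * e) = x * y * x * e := by rw [h.braid]; simp only [mul_assoc]
        rw [this, mul_assoc, h.xe, mul_smul_comm]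
        exact L.smul_mem _ m2

theorem e_mul_of_mem_span (h : IsBMWPair q l x y e f) (hν : nuPar q ≠ 0) {z : A}
    (hz : z ∈ Submodule.span ℂ ({e, y * e, x * y * e} : Set A)) : ∃ c : ℂ, e * z = c • e := by
  induction hz using Submodule.span_induction with
  | zero => exact ⟨0, by simp⟩
  | add a b _ _ ha hb =>
    obtain ⟨c, hc⟩ := ha
    obtain ⟨d, hd⟩ := hb
    exact ⟨c + d, by rw [mul_add, hc, hd, add_smul]⟩
  | smul c a _ ha =>
    obtain ⟨d, hd⟩ := ha
    exact ⟨c * d, by rw [mul_smul_comm, hd, mul_smul]⟩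
  | mem z hz =>
    rcases hz with rfl | rfl | rfl
    · exact ⟨_, by rw [← pow_two, h.ee]⟩
    · exact ⟨_, by rw [← mul_assoc, h.eye]⟩
    · exact ⟨l⁻¹ * l, by
        rw [← mul_assoc, ← mul_assoc, h.ex hν, smul_mul_assoc, smul_mul_assoc, h.eye, smul_smul]⟩

end IsBMWPair

theorem evalWord_one {I : Type} {A : Type*} [Monoid A] (x e : I → A) : evalWord x e 1 = 1 :=
  map_one _

theorem evalWord_of_X {I : Type} {A : Type*} [Monoid A] (x e : I → A) (i : I) :
    evalWord x e (FreeMonoid.of (Letter.X i)) = x i :=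
  FreeMonoid.lift_eval_of _ _

theorem evalWord_of_E {I : Type} {A : Type*} [Monoid A] (x e : I → A) (i : I) :
    evalWord x e (FreeMonoid.of (Letter.E i)) = e i :=
  FreeMonoid.lift_eval_of _ _

theorem map_evalWord {I : Type} {A B F : Type*} [Monoid A] [Monoid B] [FunLike F A B]
    [MonoidHomClass F A B] (φ : F) (x e : I → A) (w : FreeMonoid (Letter I)) :
    φ (evalWord x e w) = evalWord (fun i => φ (x i)) (fun i => φ (e i)) w := by
  induction w using FreeMonoid.inductionOn with
  | one => simp
  | of a => cases a <;> simp [evalWord_of_X, evalWord_of_E]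
  | mul a b ha hb => simp [ha, hb]

/-- In an algebra satisfying the relations of `B_3(q, l)`, every `E_i w E_i` is a multiple
of `E_i`. -/
theorem exists_sandwich_eq_smul {A : Type*} [Ring A] [Algebra ℂ A] {q l : ℂ} {x e : Fin 2 → A}
    {i j : Fin 2} (hij : i ≠ j) (h : IsBMWPair q l (x i) (x j) (e i) (e j)) (hl : l ≠ 0)
    (hν : nuPar q ≠ 0) (hlν : 1 + l * nuPar q ≠ 0) (w : FreeMonoid (Letter (Fin 2))) :
    ∃ c : ℂ, e i * evalWord x e w * e i = c • e i := by
  set L := Submodule.span ℂ ({e i, x j * e i, x i * x j * e i} : Set A) with hL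
  have hcases : ∀ k : Fin 2, k = i ∨ k = j := by omega
  have hX : ∀ k, ∀ z ∈ L, x k * z ∈ L := fun k z hz => by
    rcases hcases k with rfl | rfl
    · exact (h.mul_mem_span hl hν hlν hz).1
    · exact (h.mul_mem_span hl hν hlν hz).2
  have hE : ∀ k, ∀ z ∈ L, e k * z ∈ L := fun k z hz => by
    have hk : e k = ((nuPar q)⁻¹ * l) • (x k * x k + nuPar q • x k - 1) := by
      rcases hcases k with rfl | rfl
      · exact h.e_eq hν
      · exact h.symm.e_eq hν
    rw [hk, smul_mul_assoc, sub_mul, add_mul, smul_mul_assoc, one_mul, mul_assoc]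
    exact L.smul_mem _ (L.sub_mem (L.add_mem (hX k _ (hX k z hz)) (L.smul_mem _ (hX k z hz))) hz)
  have hw : ∀ z ∈ L, evalWord x e w * z ∈ L := by
    induction w using FreeMonoid.inductionOn with
    | one => simp
    | of a =>
      cases a with
      | X k => rw [evalWord_of_X]; exact hX k
      | E k => rw [evalWord_of_E]; exact hE k
    | mul a b ha hb =>
      intro z hz
      rw [map_mul, mul_assoc]
      exact ha _ (hb _ hz)
  rw [mul_assoc]
  exact h.e_mul_of_mem_span hν (hw _ (Submodule.subset_span (by simp)))

theorem adj_pathGraph_two {i j : Fin 2} : (SimpleGraph.pathGraph 2).Adj i j ↔ i ≠ j := by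
  rw [SimpleGraph.pathGraph_adj]
  omega

/-- The generators of `B_3(q, l)` satisfy its defining relations. -/
theorem isBMWPair_generators (q l : ℂ) {i j : Fin 2} (hij : i ≠ j) :
    IsBMWPair q l (cX q l i) (cX q l j) (cE q l i) (cE q l j) := by
  have hA := adj_pathGraph_two.2 hij
  have hA' := adj_pathGraph_two.2 hij.symm
  have key : ∀ {a b}, BMWRel (SimpleGraph.pathGraph 2) q l a b →
      RingQuot.mkAlgHom ℂ (BMWRel _ q l) a = RingQuot.mkAlgHom ℂ (BMWRel _ q l) b :=
    fun h => RingQuot.mkAlgHom_rel ℂ h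
  constructor
  · simpa only [cX, cE, map_mul] using key (.braid hA)
  · simpa only [cX, cE, map_mul] using key (.XXE hA)
  · simpa only [cX, cE, map_mul] using key (.XXE hA')
  · simpa only [cX, cE, map_mul, map_smul, map_sub, map_add, map_pow, map_one] using key (.quad i)
  · simpa only [cX, cE, map_mul, map_smul, map_sub, map_add, map_pow, map_one] using key (.quad j)
  · simpa only [cX, cE, map_mul, map_smul] using key (.XE i)
  · simpa only [cX, cE, map_mul, map_smul] using key (.XE j)
  · simpa only [cX, cE, map_mul, map_smul] using key (.EXE hA)
  · simpa only [cX, cE, map_mul, map_smul] using key (.EXE hA')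
  · simpa only [cX, cE, map_pow, map_smul] using key (.EE i)
  · simpa only [cX, cE, map_pow, map_smul] using key (.EE j)

/-- The universal property of `B_3(q, l)`. -/
theorem exists_algHom_of_isBMWPair {A : Type*} [Ring A] [Algebra ℂ A] {q l : ℂ} {x e : Fin 2 → A}
    (h : IsBMWPair q l (x 0) (x 1) (e 0) (e 1)) (hν : nuPar q ≠ 0) :
    ∃ φ : BMW3 q l →ₐ[ℂ] A, (∀ i, φ (cX q l i) = x i) ∧ ∀ i, φ (cE q l i) = e i := by
  let f : FreeAlgebra ℂ (Letter (Fin 2)) →ₐ[ℂ] A := FreeAlgebra.lift ℂ fun a => match a with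
    | Letter.X i => x i
    | Letter.E i => e i
  have fX : ∀ i, f (bX i) = x i := fun i => FreeAlgebra.lift_ι_apply _ _
  have fE : ∀ i, f (bE i) = e i := fun i => FreeAlgebra.lift_ι_apply _ _
  have hpair : ∀ i j : Fin 2, i ≠ j → IsBMWPair q l (x i) (x j) (e i) (e j) := by
    intro i j hij
    obtain ⟨rfl, rfl⟩ | ⟨rfl, rfl⟩ : (i = 0 ∧ j = 1) ∨ (i = 1 ∧ j = 0) := by omega
    · exact h
    · exact h.symm
  have hone : ∀ i : Fin 2, ∃ j, i ≠ j := fun i => ⟨i + 1, by omega⟩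
  have hf : ∀ ⦃a b⦄, BMWRel (SimpleGraph.pathGraph 2) q l a b → f a = f b := by
    intro a b hab
    cases hab with
    | braid hA => simpa only [map_mul, fX, fE] using (hpair _ _ (adj_pathGraph_two.1 hA)).braid
    | XXE hA => simpa only [map_mul, fX, fE] using (hpair _ _ (adj_pathGraph_two.1 hA)).xye
    | commXX hA =>
      obtain rfl := not_not.1 fun hne => hA (adj_pathGraph_two.2 hne)
      rfl
    | quad i =>
      obtain ⟨j, hij⟩ := hone i
      simpa only [map_mul, map_smul, map_sub, map_add, map_pow, map_one, fX, fE]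
        using (hpair _ _ hij).quad_x
    | XE i =>
      obtain ⟨j, hij⟩ := hone i
      simpa only [map_mul, map_smul, fX, fE] using (hpair _ _ hij).xe
    | EXE hA =>
      simpa only [map_mul, map_smul, fX, fE] using (hpair _ _ (adj_pathGraph_two.1 hA)).eye
    | @commXE i j hA =>
      obtain rfl := not_not.1 fun hne => hA (adj_pathGraph_two.2 hne)
      obtain ⟨j, hij⟩ := hone i
      simp only [map_mul, fX, fE]
      rw [(hpair _ _ hij).xe, (hpair _ _ hij).ex hν]
    | EE i =>
      obtain ⟨j, hij⟩ := hone i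
      simpa only [map_pow, map_smul, fX, fE] using (hpair _ _ hij).ee
  refine ⟨RingQuot.liftAlgHom ℂ ⟨f, hf⟩, fun i => ?_, fun i => ?_⟩
  · exact (RingQuot.liftAlgHom_mkAlgHom_apply ℂ f hf (bX i)).trans (fX i)
  · exact (RingQuot.liftAlgHom_mkAlgHom_apply ℂ f hf (bE i)).trans (fE i)

/-! ### The isomorphism, given the values of `Φ` -/

theorem qPar_ne_zero (k κ : ℂ) : qPar k κ ≠ 0 := Complex.exp_ne_zero _

theorem lPar_ne_zero (k α κ : ℂ) : lPar k α κ ≠ 0 :=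
  div_ne_zero (Complex.exp_ne_zero _) (qPar_ne_zero k κ)

theorem nuPar_ne_zero {q : ℂ} (hq0 : q ≠ 0) (hq : q ^ 2 ≠ 1) : nuPar q ≠ 0 := by
  intro h
  apply hq
  rw [nuPar, sub_eq_zero] at h
  rw [pow_two]
  nth_rewrite 1 [← h]
  exact inv_mul_cancel₀ hq0

theorem sub_mul_add_inv {A : Type*} [Ring A] [Algebra ℂ A] {q : ℂ} (hq : q ≠ 0) (x : A) :
    (x - q • (1 : A)) * (x + q⁻¹ • (1 : A)) = x ^ 2 + nuPar q • x - 1 := by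
  simp only [sub_mul, mul_add, smul_mul_assoc, mul_smul_comm, mul_one, one_mul, smul_sub,
    smul_smul, inv_mul_cancel₀ hq, nuPar, pow_two, sub_smul, one_smul]
  abel

section Isomorphism

variable {k α κ : ℂ} {p : Fin 2 → ℝ}

/-- The relations of `B_3(q, l)` hold in `B_{D_3}(Π, κ)`: the quadratic relation expresses `E_i` as
a polynomial in `X_i`, and then `X_i X_j E_i = E_j X_i X_j` follows from the braid relation. -/
theorem isBMWPair_dihedral
    (hone : ∀ i, Phi 3 k α κ p i 1 = tauPar (qPar k κ) (lPar k α κ))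
    (hX : ∀ i j : Fin 2, i ≠ j →
      Phi 3 k α κ p i (FreeMonoid.of (Letter.X j)) = lPar k α κ)
    (hν : nuPar (qPar k κ) ≠ 0) :
    IsBMWPair (qPar k κ) (lPar k α κ) (dX 3 k α κ p 0) (dX 3 k α κ p 1) (dE 3 k α κ p 0)
      (dE 3 k α κ p 1) := by
  have key : ∀ {a b}, DRel 3 k α κ p a b →
      RingQuot.mkAlgHom ℂ (DRel 3 k α κ p) a = RingQuot.mkAlgHom ℂ (DRel 3 k α κ p) b :=
    fun h => RingQuot.mkAlgHom_rel ℂ h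
  have braid : dX 3 k α κ p 0 * dX 3 k α κ p 1 * dX 3 k α κ p 0 =
      dX 3 k α κ p 1 * dX 3 k α κ p 0 * dX 3 k α κ p 1 := by
    simpa only [altProd, mul_one, map_mul, ← mul_assoc, dX] using key .braid
  have quad : ∀ i, lPar k α κ • (dX 3 k α κ p i ^ 2 + nuPar (qPar k κ) • dX 3 k α κ p i - 1) =
      nuPar (qPar k κ) • dE 3 k α κ p i := fun i => by
    have h := key (.quad i)
    simp only [Algebra.algebraMap_eq_smul_one, sub_mul_add_inv (qPar_ne_zero k κ), map_smul,
      map_sub, map_add, map_pow, map_one] at h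
    exact h.symm
  have hE : ∀ i, dE 3 k α κ p i = ((nuPar (qPar k κ))⁻¹ * lPar k α κ) •
      (dX 3 k α κ p i ^ 2 + nuPar (qPar k κ) • dX 3 k α κ p i - 1) := fun i => by
    rw [mul_smul, quad, smul_smul, inv_mul_cancel₀ hν, one_smul]
  have XXE : ∀ {x y : DihedralAlg 3 k α κ p}, x * y * x = y * x * y →
      ∀ c d : ℂ, x * y * (c • (x ^ 2 + d • x - 1)) = (c • (y ^ 2 + d • y - 1)) * x * y := by
    intro x y h c d
    have h2 : x * y * (x * x) = y * y * x * y := by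
      rw [← mul_assoc, h, mul_assoc _ y, mul_assoc y x, ← mul_assoc x y, h]
      simp only [mul_assoc]
    simp only [mul_smul_comm, smul_mul_assoc, mul_sub, mul_add, sub_mul, add_mul, pow_two, h2,
      mul_one, one_mul, h]
  constructor
  · exact braid
  · rw [hE 0, hE 1]; exact XXE braid _ _
  · rw [hE 0, hE 1]; exact XXE braid.symm _ _
  · exact quad 0
  · exact quad 1
  · simpa only [dX, dE, map_mul, map_smul] using key (.X_mul_E 0)
  · simpa only [dX, dE, map_mul, map_smul] using key (.X_mul_E 1)
  · have := key (.sandwich 0 (FreeMonoid.of (Letter.X 1)))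
    rwa [evalWord_of_X, hX 0 1 (by simp), map_mul, map_mul, map_smul] at this
  · have := key (.sandwich 1 (FreeMonoid.of (Letter.X 0)))
    rwa [evalWord_of_X, hX 1 0 (by simp), map_mul, map_mul, map_smul] at this
  · have := key (.sandwich 0 1)
    rwa [evalWord_one, hone, mul_one, map_mul, map_smul, ← pow_two] at this
  · have := key (.sandwich 1 1)
    rwa [evalWord_one, hone, mul_one, map_mul, map_smul, ← pow_two] at this

/-- The homomorphism `B_{D_3}(Π, κ) → B_3(q, l)`. -/
theorem exists_algHom_dihedral
    (hsand : ∀ (i : Fin 2) (w : FreeMonoid (Letter (Fin 2))),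
      cE (qPar k κ) (lPar k α κ) i *
          evalWord (cX (qPar k κ) (lPar k α κ)) (cE (qPar k κ) (lPar k α κ)) w *
          cE (qPar k κ) (lPar k α κ) i =
        Phi 3 k α κ p i w • cE (qPar k κ) (lPar k α κ) i)
    (hν : nuPar (qPar k κ) ≠ 0) :
    ∃ φ : DihedralAlg 3 k α κ p →ₐ[ℂ] BMW3 (qPar k κ) (lPar k α κ),
      (∀ i, φ (dX 3 k α κ p i) = cX (qPar k κ) (lPar k α κ) i) ∧
      ∀ i, φ (dE 3 k α κ p i) = cE (qPar k κ) (lPar k α κ) i := by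
  set q := qPar k κ
  set l := lPar k α κ
  have hl : l ≠ 0 := lPar_ne_zero k α κ
  let f : FreeAlgebra ℂ DGen →ₐ[ℂ] BMW3 q l := FreeAlgebra.lift ℂ fun a => match a with
    | DGen.X i => cX q l i
    | DGen.Xinv i => cX q l i + nuPar q • 1 - nuPar q • cE q l i
    | DGen.E i => cE q l i
  have fX : ∀ i, f (gX i) = cX q l i := fun i => FreeAlgebra.lift_ι_apply _ _
  have fXinv : ∀ i, f (gXinv i) = cX q l i + nuPar q • 1 - nuPar q • cE q l i :=
    fun i => FreeAlgebra.lift_ι_apply _ _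
  have fE : ∀ i, f (gE i) = cE q l i := fun i => FreeAlgebra.lift_ι_apply _ _
  have hpair : ∀ i : Fin 2, ∃ j, i ≠ j ∧
      IsBMWPair q l (cX q l i) (cX q l j) (cE q l i) (cE q l j) := fun i =>
    ⟨i + 1, by omega, isBMWPair_generators q l (by omega)⟩
  have hf : ∀ ⦃a b⦄, DRel 3 k α κ p a b → f a = f b := by
    intro a b hab
    cases hab with
    | mul_inv i =>
      obtain ⟨j, -, h⟩ := hpair i
      rw [map_mul, fX, fXinv, map_one, h.x_mul_inv hl]
    | inv_mul i =>
      obtain ⟨j, -, h⟩ := hpair i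
      rw [map_mul, fX, fXinv, map_one, h.inv_mul_x hl hν]
    | braid =>
      simp only [altProd, mul_one, map_mul, fX, ← mul_assoc]
      exact (isBMWPair_generators q l (by simp : (0 : Fin 2) ≠ 1)).braid
    | quad i =>
      obtain ⟨j, -, h⟩ := hpair i
      simp only [Algebra.algebraMap_eq_smul_one]
      rw [sub_mul_add_inv (qPar_ne_zero k κ)]
      simp only [map_smul, map_sub, map_add, map_pow, map_one, fX, fE]
      exact h.quad_x.symm
    | X_mul_E i =>
      obtain ⟨j, -, h⟩ := hpair i
      rw [map_mul, map_smul, fX, fE, h.xe]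
    | E_mul_X i =>
      obtain ⟨j, -, h⟩ := hpair i
      rw [map_mul, map_smul, fX, fE, h.ex hν]
    | sandwich i w =>
      rw [map_mul, map_mul, map_smul, map_evalWord]
      simp only [fX, fE]
      exact hsand i w
  refine ⟨RingQuot.liftAlgHom ℂ ⟨f, hf⟩, fun i => ?_, fun i => ?_⟩
  · exact (RingQuot.liftAlgHom_mkAlgHom_apply ℂ f hf (gX i)).trans (fX i)
  · exact (RingQuot.liftAlgHom_mkAlgHom_apply ℂ f hf (gE i)).trans (fE i)

theorem exists_algEquiv_dihedral
    (hsand : ∀ (i : Fin 2) (w : FreeMonoid (Letter (Fin 2))),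
      cE (qPar k κ) (lPar k α κ) i *
          evalWord (cX (qPar k κ) (lPar k α κ)) (cE (qPar k κ) (lPar k α κ)) w *
          cE (qPar k κ) (lPar k α κ) i =
        Phi 3 k α κ p i w • cE (qPar k κ) (lPar k α κ) i)
    (hone : ∀ i, Phi 3 k α κ p i 1 = tauPar (qPar k κ) (lPar k α κ))
    (hX : ∀ i j : Fin 2, i ≠ j →
      Phi 3 k α κ p i (FreeMonoid.of (Letter.X j)) = lPar k α κ)
    (hν : nuPar (qPar k κ) ≠ 0) :
    ∃ φ : DihedralAlg 3 k α κ p ≃ₐ[ℂ] BMW3 (qPar k κ) (lPar k α κ), ∀ i : Fin 2,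
      φ (dX 3 k α κ p i) = cX (qPar k κ) (lPar k α κ) i ∧
      φ (dE 3 k α κ p i) = cE (qPar k κ) (lPar k α κ) i := by
  obtain ⟨φ, φX, φE⟩ := exists_algHom_dihedral hsand hν
  obtain ⟨ψ, ψX, ψE⟩ := exists_algHom_of_isBMWPair (isBMWPair_dihedral hone hX hν) hν
  refine ⟨AlgEquiv.ofAlgHom φ ψ ?_ ?_, fun i => ⟨φX i, φE i⟩⟩
  · apply RingQuot.ringQuot_ext'
    apply FreeAlgebra.hom_ext
    funext a
    cases a with
    | X i => exact (congrArg φ (ψX i)).trans (φX i)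
    | E i => exact (congrArg φ (ψE i)).trans (φE i)
  · have hXX : ∀ i, ψ (φ (dX 3 k α κ p i)) = dX 3 k α κ p i := fun i => by rw [φX, ψX]
    apply RingQuot.ringQuot_ext'
    apply FreeAlgebra.hom_ext
    funext a
    cases a with
    | X i => exact hXX i
    | E i => exact (congrArg ψ (φE i)).trans (ψE i)
    | Xinv i =>
      -- an algebra endomorphism fixing `X_i` fixes its inverse
      have h1 : dX 3 k α κ p i * RingQuot.mkAlgHom ℂ (DRel 3 k α κ p) (gXinv i) = 1 := by
        simpa only [dX, map_mul, map_one] using RingQuot.mkAlgHom_rel ℂ (DRel.mul_inv (p := p) i)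
      have h2 : RingQuot.mkAlgHom ℂ (DRel 3 k α κ p) (gXinv i) * dX 3 k α κ p i = 1 := by
        simpa only [dX, map_mul, map_one] using RingQuot.mkAlgHom_rel ℂ (DRel.inv_mul (p := p) i)
      have h3 := congrArg (fun z => ψ (φ z)) h1
      simp only [map_mul, map_one, hXX] at h3
      exact (left_inv_eq_right_inv h2 h3).symm

end Isomorphism

/-! ### Three-dimensional matrices with prescribed eigenvalues -/

open Matrix

/-- A case of Jacobi's formula for the minors of the adjugate. -/
theorem adjugate_minor (B : Matrix (Fin 3) (Fin 3) ℂ) (i j : Fin 3) :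
    B.adjugate i j * B.adjugate (i + 1) (j + 1) - B.adjugate i (j + 1) * B.adjugate (i + 1) j =
      B.det * B (j + 2) (i + 2) := by
  rw [det_fin_three, adjugate_fin_three]
  fin_cases i <;> fin_cases j <;>
    simp only [Fin.zero_eta, Fin.mk_one, Fin.reduceFinMk, Fin.reduceAdd, zero_add, of_apply,
      cons_val', cons_val_zero, cons_val_one, cons_val_fin_one, cons_val, Fin.isValue] <;>
    ring

/-- The adjugate of a singular `3 × 3` matrix has rank at most one. -/
theorem adjugate_minor_of_det_eq_zero {B : Matrix (ZMod 3) (ZMod 3) ℂ} (hB : B.det = 0)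
    (i j k l : ZMod 3) :
    B.adjugate i j * B.adjugate k l = B.adjugate i l * B.adjugate k j := by
  have main : ∀ {B : Matrix (Fin 3) (Fin 3) ℂ}, B.det = 0 → ∀ i j k l : Fin 3,
      B.adjugate i j * B.adjugate k l = B.adjugate i l * B.adjugate k j := by
    intro B hB i j k l
    have h : ∀ i j, B.adjugate i j * B.adjugate (i + 1) (j + 1) -
        B.adjugate i (j + 1) * B.adjugate (i + 1) j = 0 := fun i j => by
      rw [adjugate_minor, hB, zero_mul]
    have hcases : ∀ i k : Fin 3, k = i ∨ k = i + 1 ∨ i = k + 1 := by decide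
    rcases hcases i k with rfl | rfl | rfl
    · ring
    all_goals
      rcases hcases j l with rfl | rfl | rfl
      · ring
    · linear_combination h i j
    · linear_combination -h i l
    · linear_combination -h k j
    · linear_combination h k l
  exact main hB i j k l

/-- `e M e = tr(e M) e` for a matrix `e` of rank one. -/
theorem mul_mul_eq_trace_smul {n : Type*} [Fintype n] {e : Matrix n n ℂ}
    (he : ∀ i j k l, e i j * e k l = e i l * e k j) (M : Matrix n n ℂ) :
    e * M * e = (e * M).trace • e := by
  ext i l
  rw [Matrix.smul_apply, smul_eq_mul]
  simp only [Matrix.mul_apply, trace, diag_apply, Finset.sum_mul]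
  refine Finset.sum_congr rfl fun k _ => Finset.sum_congr rfl fun j _ => ?_
  linear_combination M j k * he i j k l

theorem adjugate_sub_smul_one (T : Matrix (ZMod 3) (ZMod 3) ℂ) {a b c : ℂ}
    (h : ∀ x : ℂ, (x • (1 : Matrix (ZMod 3) (ZMod 3) ℂ) - T).det = (x - a) * (x - b) * (x - c)) :
    (T - a • 1).adjugate = (T - b • 1) * (T - c • 1) ∧ T.trace = a + b + c ∧
      ((T - b • 1) * (T - c • 1)).trace = (a - b) * (a - c) := by
  have main : ∀ T : Matrix (Fin 3) (Fin 3) ℂ,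
      (∀ x : ℂ, (x • (1 : Matrix (Fin 3) (Fin 3) ℂ) - T).det = (x - a) * (x - b) * (x - c)) →
      (T - a • 1).adjugate = (T - b • 1) * (T - c • 1) ∧ T.trace = a + b + c ∧
        ((T - b • 1) * (T - c • 1)).trace = (a - b) * (a - c) := by
    intro T h
    have h0 := h 0
    have h1 := h 1
    have h2 := h (-1)
    simp [det_fin_three] at h0 h1 h2
    have htr : T 0 0 + T 1 1 + T 2 2 = a + b + c := by
      linear_combination (-1 / 2) * h1 + (-1 / 2) * h2 + h0
    have hc2 : T 0 0 * T 1 1 + T 0 0 * T 2 2 + T 1 1 * T 2 2 - T 0 1 * T 1 0 - T 0 2 * T 2 0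
        - T 1 2 * T 2 1 = a * b + b * c + c * a := by
      linear_combination (1 / 2) * h1 - (1 / 2) * h2
    refine ⟨?_, ?_, ?_⟩
    · rw [adjugate_fin_three]
      ext i j
      fin_cases i <;> fin_cases j <;> simp [mul_apply, Fin.sum_univ_three]
      all_goals grind
    · rw [trace_fin_three, htr]
    · simp [trace_fin_three, mul_apply, Fin.sum_univ_three]
      grind
  exact main T h

/-- The eigenvalue data of one generator: `T` is a `3 × 3` matrix with eigenvalues `l⁻¹`, `q` and
`-q⁻¹`, where `l⁻¹` is different from the other two. -/
structure HasBMWEigenvalues (q l : ℂ) (T : Matrix (ZMod 3) (ZMod 3) ℂ) : Prop where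
  q_ne_zero : q ≠ 0
  l_ne_zero : l ≠ 0
  nu_ne_zero : nuPar q ≠ 0
  l_mul_q : l * q ≠ 1
  l_ne : l ≠ -q
  det : ∀ x : ℂ, (x • (1 : Matrix (ZMod 3) (ZMod 3) ℂ) - T).det = (x - l⁻¹) * (x - q) * (x + q⁻¹)

/-- The element `e = (l / ν) (T - q) (T + q⁻¹)`. -/
noncomputable def bmwE (q l : ℂ) (T : Matrix (ZMod 3) (ZMod 3) ℂ) : Matrix (ZMod 3) (ZMod 3) ℂ :=
  (l / nuPar q) • ((T - q • 1) * (T + q⁻¹ • 1))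

namespace HasBMWEigenvalues

variable {q l : ℂ} {T : Matrix (ZMod 3) (ZMod 3) ℂ}

theorem adjugate (h : HasBMWEigenvalues q l T) :
    (T - l⁻¹ • 1).adjugate = (T - q • 1) * (T + q⁻¹ • 1) ∧ T.trace = l⁻¹ + q - q⁻¹ ∧
      ((T - q • 1) * (T + q⁻¹ • 1)).trace = (l⁻¹ - q) * (l⁻¹ + q⁻¹) := by
  have := adjugate_sub_smul_one T (a := l⁻¹) (b := q) (c := -q⁻¹)
    (fun x => by rw [h.det, sub_neg_eq_add])
  simpa only [neg_smul, sub_neg_eq_add, ← sub_eq_add_neg] using this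

theorem det_sub_eq_zero (h : HasBMWEigenvalues q l T) : (T - l⁻¹ • 1).det = 0 := by
  rw [← neg_sub, Matrix.det_neg, h.det]
  simp

theorem tau_eq (h : HasBMWEigenvalues q l T) :
    l / nuPar q * ((l⁻¹ - q) * (l⁻¹ + q⁻¹)) = tauPar q l := by
  have h1 := h.q_ne_zero
  have h2 := h.l_ne_zero
  have h3 := h.nu_ne_zero
  have h4 : (l⁻¹ - q) * (l⁻¹ + q⁻¹) = l⁻¹ * (l⁻¹ - l + nuPar q) := by
    rw [nuPar]; field_simp; ring
  rw [h4, tauPar]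
  field_simp
  ring

theorem tau_ne_zero (h : HasBMWEigenvalues q l T) : tauPar q l ≠ 0 := by
  have h1 := h.q_ne_zero
  have h2 := h.l_ne_zero
  rw [← h.tau_eq]
  refine mul_ne_zero (div_ne_zero h2 h.nu_ne_zero) (mul_ne_zero ?_ ?_)
  · intro h3
    apply h.l_mul_q
    field_simp at h3
    linear_combination -h3
  · intro h3
    apply h.l_ne
    field_simp at h3
    linear_combination h3

theorem trace_e (h : HasBMWEigenvalues q l T) : (bmwE q l T).trace = tauPar q l := by
  rw [bmwE, trace_smul, h.adjugate.2.2, smul_eq_mul, h.tau_eq]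

theorem e_ne_zero (h : HasBMWEigenvalues q l T) : bmwE q l T ≠ 0 := fun h0 =>
  h.tau_ne_zero (by rw [← h.trace_e, h0, trace_zero])

theorem e_mul_e (h : HasBMWEigenvalues q l T) (M : Matrix (ZMod 3) (ZMod 3) ℂ) :
    bmwE q l T * M * bmwE q l T = (bmwE q l T * M).trace • bmwE q l T := by
  refine mul_mul_eq_trace_smul (fun i j k m => ?_) M
  have := adjugate_minor_of_det_eq_zero h.det_sub_eq_zero i j k m
  rw [h.adjugate.1] at this
  simp only [bmwE, Matrix.smul_apply, smul_eq_mul]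
  linear_combination (l / nuPar q) ^ 2 * this

theorem e_sq (h : HasBMWEigenvalues q l T) : bmwE q l T ^ 2 = tauPar q l • bmwE q l T := by
  have := h.e_mul_e 1
  rwa [mul_one, ← pow_two, h.trace_e] at this

theorem T_mul_e (h : HasBMWEigenvalues q l T) : T * bmwE q l T = l⁻¹ • bmwE q l T := by
  have h1 : (T - l⁻¹ • 1) * ((T - q • 1) * (T + q⁻¹ • 1)) = 0 := by
    rw [← h.adjugate.1, mul_adjugate, h.det_sub_eq_zero, zero_smul]
  rw [sub_mul, smul_mul_assoc, one_mul, sub_eq_zero] at h1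
  rw [bmwE, mul_smul_comm, h1, smul_comm]

theorem quad (h : HasBMWEigenvalues q l T) :
    l • (T ^ 2 + nuPar q • T - 1) = nuPar q • bmwE q l T := by
  rw [bmwE, sub_mul_add_inv h.q_ne_zero, smul_smul, mul_div_cancel₀ _ h.nu_ne_zero]

/-- `e = 1 + ν⁻¹ (T - T⁻¹)`. -/
theorem e_eq_of_mul_eq_one (h : HasBMWEigenvalues q l T) {T' : Matrix (ZMod 3) (ZMod 3) ℂ}
    (hT' : T' * T = 1) : bmwE q l T = 1 + (nuPar q)⁻¹ • (T - T') := by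
  have h1 := congrArg (T' * ·) h.quad
  have h2 : T' * bmwE q l T = l • bmwE q l T := by
    have := congrArg (fun X => l • (T' * X)) h.T_mul_e
    simp only [← mul_assoc, hT', one_mul, mul_smul_comm, smul_smul,
      mul_inv_cancel₀ h.l_ne_zero, one_smul] at this
    exact this.symm
  simp only [mul_smul_comm, mul_sub, mul_add, pow_two, ← mul_assoc, hT', one_mul, mul_one, h2]
    at h1
  rw [smul_comm (nuPar q)] at h1
  have h3 := smul_right_injective _ h.l_ne_zero h1
  have h4 := congrArg ((nuPar q)⁻¹ • ·) h3
  simp only [smul_smul, inv_mul_cancel₀ h.nu_ne_zero, one_smul] at h4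
  rw [← h4, smul_sub, smul_add, smul_smul, inv_mul_cancel₀ h.nu_ne_zero, one_smul, smul_sub]
  abel

end HasBMWEigenvalues

/-- `Q` is the projection onto the `-1`-eigenspace of the reflection `J = 1 - 2 Q`. -/
structure IsReflectionProj (Q : Matrix (ZMod 3) (ZMod 3) ℂ) : Prop where
  trace : Q.trace = 1
  mul_mul : ∀ M, Q * M * Q = (Q * M).trace • Q

/-- If the two generators are `ζ J C` and `ζ C J` with a reflection `J`, an element `C` of order
three with `tr C = tr C² = 0`, then `tr (e_0 T_1) = l`. The traces of words in `C`
and the reflection `J = 1 - 2 Q` are polynomials in `tr (C Q)` and `tr (C² Q)`, which are determined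
by the traces of `T_0` and `T_0⁻¹`. -/
theorem trace_e_mul {q l ζ : ℂ} {Q C : Matrix (ZMod 3) (ZMod 3) ℂ} (hQ : IsReflectionProj Q)
    (hC : C * C * C = 1) (hC1 : C.trace = 0) (hC2 : (C * C).trace = 0) (hζ : ζ ≠ 0)
    (h : HasBMWEigenvalues q l (ζ • ((1 - (2 : ℂ) • Q) * C))) :
    (bmwE q l (ζ • ((1 - (2 : ℂ) • Q) * C)) * (ζ • (C * (1 - (2 : ℂ) • Q)))).trace = l := by
  have hQQ : Q * Q = Q := by
    have := hQ.mul_mul 1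
    rwa [mul_one, hQ.trace, one_smul] at this
  have hJ : (1 - (2 : ℂ) • Q) * (1 - (2 : ℂ) • Q) = 1 := by
    simp only [sub_mul, mul_sub, mul_one, one_mul, smul_mul_assoc, mul_smul_comm, hQQ]
    module
  have hinv : (ζ⁻¹ • (C * C * (1 - (2 : ℂ) • Q))) * (ζ • ((1 - (2 : ℂ) • Q) * C)) = 1 := by
    rw [smul_mul_smul_comm, inv_mul_cancel₀ hζ, one_smul, mul_assoc (C * C),
      ← mul_assoc (1 - (2 : ℂ) • Q), hJ, one_mul, hC]
  have he := h.e_eq_of_mul_eq_one hinv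
  -- traces of words in `C` and `J`
  set x := (Q * C).trace with hx
  set y := (Q * (C * C)).trace with hy
  have tJC : ((1 - (2 : ℂ) • Q) * C).trace = -2 * x := by
    simp only [sub_mul, one_mul, smul_mul_assoc, trace_sub, trace_smul, hC1, ← hx, smul_eq_mul]
    ring
  have tCJ : (C * (1 - (2 : ℂ) • Q)).trace = -2 * x := by rw [trace_mul_comm, tJC]
  have tCCJ : (C * C * (1 - (2 : ℂ) • Q)).trace = -2 * y := by
    rw [trace_mul_comm]
    simp only [sub_mul, one_mul, smul_mul_assoc, trace_sub, trace_smul, hC2, ← hy, smul_eq_mul]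
    ring
  have t3 : (1 : Matrix (ZMod 3) (ZMod 3) ℂ).trace = 3 := by simp
  have tJCCJ : ((1 - (2 : ℂ) • Q) * C * (C * (1 - (2 : ℂ) • Q))).trace = 0 := by
    rw [← mul_assoc, trace_mul_comm, ← mul_assoc, ← mul_assoc, hJ, one_mul, hC2]
  have tCCJCJ : (C * C * (1 - (2 : ℂ) • Q) * (C * (1 - (2 : ℂ) • Q))).trace = -1 + 4 * x * y := by
    have hb : (C * C * Q * (C * Q)).trace = x * y := by
      have : C * C * Q * (C * Q) = C * C * (Q * C * Q) := by simp only [mul_assoc]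
      rw [this, hQ.mul_mul, mul_smul_comm, trace_smul, smul_eq_mul, trace_mul_comm (C * C)]
    have hc : (C * C * (C * Q)).trace = 1 := by rw [← mul_assoc, hC, one_mul, hQ.trace]
    have hd : (C * C * Q * C).trace = 1 := by
      rw [trace_mul_comm, ← mul_assoc, ← mul_assoc, hC, one_mul, hQ.trace]
    have : C * C * (1 - (2 : ℂ) • Q) * (C * (1 - (2 : ℂ) • Q)) =
        1 - (2 : ℂ) • (C * C * (C * Q)) - (2 : ℂ) • (C * C * Q * C) +
          (4 : ℂ) • (C * C * Q * (C * Q)) := by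
      simp only [sub_mul, mul_sub, mul_one, smul_mul_assoc, mul_smul_comm, hC, smul_sub, smul_smul]
      module
    rw [this]
    simp only [trace_add, trace_sub, trace_smul, hb, hc, hd, t3, smul_eq_mul]
    ring
  -- the traces of `T` and of its inverse
  have hT := h.adjugate.2.1
  rw [trace_smul, tJC, smul_eq_mul] at hT
  have hT' := h.trace_e
  rw [he, trace_add, trace_smul, trace_sub, trace_smul, trace_smul, tJC, tCCJ, t3] at hT'
  simp only [smul_eq_mul] at hT'
  rw [he, add_mul, one_mul, trace_add, trace_smul, tCJ, smul_mul_assoc, trace_smul, sub_mul,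
    smul_mul_smul_comm, smul_mul_smul_comm, inv_mul_cancel₀ hζ, trace_sub, trace_smul, trace_smul,
    tJCCJ, tCCJCJ]
  simp only [smul_eq_mul, mul_zero]
  have hν := h.nu_ne_zero
  have hx' : ζ * x = -(l⁻¹ - nuPar q) / 2 := by rw [nuPar]; linear_combination (-1 / 2) * hT
  have hy' : ζ⁻¹ * y = -(nuPar q + l) / 2 := by
    have h4 := congrArg (nuPar q * ·) hT'
    simp only [tauPar, mul_add, mul_sub, mul_inv_cancel_left₀ hν, mul_div_cancel₀ _ hν] at h4
    linear_combination (1 / 2) * h4 + hx'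
  have hxy : x * y = (l⁻¹ - nuPar q) * (nuPar q + l) / 4 := by
    have : x * y = (ζ * x) * (ζ⁻¹ * y) := by field_simp
    rw [this, hx', hy']; ring
  have hl := h.l_ne_zero
  have : (ζ * (-2 * x) + (nuPar q)⁻¹ * (0 - 1 * (-1 + 4 * x * y))) =
    -2 * (ζ * x) + (nuPar q)⁻¹ * (1 - 4 * (x * y)) := by ring
  rw [this, hx', hxy]
  field_simp
  ring

theorem mul_mul_bmwE {q l : ℂ} {x y : Matrix (ZMod 3) (ZMod 3) ℂ} (hq : q ≠ 0)
    (h : x * y * x = y * x * y) :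
    x * y * bmwE q l x = bmwE q l y * x * y := by
  have h2 : x * y * (x * x) = y * y * x * y := by
    rw [← mul_assoc, h, mul_assoc _ y, mul_assoc y x, ← mul_assoc x y, h]
    simp only [mul_assoc]
  simp only [bmwE, sub_mul_add_inv hq, mul_smul_comm, smul_mul_assoc, mul_sub, mul_add, sub_mul,
    add_mul, pow_two, h2, mul_one, one_mul, h]

theorem IsReflectionProj.mul_self {Q : Matrix (ZMod 3) (ZMod 3) ℂ} (hQ : IsReflectionProj Q) :
    Q * Q = Q := by
  have := hQ.mul_mul 1
  rwa [mul_one, hQ.trace, one_smul] at this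

theorem IsReflectionProj.sq_eq_one {Q : Matrix (ZMod 3) (ZMod 3) ℂ} (hQ : IsReflectionProj Q) :
    (1 - (2 : ℂ) • Q) * (1 - (2 : ℂ) • Q) = 1 := by
  simp only [sub_mul, mul_sub, mul_one, one_mul, smul_mul_assoc, mul_smul_comm, hQ.mul_self]
  module

/-- A reflection `J` and an element `C` of order three give a representation of the braid group on
three strands, `T_0 = ζ J C` and `T_1 = ζ C J`; with the right eigenvalues it is a representation
of `B_3(q, l)`. -/
theorem isBMWPair_of_reflection {q l ζ : ℂ} {Q C : Matrix (ZMod 3) (ZMod 3) ℂ}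
    (hQ : IsReflectionProj Q)
    (hC : C * C * C = 1) (hC1 : C.trace = 0) (hC2 : (C * C).trace = 0) (hζ : ζ ≠ 0)
    (h : HasBMWEigenvalues q l (ζ • ((1 - (2 : ℂ) • Q) * C))) :
    HasBMWEigenvalues q l (ζ • (C * (1 - (2 : ℂ) • Q))) ∧
    IsBMWPair q l (ζ • ((1 - (2 : ℂ) • Q) * C)) (ζ • (C * (1 - (2 : ℂ) • Q)))
      (bmwE q l (ζ • ((1 - (2 : ℂ) • Q) * C))) (bmwE q l (ζ • (C * (1 - (2 : ℂ) • Q)))) := by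
  have hJ := hQ.sq_eq_one
  have htr := trace_e_mul hQ hC hC1 hC2 hζ h
  -- the same for `T_1 = ζ J C'` and `T_0 = ζ C' J` with `C' = J C J`
  have htr' := fun hC' hC1' hC2' => trace_e_mul (q := q) (l := l) (ζ := ζ)
    (C := (1 - (2 : ℂ) • Q) * C * (1 - (2 : ℂ) • Q)) hQ hC' hC1' hC2' hζ
  set J := 1 - (2 : ℂ) • Q with hJdef
  have e1 : J * (J * C * J) = C * J := by
    rw [mul_assoc J C, ← mul_assoc, hJ, one_mul]
  have e0 : J * C * J * J = J * C := by rw [mul_assoc, hJ, mul_one]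
  have e2 : J * C * J * (J * C * J) = J * (C * C) * J := by
    rw [← mul_assoc, ← mul_assoc, e0]; simp only [mul_assoc]
  have e3 : J * C * J * (J * C * J) * (J * C * J) = 1 := by
    rw [e2, mul_assoc, e1, ← mul_assoc, mul_assoc J, hC, mul_one, hJ]
  have hconj : ∀ M : Matrix (ZMod 3) (ZMod 3) ℂ, (J * M * J).trace = M.trace := fun M => by
    rw [trace_mul_comm, ← mul_assoc, hJ, one_mul]
  have h1 : HasBMWEigenvalues q l (ζ • (C * J)) := by
    refine { h with det := fun x => ?_ }
    have hdJ : J.det * J.det = 1 := by rw [← det_mul, hJ, det_one]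
    have : x • (1 : Matrix (ZMod 3) (ZMod 3) ℂ) - ζ • (C * J) = J * (x • 1 - ζ • (J * C)) * J := by
      simp only [mul_sub, sub_mul, mul_smul_comm, smul_mul_assoc, mul_one, hJ, ← mul_assoc, one_mul]
    rw [this, det_mul, det_mul, h.det]
    linear_combination ((x - l⁻¹) * (x - q) * (x + q⁻¹)) * hdJ
  have braid : (ζ • (J * C)) * (ζ • (C * J)) * (ζ • (J * C)) =
      (ζ • (C * J)) * (ζ • (J * C)) * (ζ • (C * J)) := by
    simp only [smul_mul_smul_comm]
    congr 1
    calc J * C * (C * J) * (J * C) = J * (C * C * (J * J) * C) := by simp only [mul_assoc]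
      _ = C * (J * J) * C * C * J := by rw [hJ, mul_one, mul_one, hC, mul_one, one_mul]
      _ = _ := by simp only [mul_assoc]
  refine ⟨h1, ?_⟩
  constructor
  · exact braid
  · exact mul_mul_bmwE h.q_ne_zero braid
  · exact mul_mul_bmwE h.q_ne_zero braid.symm
  · exact h.quad
  · exact h1.quad
  · exact h.T_mul_e
  · exact h1.T_mul_e
  · rw [h.e_mul_e, htr]
  · rw [e1] at htr'
    rw [e0] at htr'
    rw [h1.e_mul_e, htr' e3 (by rw [hconj, hC1]) (by rw [e2, hconj, hC2]) h1]
  · exact h.e_sq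
  · exact h1.e_sq

open scoped Matrix.Norms.Operator

/-! ### The connection in the affine coordinate of the projective line -/

/-- The primitive cube root of unity `exp(2πi/3)`. -/
noncomputable def cubeRoot : ℂ := Complex.exp (2 * π / 3 * Complex.I)

theorem cubeRoot_pow_three : cubeRoot ^ 3 = 1 := by
  rw [cubeRoot, ← Complex.exp_nat_mul, ← Complex.exp_two_pi_mul_I]
  congr 1
  push_cast
  ring

theorem cubeRoot_ne_zero : cubeRoot ≠ 0 := Complex.exp_ne_zero _

theorem cubeRoot_eq : cubeRoot = ⟨-1 / 2, √3 / 2⟩ := by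
  have h : (2 * π / 3 * Complex.I : ℂ) = ((π - π / 3 : ℝ) : ℂ) * Complex.I := by
    push_cast; ring
  apply Complex.ext
  · rw [cubeRoot, h, Complex.exp_ofReal_mul_I_re, Real.cos_pi_sub, Real.cos_pi_div_three]
    norm_num
  · rw [cubeRoot, h, Complex.exp_ofReal_mul_I_im, Real.sin_pi_sub, Real.sin_pi_div_three]

/-- The point of the projective line, in the coordinate `w = u / v` with `u = z₁ + i z₂` and
`v = z₁ - i z₂`, of the line `H_j`. -/
noncomputable def singPt (j : ZMod 3) : ℂ := cubeRoot ^ j.val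

theorem singPt_ne_zero (j : ZMod 3) : singPt j ≠ 0 := pow_ne_zero _ cubeRoot_ne_zero

theorem singPt_add (i j : ZMod 3) : singPt (i + j) = singPt i * singPt j := by
  rw [singPt, singPt, singPt, ZMod.val_add, ← pow_add, ← pow_eq_pow_mod _ cubeRoot_pow_three]

theorem singPt_one : singPt 1 = cubeRoot := pow_one _

theorem singPt_zero : singPt 0 = 1 := pow_zero _

theorem norm_singPt (j : ZMod 3) : ‖singPt j‖ = 1 := by
  have h : (2 * π / 3 * Complex.I : ℂ) = ((2 * π / 3 : ℝ) : ℂ) * Complex.I := by push_cast; ring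
  rw [singPt, norm_pow, cubeRoot, h, Complex.norm_exp_ofReal_mul_I, one_pow]

/-- `f_j = (exp(-iπj/3) / 2i) (u - ω^j v)`. -/
theorem lineForm_eq (j : ZMod 3) (z : Fin 2 → ℂ) :
    lineForm 3 j z = Complex.exp (-lineAngle 3 j * Complex.I) / (2 * Complex.I) *
      ((z 0 + Complex.I * z 1) - singPt j * (z 0 - Complex.I * z 1)) := by
  have h1 : singPt j = Complex.exp (lineAngle 3 j * Complex.I) ^ 2 := by
    rw [singPt, cubeRoot, ← Complex.exp_nat_mul, ← Complex.exp_nat_mul, lineAngle]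
    congr 1
    push_cast
    ring
  have h2 : Complex.exp (-lineAngle 3 j * Complex.I) =
      Complex.cos (lineAngle 3 j) - Complex.sin (lineAngle 3 j) * Complex.I := by
    rw [Complex.exp_mul_I, Complex.cos_neg, Complex.sin_neg]; ring
  have h3 : Complex.exp (lineAngle 3 j * Complex.I) =
      Complex.cos (lineAngle 3 j) + Complex.sin (lineAngle 3 j) * Complex.I := Complex.exp_mul_I _
  have h4 := Complex.sin_sq_add_cos_sq (lineAngle 3 j)
  have hI := Complex.I_sq
  have hI0 := Complex.I_ne_zero
  rw [h1, h2, h3, lineForm, lineNormal]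
  simp only [cons_val_zero, cons_val_one, Complex.ofReal_neg, Complex.ofReal_sin,
    Complex.ofReal_cos, cons_val_fin_one]
  generalize Complex.cos (lineAngle 3 j) = c at *
  generalize Complex.sin (lineAngle 3 j) = s at *
  rw [eq_comm, div_mul_eq_mul_div, div_eq_iff (by simp)]
  grind

theorem lineForm_ne_zero_iff {j : ZMod 3} {z : Fin 2 → ℂ} (hv : z 0 - Complex.I * z 1 ≠ 0) :
    lineForm 3 j z ≠ 0 ↔
      (z 0 + Complex.I * z 1) / (z 0 - Complex.I * z 1) ≠ singPt j := by
  have : Complex.exp (-lineAngle 3 j * Complex.I) / (2 * Complex.I) ≠ 0 :=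
    div_ne_zero (Complex.exp_ne_zero _) (by simp)
  rw [lineForm_eq, mul_ne_zero_iff_left this, sub_ne_zero, Ne, Ne, div_eq_iff hv]

/-- The residue of the connection along `H_j`, divided by `κ`. -/
noncomputable def lkRes (k α : ℂ) (j : ZMod 3) : Matrix (ZMod 3) (ZMod 3) ℂ :=
  k • reflPerm 3 j - lkProj 3 k α j

/-- The cyclic permutation `v_j ↦ v_{j+1}`. -/
def rotPerm : Matrix (ZMod 3) (ZMod 3) ℂ := Matrix.of fun a b => if a = b + 1 then 1 else 0

theorem rotPerm_mul_apply (M : Matrix (ZMod 3) (ZMod 3) ℂ) (a b : ZMod 3) :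
    (rotPerm * M) a b = M (a - 1) b := by
  have : ∀ c : ZMod 3, a = c + 1 ↔ c = a - 1 := fun c =>
    ⟨fun h => by rw [h]; ring, fun h => by rw [h]; ring⟩
  simp [rotPerm, Matrix.mul_apply, this]

theorem mul_rotPerm_apply (M : Matrix (ZMod 3) (ZMod 3) ℂ) (a b : ZMod 3) :
    (M * rotPerm) a b = M a (b + 1) := by
  simp [rotPerm, Matrix.mul_apply]

theorem reflPerm_mul_apply (i : ZMod 3) (M : Matrix (ZMod 3) (ZMod 3) ℂ) (a b : ZMod 3) :
    (reflPerm 3 i * M) a b = M (2 * i - a) b := by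
  have : ∀ c : ZMod 3, a = 2 * i - c ↔ c = 2 * i - a := fun c =>
    ⟨fun h => by rw [h]; ring, fun h => by rw [h]; ring⟩
  simp [reflPerm, Matrix.mul_apply, this]

theorem mul_reflPerm_apply (i : ZMod 3) (M : Matrix (ZMod 3) (ZMod 3) ℂ) (a b : ZMod 3) :
    (M * reflPerm 3 i) a b = M a (2 * i - b) := by
  simp [reflPerm, Matrix.mul_apply]

theorem lkRes_apply (k α : ℂ) (j a b : ZMod 3) :
    lkRes k α j a b = k * (if a = 2 * j - b then 1 else 0) -
      if a = j then (if b = j then α else k) else 0 := rfl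

theorem rotPerm_mul_lkRes (k α : ℂ) (j : ZMod 3) :
    rotPerm * lkRes k α j = lkRes k α (j + 1) * rotPerm := by
  ext a b
  rw [rotPerm_mul_apply, mul_rotPerm_apply, lkRes_apply, lkRes_apply]
  have h1 : ∀ a b j : ZMod 3, a - 1 = 2 * j - b ↔ a = 2 * (j + 1) - (b + 1) := by decide
  have h2 : ∀ a j : ZMod 3, a - 1 = j ↔ a = j + 1 := by decide
  have h3 : ∀ b j : ZMod 3, b = j ↔ b + 1 = j + 1 := by decide
  simp only [h1 a b j, h2 a j, h3 b j]

theorem reflPerm_mul_lkRes (k α : ℂ) (i j : ZMod 3) :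
    reflPerm 3 i * lkRes k α j = lkRes k α (2 * i - j) * reflPerm 3 i := by
  ext a b
  rw [reflPerm_mul_apply, mul_reflPerm_apply, lkRes_apply, lkRes_apply]
  have h1 : ∀ a b i j : ZMod 3,
      2 * i - a = 2 * j - b ↔ a = 2 * (2 * i - j) - (2 * i - b) := by decide
  have h2 : ∀ a i j : ZMod 3, 2 * i - a = j ↔ a = 2 * i - j := by decide
  have h3 : ∀ b i j : ZMod 3, b = j ↔ 2 * i - b = 2 * i - j := by decide
  simp only [h1 a b i j, h2 a i j, h3 b i j]

theorem reflPerm_mul_self (i : ZMod 3) : reflPerm 3 i * reflPerm 3 i = 1 := by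
  ext a b
  rw [reflPerm_mul_apply, reflPerm, Matrix.of_apply, Matrix.one_apply]
  have h1 : ∀ a b i : ZMod 3, 2 * i - a = 2 * i - b ↔ a = b := by decide
  simp only [h1]

theorem reflPerm_zero_eq : reflPerm 3 0 = reflPerm 3 2 * rotPerm := by
  ext a b
  rw [mul_rotPerm_apply, reflPerm, reflPerm, Matrix.of_apply, Matrix.of_apply]
  have h1 : ∀ a b : ZMod 3, a = 2 * 0 - b ↔ a = 2 * 2 - (b + 1) := by decide
  simp only [h1 a b]

theorem reflPerm_one_mul : reflPerm 3 1 * reflPerm 3 2 = rotPerm := by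
  ext a b
  rw [mul_reflPerm_apply, reflPerm, rotPerm, Matrix.of_apply, Matrix.of_apply]
  have h1 : ∀ a b : ZMod 3, a = 2 * 1 - (2 * 2 - b) ↔ a = b + 1 := by decide
  simp only [h1 a b]

theorem rotPerm_pow_three : rotPerm * rotPerm * rotPerm = 1 := by
  ext a b
  rw [mul_rotPerm_apply, mul_rotPerm_apply, rotPerm, Matrix.of_apply, Matrix.one_apply]
  have h1 : ∀ a b : ZMod 3, a = b + 1 + 1 + 1 ↔ a = b := by decide
  simp only [h1 a b]

theorem trace_rotPerm : rotPerm.trace = 0 :=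
  Finset.sum_eq_zero fun a _ => by simp [rotPerm]

theorem trace_rotPerm_sq : (rotPerm * rotPerm).trace = 0 :=
  Finset.sum_eq_zero fun a _ => by
    rw [diag_apply, mul_rotPerm_apply, rotPerm, Matrix.of_apply]
    have h1 : ∀ a : ZMod 3, a ≠ a + 1 + 1 := by decide
    simp only [h1 a, if_false]

/-- The residue of the connection at the origin is scalar. -/
theorem sum_lkRes (k α : ℂ) : ∑ j, lkRes k α j = (k - α) • (1 : Matrix (ZMod 3) (ZMod 3) ℂ) := by
  ext a b
  rw [Matrix.sum_apply]
  simp only [lkRes_apply, Finset.sum_sub_distrib, ← Finset.mul_sum, Matrix.smul_apply,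
    Matrix.one_apply, smul_eq_mul]
  have h1 : ∀ a b : ZMod 3, (∑ j : ZMod 3, (if a = 2 * j - b then 1 else 0 : ℕ)) = 1 := by decide
  have h1' : (∑ j : ZMod 3, (if a = 2 * j - b then 1 else 0 : ℂ)) = 1 := by
    exact_mod_cast congrArg (Nat.cast (R := ℂ)) (h1 a b)
  rw [h1']
  simp only [Finset.sum_ite_eq, Finset.mem_univ, if_true, eq_comm (a := b)]
  split_ifs <;> ring

/-- The reflection `ι(s_2)` is `1 - 2 Q` with `Q` of rank one. -/
theorem isReflectionProj_reflPerm :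
    IsReflectionProj ((1 / 2 : ℂ) • (1 - reflPerm 3 2)) := by
  constructor
  · have h : (1 - reflPerm 3 2).trace = 2 := by
      have h1 : (reflPerm 3 2).trace = 1 := by
        have h2 : ∑ a : ZMod 3, (if a = 2 * 2 - a then 1 else 0 : ℕ) = 1 := by decide
        have h3 := congrArg (Nat.cast (R := ℂ)) h2
        simp only [Nat.cast_sum, Nat.cast_ite, Nat.cast_one, Nat.cast_zero] at h3
        exact h3
      rw [trace_sub, h1]
      simp
      norm_num
    rw [trace_smul, h]
    norm_num
  · intro M
    refine mul_mul_eq_trace_smul (fun i j k l => ?_) M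
    have h : ∀ i j k l : ZMod 3,
        ((if i = j then 1 else 0) - (if i = 2 * 2 - j then 1 else 0) : ℤ) *
          ((if k = l then 1 else 0) - (if k = 2 * 2 - l then 1 else 0)) =
        ((if i = l then 1 else 0) - (if i = 2 * 2 - l then 1 else 0)) *
          ((if k = j then 1 else 0) - (if k = 2 * 2 - j then 1 else 0)) := by decide
    have h' := congrArg (Int.cast (R := ℂ)) (h i j k l)
    push_cast at h'
    simp only [Matrix.smul_apply, Matrix.sub_apply, Matrix.one_apply, reflPerm, Matrix.of_apply,
      smul_eq_mul]
    linear_combination (1 / 4) * h'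

/-- The connection form on the projective line, in the coordinate `w`. -/
noncomputable def lkConn (k α κ w : ℂ) : Matrix (ZMod 3) (ZMod 3) ℂ :=
  κ • ∑ j, (w - singPt j)⁻¹ • lkRes k α j

theorem lkConn_rot (k α κ w : ℂ) :
    cubeRoot • (lkConn k α κ (cubeRoot * w) * rotPerm) = rotPerm * lkConn k α κ w := by
  rw [lkConn, lkConn, smul_mul_assoc, mul_smul_comm, smul_comm, Finset.mul_sum, Finset.sum_mul,
    ← Equiv.sum_comp (Equiv.addRight (1 : ZMod 3)), Finset.smul_sum]
  congr 1
  refine Finset.sum_congr rfl fun j _ => ?_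
  rw [Equiv.coe_addRight, smul_mul_assoc, ← rotPerm_mul_lkRes, mul_smul_comm, smul_smul,
    singPt_add, singPt_one, mul_comm (singPt j), ← mul_sub, mul_inv,
    mul_inv_cancel_left₀ cubeRoot_ne_zero]

theorem lkConn_refl (k α κ : ℂ) {w : ℂ} (hw : w ≠ 0) (hw' : ∀ j, w ≠ singPt j) :
    (κ * (k - α) / w) • reflPerm 3 2 +
      (-cubeRoot / w ^ 2) • (reflPerm 3 2 * lkConn k α κ (cubeRoot / w)) =
      lkConn k α κ w * reflPerm 3 2 := by
  have h1 : (κ * (k - α) / w) • reflPerm 3 2 =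
      κ • ∑ j, w⁻¹ • (lkRes k α j * reflPerm 3 2) := by
    rw [← Finset.smul_sum, ← Finset.sum_mul, sum_lkRes, smul_mul_assoc, one_mul, smul_smul,
      smul_smul]
    congr 1
    ring
  have h2 : reflPerm 3 2 * lkConn k α κ (cubeRoot / w) =
      κ • ∑ j, (cubeRoot / w - singPt (1 - j))⁻¹ • (lkRes k α j * reflPerm 3 2) := by
    rw [lkConn, mul_smul_comm, Finset.mul_sum, ← Equiv.sum_comp (Equiv.subLeft (1 : ZMod 3))]
    congr 1
    refine Finset.sum_congr rfl fun j _ => ?_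
    have h3 : ∀ j : ZMod 3, 2 * 2 - (1 - j) = j := by decide
    rw [Equiv.subLeft_apply, mul_smul_comm, reflPerm_mul_lkRes, h3]
  rw [h1, h2, smul_comm _ κ, ← smul_add, Finset.smul_sum, ← Finset.sum_add_distrib, lkConn,
    smul_mul_assoc, Finset.sum_mul]
  congr 1
  refine Finset.sum_congr rfl fun j _ => ?_
  rw [smul_smul, ← add_smul, smul_mul_assoc]
  congr 1
  have hj := singPt_ne_zero j
  have h4 : singPt (1 - j) = cubeRoot / singPt j := by
    rw [eq_div_iff hj, ← singPt_add, sub_add_cancel, singPt_one]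
  have h5 := sub_ne_zero.2 (hw' j)
  have h6 : cubeRoot / w - cubeRoot / singPt j = -(cubeRoot * (w - singPt j)) / (w * singPt j) := by
    field_simp
    ring
  have h7 := cubeRoot_ne_zero
  rw [h4, h6]
  field_simp
  ring

/-- In the coordinates `w = u / v` and `v` the connection form is `κ (k - α) dv / v` plus the form
`lkConn w dw`. -/
theorem lkForm_eq (k α κ : ℂ) {z d : Fin 2 → ℂ} (hv : z 0 - Complex.I * z 1 ≠ 0)
    (hz : ∀ j, lineForm 3 j z ≠ 0) :
    lkForm 3 k α κ z d =
      (κ * (k - α) * ((d 0 - Complex.I * d 1) / (z 0 - Complex.I * z 1))) • 1 +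
      (((d 0 + Complex.I * d 1) * (z 0 - Complex.I * z 1) -
        (z 0 + Complex.I * z 1) * (d 0 - Complex.I * d 1)) / (z 0 - Complex.I * z 1) ^ 2) •
        lkConn k α κ ((z 0 + Complex.I * z 1) / (z 0 - Complex.I * z 1)) := by
  have hz' := fun j => (lineForm_ne_zero_iff hv).1 (hz j)
  have hf : ∀ j, lineForm 3 j d / lineForm 3 j z =
      ((d 0 + Complex.I * d 1) - singPt j * (d 0 - Complex.I * d 1)) /
      ((z 0 + Complex.I * z 1) - singPt j * (z 0 - Complex.I * z 1)) := fun j => by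
    have : Complex.exp (-lineAngle 3 j * Complex.I) / (2 * Complex.I) ≠ 0 :=
      div_ne_zero (Complex.exp_ne_zero _) (by simp)
    rw [lineForm_eq, lineForm_eq, mul_div_mul_left _ _ this]
  simp only [lkForm, hf]
  generalize z 0 + Complex.I * z 1 = u at *
  generalize z 0 - Complex.I * z 1 = v at *
  generalize d 0 + Complex.I * d 1 = u' at *
  generalize d 0 - Complex.I * d 1 = v' at *
  have h1 : (κ * (k - α) * (v' / v)) • (1 : Matrix (ZMod 3) (ZMod 3) ℂ) =
      κ • ∑ j, (v' / v) • lkRes k α j := by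
    rw [← Finset.smul_sum, sum_lkRes, smul_smul, smul_smul]
    congr 1
    ring
  rw [h1, lkConn, smul_comm _ κ, ← smul_add]
  congr 1
  rw [Finset.smul_sum, ← Finset.sum_add_distrib]
  refine Finset.sum_congr rfl fun j _ => ?_
  rw [smul_smul, ← add_smul]
  change _ • lkRes k α j = _
  congr 1
  have h2 : u / v - singPt j ≠ 0 := sub_ne_zero.2 (hz' j)
  have h3 : u - singPt j * v = (u / v - singPt j) * v := by field_simp
  have h4 : u = (u / v) * v := by field_simp
  rw [h3]
  generalize u / v = w at *
  rw [h4]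
  field_simp
  ring

/-! ### The fundamental solution on the slit plane -/

/-- The complement of the outward rays from the three singular points. -/
def slitDomain : Set ℂ := {w | ∀ j : ZMod 3, 1 - w / singPt j ∈ Complex.slitPlane}

theorem isOpen_slitDomain : IsOpen slitDomain := by
  have : slitDomain = ⋂ j : ZMod 3, (fun w => 1 - w / singPt j) ⁻¹' Complex.slitPlane := by
    ext w; simp [slitDomain]
  rw [this]
  exact isOpen_iInter_of_finite fun j => Complex.isOpen_slitPlane.preimage (by fun_prop)

theorem zero_mem_slitDomain : (0 : ℂ) ∈ slitDomain := fun j => by simp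

theorem starConvex_slitDomain : StarConvex ℝ 0 slitDomain := by
  intro w hw a b ha hb hab j
  have := Complex.starConvex_one_slitPlane (hw j) ha hb hab
  convert this using 1
  have hab' : (a : ℂ) + b = 1 := by exact_mod_cast hab
  simp only [Complex.real_smul, mul_zero, zero_add, mul_one]
  linear_combination -hab'

theorem isPreconnected_slitDomain : IsPreconnected slitDomain :=
  (starConvex_slitDomain.isPathConnected zero_mem_slitDomain).isConnected.isPreconnected

theorem ne_singPt_of_mem {w : ℂ} (hw : w ∈ slitDomain) (j : ZMod 3) : w ≠ singPt j := by
  rintro rfl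
  have := Complex.slitPlane_ne_zero (hw j)
  rw [div_self (singPt_ne_zero j), sub_self] at this
  exact this rfl

theorem mem_slitDomain_of_norm_le {w : ℂ} (hw : ‖w‖ ≤ 1) (hw' : ∀ j, w ≠ singPt j) :
    w ∈ slitDomain := by
  intro j
  have h1 : ‖w / singPt j‖ ≤ 1 := by rwa [norm_div, norm_singPt, div_one]
  have h2 : (w / singPt j).re ≤ 1 := (Complex.re_le_norm _).trans h1
  rw [Complex.mem_slitPlane_iff, Complex.sub_re, Complex.sub_im, Complex.one_re, Complex.one_im]
  by_contra! h
  apply hw' j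
  have h3 : w / singPt j = 1 := Complex.ext (by simp; linarith [h.1]) (by simp; linarith [h.2])
  rwa [div_eq_one_iff_eq (singPt_ne_zero j)] at h3

theorem cubeRoot_mul_mem {w : ℂ} (hw : w ∈ slitDomain) : cubeRoot * w ∈ slitDomain := fun j => by
  have h : cubeRoot * w / singPt j = w / singPt (j - 1) := by
    have : singPt j = cubeRoot * singPt (j - 1) := by
      rw [← singPt_one, ← singPt_add, add_sub_cancel]
    rw [this, mul_div_mul_left _ _ cubeRoot_ne_zero]
  rw [h]
  exact hw (j - 1)

theorem differentiableOn_lkConn (k α κ : ℂ) : DifferentiableOn ℂ (lkConn k α κ) slitDomain := by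
  intro w hw
  apply DifferentiableAt.differentiableWithinAt
  refine DifferentiableAt.const_smul (DifferentiableAt.fun_sum fun j _ => ?_) κ
  have h : DifferentiableAt ℂ (fun w => (w - singPt j)⁻¹) w :=
    DifferentiableAt.fun_inv (by fun_prop) (sub_ne_zero.2 (ne_singPt_of_mem hw j))
  exact h.smul_const _

/-- `Y` is the fundamental solution of `dY = lkConn Y dw`, and `Z` is its inverse. -/
structure IsFundamental (k α κ : ℂ) (Y Z : ℂ → Matrix (ZMod 3) (ZMod 3) ℂ) : Prop where
  Y_zero : Y 0 = 1
  Z_zero : Z 0 = 1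
  deriv_Y : ∀ w ∈ slitDomain, HasDerivAt Y (lkConn k α κ w * Y w) w
  deriv_Z : ∀ w ∈ slitDomain, HasDerivAt Z (-(Z w * lkConn k α κ w)) w

theorem exists_isFundamental (k α κ : ℂ) : ∃ Y Z, IsFundamental k α κ Y Z := by
  have hL : DifferentiableOn ℂ
      (fun w => ContinuousLinearMap.mul ℂ (Matrix (ZMod 3) (ZMod 3) ℂ) (lkConn k α κ w))
      slitDomain :=
    (ContinuousLinearMap.differentiable _).comp_differentiableOn (differentiableOn_lkConn k α κ)
  have hL' : DifferentiableOn ℂ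
      (fun w => -(ContinuousLinearMap.mul ℂ (Matrix (ZMod 3) (ZMod 3) ℂ)).flip (lkConn k α κ w))
      slitDomain :=
    ((ContinuousLinearMap.differentiable _).comp_differentiableOn
      (differentiableOn_lkConn k α κ)).neg
  obtain ⟨Y, hY0, hY⟩ := exists_solution_linearODE 1 isOpen_slitDomain starConvex_slitDomain hL
  obtain ⟨Z, hZ0, hZ⟩ := exists_solution_linearODE 1 isOpen_slitDomain starConvex_slitDomain hL'
  exact ⟨Y, Z, hY0, hZ0, hY, hZ⟩

theorem eq_of_hasDerivAt_zero {E : Type*} [NormedAddCommGroup E] [NormedSpace ℂ E] {s : Set ℂ}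
    (hs : IsOpen s) (hs' : IsPreconnected s) {f : ℂ → E} (hf : ∀ w ∈ s, HasDerivAt f 0 w)
    {x y : ℂ} (hx : x ∈ s) (hy : y ∈ s) : f x = f y :=
  hs.is_const_of_deriv_eq_zero hs'
    (fun w hw => (hf w hw).differentiableAt.differentiableWithinAt)
    (fun w hw => (hf w hw).deriv) hx hy

/-- The sector `0 < arg w < 2π/3`. -/
def sector : Set ℂ := {w | 0 < w.im ∧ (w / cubeRoot).im < 0}

/-- The midpoint `exp(πi/3)` of the arc of the unit circle in the sector. -/
noncomputable def midPt : ℂ := Complex.exp (π / 3 * Complex.I)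

theorem inv_cubeRoot : cubeRoot⁻¹ = ⟨-1 / 2, -(√3 / 2)⟩ := by
  rw [inv_eq_iff_eq_inv, Complex.inv_def, cubeRoot_eq]
  have : Complex.normSq ⟨-1 / 2, -(√3 / 2)⟩ = 1 := by
    rw [Complex.normSq_mk]
    have := Real.mul_self_sqrt (show (0:ℝ) ≤ 3 by norm_num)
    linear_combination (1 / 4) * this
  rw [this]
  apply Complex.ext <;> simp

theorem div_cubeRoot_im (w : ℂ) : (w / cubeRoot).im = -(√3 / 2 * w.re + w.im / 2) := by
  rw [div_eq_mul_inv, inv_cubeRoot, Complex.mul_im]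
  ring

theorem isOpen_sector : IsOpen sector :=
  (isOpen_lt continuous_const Complex.continuous_im).inter
    (isOpen_lt (Complex.continuous_im.comp (by fun_prop)) continuous_const)

theorem convex_sector : Convex ℝ sector := by
  intro w hw z hz a b ha hb hab
  simp only [sector, mem_ofPred_eq, div_cubeRoot_im] at *
  simp only [Complex.add_im, Complex.add_re, Complex.real_smul, Complex.re_ofReal_mul,
    Complex.im_ofReal_mul]
  obtain rfl : b = 1 - a := by linarith
  rcases ha.eq_or_lt with rfl | ha
  · simpa using hz
  · exact ⟨by nlinarith, by nlinarith⟩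

theorem sector_subset : sector ⊆ slitDomain := by
  intro w hw j
  obtain ⟨h1, h2⟩ := hw
  rw [Complex.mem_slitPlane_iff, Complex.sub_re, Complex.sub_im, Complex.one_re, Complex.one_im]
  have h3 : j = 0 ∨ j = 1 ∨ j = 2 := by revert j; decide
  rcases h3 with rfl | rfl | rfl
  · right
    rw [singPt_zero, div_one]
    linarith
  · right
    rw [singPt_one]
    linarith
  · have h4 : w / singPt 2 = w * cubeRoot := by
      have h5 : singPt 2 * cubeRoot = 1 := by
        rw [← singPt_one, ← singPt_add, ← singPt_zero]; rfl
      rw [div_eq_iff (singPt_ne_zero 2), mul_assoc, mul_comm cubeRoot, h5, mul_one]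
    rw [h4, cubeRoot_eq, Complex.mul_re, Complex.mul_im]
    rw [div_cubeRoot_im] at h2
    by_contra! h
    obtain ⟨h5, h6⟩ := h
    have h7 := Real.mul_self_sqrt (show (0:ℝ) ≤ 3 by norm_num)
    have h8 : 0 < √3 := by positivity
    simp only at h5 h6
    -- on the ray through `ω²` the real part is negative
    have h9 : w.im = √3 * w.re := by linarith
    rw [h9] at h2 h5
    nlinarith

theorem ne_zero_of_mem_sector {w : ℂ} (hw : w ∈ sector) : w ≠ 0 := by
  rintro rfl
  exact lt_irrefl _ hw.1

theorem cubeRoot_div_mem_sector {w : ℂ} (hw : w ∈ sector) : cubeRoot / w ∈ sector := by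
  have h0 : 0 < Complex.normSq w := Complex.normSq_pos.2 (ne_zero_of_mem_sector hw)
  obtain ⟨h1, h2⟩ := hw
  have h3 : cubeRoot / w / cubeRoot = w⁻¹ := by
    rw [div_div, mul_comm, ← div_div, div_self cubeRoot_ne_zero, one_div]
  refine ⟨?_, ?_⟩
  · rw [div_cubeRoot_im] at h2
    rw [div_eq_mul_inv, Complex.mul_im, cubeRoot_eq, Complex.inv_re, Complex.inv_im]
    have : (-1 / 2 * (-w.im / Complex.normSq w) + √3 / 2 * (w.re / Complex.normSq w)) =
        (√3 / 2 * w.re + w.im / 2) / Complex.normSq w := by ring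
    rw [this]
    exact div_pos (by linarith) h0
  · rw [h3, Complex.inv_im]
    exact div_neg_of_neg_of_pos (by linarith) h0

theorem midPt_sq : midPt ^ 2 = cubeRoot := by
  rw [midPt, cubeRoot, ← Complex.exp_nat_mul]
  congr 1
  push_cast
  ring

theorem midPt_ne_zero : midPt ≠ 0 := Complex.exp_ne_zero _

theorem cubeRoot_div_midPt : cubeRoot / midPt = midPt := by
  rw [← midPt_sq, pow_two, mul_div_assoc, div_self midPt_ne_zero, mul_one]

theorem midPt_mem_sector : midPt ∈ sector := by
  have h : (π / 3 * Complex.I : ℂ) = ((π / 3 : ℝ) : ℂ) * Complex.I := by push_cast; ring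
  have h1 : 0 < midPt.im := by
    rw [midPt, h, Complex.exp_ofReal_mul_I_im, Real.sin_pi_div_three]
    positivity
  refine ⟨h1, ?_⟩
  have h2 : midPt / cubeRoot = (starRingEnd ℂ) midPt := by
    rw [← midPt_sq, pow_two, ← div_div, div_self midPt_ne_zero, midPt, one_div,
      ← Complex.exp_neg, ← Complex.exp_conj, h]
    simp only [map_mul, Complex.conj_ofReal, Complex.conj_I, mul_neg]
  rw [h2, Complex.conj_im]
  linarith

namespace IsFundamental

variable {k α κ : ℂ} {Y Z : ℂ → Matrix (ZMod 3) (ZMod 3) ℂ}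

theorem Z_mul_Y (h : IsFundamental k α κ Y Z) {w : ℂ} (hw : w ∈ slitDomain) : Z w * Y w = 1 := by
  have := eq_of_hasDerivAt_zero isOpen_slitDomain isPreconnected_slitDomain
    (f := fun w => Z w * Y w) (fun w hw => by
      refine ((h.deriv_Z w hw).mul (h.deriv_Y w hw)).congr_deriv ?_
      rw [neg_mul, mul_assoc, neg_add_cancel]) hw zero_mem_slitDomain
  rw [this, h.Y_zero, h.Z_zero, mul_one]

theorem Y_mul_Z (h : IsFundamental k α κ Y Z) {w : ℂ} (hw : w ∈ slitDomain) : Y w * Z w = 1 :=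
  mul_eq_one_comm.1 (h.Z_mul_Y hw)

/-- The fundamental solution is equivariant under the rotation of order three. -/
theorem Y_rot (h : IsFundamental k α κ Y Z) {w : ℂ} (hw : w ∈ slitDomain) :
    Y (cubeRoot * w) * rotPerm = rotPerm * Y w := by
  have hm : ∀ w : ℂ, HasDerivAt (fun w => cubeRoot * w) cubeRoot w := fun w => by
    simpa using (hasDerivAt_id w).const_mul cubeRoot
  have := eq_of_hasDerivAt_zero isOpen_slitDomain isPreconnected_slitDomain
    (f := fun w => Z (cubeRoot * w) * rotPerm * Y w) (fun w hw => by
      have h1 := (h.deriv_Z _ (cubeRoot_mul_mem hw)).scomp w (hm w)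
      refine ((h1.mul_const rotPerm).mul (h.deriv_Y w hw)).congr_deriv ?_
      have h2 : Z (cubeRoot * w) * rotPerm * (lkConn k α κ w * Y w) =
          Z (cubeRoot * w) * (rotPerm * lkConn k α κ w) * Y w := by simp only [mul_assoc]
      simp only [Function.comp_apply]
      rw [h2, ← lkConn_rot, smul_neg, neg_mul, neg_mul]
      simp only [smul_mul_assoc, mul_smul_comm, mul_assoc, neg_add_cancel])
    hw zero_mem_slitDomain
  simp only [mul_zero, h.Z_zero, h.Y_zero, one_mul, mul_one] at this
  calc Y (cubeRoot * w) * rotPerm = Y (cubeRoot * w) * (Z (cubeRoot * w) * rotPerm * Y w) := by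
        rw [this]
    _ = rotPerm * Y w := by
        rw [← mul_assoc, ← mul_assoc, h.Y_mul_Z (cubeRoot_mul_mem hw), one_mul]

/-- The equivariance of the fundamental solution under the reflection `w ↦ ω / w` of the sector. -/
theorem Y_refl (h : IsFundamental k α κ Y Z) {w : ℂ} (hw : w ∈ sector) :
    Y w * (Z midPt * reflPerm 3 2 * Y midPt) =
      Complex.exp (κ * (k - α) * (Complex.log w - Complex.log midPt)) •
        (reflPerm 3 2 * Y (cubeRoot / w)) := by
  have := eq_of_hasDerivAt_zero isOpen_sector convex_sector.isPreconnected
    (f := fun w => Z w * (Complex.exp (κ * (k - α) * (Complex.log w - Complex.log midPt)) •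
      (reflPerm 3 2 * Y (cubeRoot / w)))) (fun w hw => by
      have h0 := ne_zero_of_mem_sector hw
      have hslit : w ∈ Complex.slitPlane := Complex.mem_slitPlane_iff.2 (Or.inr hw.1.ne')
      have h1 : HasDerivAt (fun w => cubeRoot / w) (-cubeRoot / w ^ 2) w := by
        simpa using (hasDerivAt_const w cubeRoot).fun_div (hasDerivAt_id' w) h0
      have h2 := (h.deriv_Y _ (sector_subset (cubeRoot_div_mem_sector hw))).scomp w h1
      have h3 : HasDerivAt
          (fun w => Complex.exp (κ * (k - α) * (Complex.log w - Complex.log midPt)))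
          (Complex.exp (κ * (k - α) * (Complex.log w - Complex.log midPt)) *
            (κ * (k - α) * w⁻¹)) w :=
        (((Complex.hasDerivAt_log hslit).sub_const _).const_mul (κ * (k - α))).cexp
      refine ((h.deriv_Z _ (sector_subset hw)).mul
        (h3.smul (h2.const_mul (reflPerm 3 2)))).congr_deriv ?_
      simp only [Function.comp_apply, Pi.smul_apply']
      generalize Complex.exp (κ * (k - α) * (Complex.log w - Complex.log midPt)) = c
      have h4 := lkConn_refl k α κ h0 (ne_singPt_of_mem (sector_subset hw))
      have h5 : Z w * lkConn k α κ w * c • (reflPerm 3 2 * Y (cubeRoot / w)) =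
          c • (Z w * (lkConn k α κ w * reflPerm 3 2) * Y (cubeRoot / w)) := by
        simp only [mul_smul_comm, mul_assoc]
      rw [neg_mul, h5, ← h4, neg_add_eq_zero]
      simp only [mul_smul_comm, smul_mul_assoc, mul_add, add_mul, mul_assoc, smul_add, smul_smul,
        div_eq_mul_inv]
      rw [add_comm]) hw midPt_mem_sector
  simp only [cubeRoot_div_midPt, sub_self, mul_zero, Complex.exp_zero, one_smul, ← mul_assoc]
    at this
  rw [← this, ← mul_assoc, h.Y_mul_Z (sector_subset hw), one_mul]

end IsFundamental

/-! ### Parallel transport along the half-turns -/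

section Transport

variable {ι : Type*} [Fintype ι]

theorem hasDerivWithinAt_mulVec {M : ℝ → Matrix ι ι ℂ} {M' : Matrix ι ι ℂ} {y : ℝ → ι → ℂ}
    {y' : ι → ℂ} {s : Set ℝ} {t : ℝ} (hM : HasDerivWithinAt M M' s t)
    (hy : HasDerivWithinAt y y' s t) :
    HasDerivWithinAt (fun t => M t *ᵥ y t) (M' *ᵥ y t + M t *ᵥ y') s t := by
  have hM' : ∀ i j, HasDerivWithinAt (fun t => M t i j) (M' i j) s t := fun i j =>
    hasDerivWithinAt_pi.1 (hasDerivWithinAt_pi.1 hM i) j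
  refine hasDerivWithinAt_pi.2 fun i => ?_
  have := HasDerivWithinAt.fun_sum (u := Finset.univ) fun j _ =>
    (hM' i j).mul (hasDerivWithinAt_pi.1 hy j)
  refine this.congr_deriv ?_
  rw [Finset.sum_add_distrib]
  rfl

/-- Parallel transport is unique and is computed by an invertible matrix of flat sections. -/
theorem isTransport_iff [DecidableEq ι]
    {Ω : (Fin 2 → ℂ) → (Fin 2 → ℂ) → Matrix ι ι ℂ} {γ : ℝ → Fin 2 → ℂ}
    {F G : ℝ → Matrix ι ι ℂ}
    (hF : ∀ t ∈ Icc (0 : ℝ) 1, HasDerivAt F (Ω (γ t) (deriv γ t) * F t) t)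
    (hG : ∀ t ∈ Icc (0 : ℝ) 1, HasDerivAt G (-(G t * Ω (γ t) (deriv γ t))) t)
    (hGF : ∀ t ∈ Icc (0 : ℝ) 1, G t * F t = 1) {P : Matrix ι ι ℂ} :
    IsTransport Ω γ P ↔ P = F 1 * G 0 := by
  have h0 : (0 : ℝ) ∈ Icc (0 : ℝ) 1 := by simp
  have h1 : (1 : ℝ) ∈ Icc (0 : ℝ) 1 := by simp
  constructor
  · intro h
    refine Matrix.mulVec_injective (funext fun v => ?_)
    obtain ⟨y, hy, hy0, hy1⟩ := h v
    have hGy : ∀ t ∈ Icc (0 : ℝ) 1,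
        HasDerivWithinAt (fun t => G t *ᵥ y t) 0 (Icc (0 : ℝ) 1) t := fun t ht => by
      refine (hasDerivWithinAt_mulVec (hG t ht).hasDerivWithinAt (hy t ht)).congr_deriv ?_
      rw [neg_mulVec, mulVec_mulVec, neg_add_cancel]
    have hconst := constant_of_has_deriv_right_zero
      (fun t ht => (hGy t ht).continuousWithinAt)
      (fun t ht => (hGy t ⟨ht.1, ht.2.le⟩).mono_of_mem_nhdsWithin (Icc_mem_nhdsGE_of_mem ht)) 1 h1
    change P *ᵥ v = _
    rw [← hy1, ← hy0, ← mulVec_mulVec, ← hconst, mulVec_mulVec, mul_eq_one_comm.1 (hGF 1 h1),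
      one_mulVec]
  · rintro rfl v
    refine ⟨fun t => F t *ᵥ (G 0 *ᵥ v), fun t ht => ?_, ?_, ?_⟩
    · refine (hasDerivWithinAt_mulVec (hF t ht).hasDerivWithinAt
        (hasDerivWithinAt_const t _ (G 0 *ᵥ v))).congr_deriv ?_
      simp only [mulVec_zero, add_zero, mulVec_mulVec, mul_assoc]
    · change F 0 *ᵥ (G 0 *ᵥ v) = v
      rw [mulVec_mulVec, mul_eq_one_comm.1 (hGF 0 h0), one_mulVec]
    · exact mulVec_mulVec _ _ _

end Transport

/-- The coordinate `u = z₁ + i z₂` of `ℂ²`. -/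
def coordU (z : Fin 2 → ℂ) : ℂ := z 0 + Complex.I * z 1

/-- The coordinate `v = z₁ - i z₂` of `ℂ²`. -/
def coordV (z : Fin 2 → ℂ) : ℂ := z 0 - Complex.I * z 1

/-- The matrix of flat sections `v ^ μ Y(u / v)`, with the principal branch of the power. -/
noncomputable def flatSection (μ : ℂ) (Y : ℂ → Matrix (ZMod 3) (ZMod 3) ℂ) (z : Fin 2 → ℂ) :
    Matrix (ZMod 3) (ZMod 3) ℂ :=
  Complex.exp (μ * Complex.log (coordV z)) • Y (coordU z / coordV z)

section Flat

variable {k α κ : ℂ} {Y Z : ℂ → Matrix (ZMod 3) (ZMod 3) ℂ} {γ : ℝ → Fin 2 → ℂ} {d : Fin 2 → ℂ}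
  {t : ℝ}

theorem hasDerivAt_coord (hγ : HasDerivAt γ d t) :
    HasDerivAt (fun t => coordU (γ t)) (coordU d) t ∧
      HasDerivAt (fun t => coordV (γ t)) (coordV d) t := by
  have h0 := hasDerivAt_pi.1 hγ 0
  have h1 := hasDerivAt_pi.1 hγ 1
  exact ⟨h0.add (h1.const_mul Complex.I), h0.sub (h1.const_mul Complex.I)⟩

theorem lineForm_ne_zero_of_mem {z : Fin 2 → ℂ} (hv : coordV z ≠ 0)
    (hw : coordU z / coordV z ∈ slitDomain) (j : ZMod 3) : lineForm 3 j z ≠ 0 :=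
  (lineForm_ne_zero_iff hv).2 (ne_singPt_of_mem hw j)

theorem IsFundamental.hasDerivAt_flatSection (h : IsFundamental k α κ Y Z)
    (hγ : HasDerivAt γ d t) (hv : coordV (γ t) ∈ Complex.slitPlane)
    (hw : coordU (γ t) / coordV (γ t) ∈ slitDomain) :
    HasDerivAt (fun t => flatSection (κ * (k - α)) Y (γ t))
        (lkForm 3 k α κ (γ t) d * flatSection (κ * (k - α)) Y (γ t)) t ∧
      HasDerivAt (fun t => flatSection (-(κ * (k - α))) Z (γ t))
        (-(flatSection (-(κ * (k - α))) Z (γ t) * lkForm 3 k α κ (γ t) d)) t := by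
  obtain ⟨hU, hV⟩ := hasDerivAt_coord hγ
  have hv0 := Complex.slitPlane_ne_zero hv
  have hW := hU.fun_div hV hv0
  have hY := (h.deriv_Y _ hw).scomp t hW
  have hZ := (h.deriv_Z _ hw).scomp t hW
  have hE : ∀ μ : ℂ, HasDerivAt (fun t => Complex.exp (μ * Complex.log (coordV (γ t))))
      (Complex.exp (μ * Complex.log (coordV (γ t))) * (μ * (coordV d / coordV (γ t)))) t :=
    fun μ => ((hV.clog_real hv).const_mul μ).cexp
  have hform : lkForm 3 k α κ (γ t) d =
      (κ * (k - α) * (coordV d / coordV (γ t))) • 1 +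
        ((coordU d * coordV (γ t) - coordU (γ t) * coordV d) / coordV (γ t) ^ 2) •
          lkConn k α κ (coordU (γ t) / coordV (γ t)) :=
    lkForm_eq k α κ hv0 (lineForm_ne_zero_of_mem hv0 hw)
  rw [hform]
  refine ⟨((hE _).smul hY).congr_deriv ?_, ((hE _).smul hZ).congr_deriv ?_⟩
  · simp only [flatSection, Function.comp_apply, add_mul, smul_mul_assoc, one_mul, mul_smul_comm]
    module
  · simp only [flatSection, Function.comp_apply, mul_add, smul_mul_assoc, mul_one, mul_smul_comm]
    module

theorem IsFundamental.flatSection_mul (h : IsFundamental k α κ Y Z) {μ : ℂ} {z : Fin 2 → ℂ}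
    (hw : coordU z / coordV z ∈ slitDomain) :
    flatSection (-μ) Z z * flatSection μ Y z = 1 := by
  rw [flatSection, flatSection, smul_mul_smul_comm, h.Z_mul_Y hw, ← Complex.exp_add, neg_mul,
    neg_add_cancel, Complex.exp_zero, one_smul]

end Flat

theorem lineForm_zero (z : Fin 2 → ℂ) : lineForm 3 0 z = z 1 := by
  simp [lineForm, lineNormal, lineAngle]

theorem lineAngle_one : lineAngle 3 1 = π / 3 := by
  have : (1 : ZMod 3).val = 1 := rfl
  simp [lineAngle, this]

theorem lineAngle_two : lineAngle 3 2 = π - π / 3 := by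
  have : (2 : ZMod 3).val = 2 := rfl
  rw [lineAngle, this]
  push_cast
  ring

theorem lineForm_one (z : Fin 2 → ℂ) :
    lineForm 3 1 z = -((√3 / 2 : ℝ) : ℂ) * z 0 + 1 / 2 * z 1 := by
  simp only [lineForm, lineNormal, lineAngle_one, Real.sin_pi_div_three, Real.cos_pi_div_three,
    cons_val_zero, cons_val_one, cons_val_fin_one]
  push_cast
  ring

theorem lineForm_two (z : Fin 2 → ℂ) :
    lineForm 3 2 z = -((√3 / 2 : ℝ) : ℂ) * z 0 - 1 / 2 * z 1 := by
  simp only [lineForm, lineNormal, lineAngle_two, Real.sin_pi_sub, Real.cos_pi_sub,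
    Real.sin_pi_div_three, Real.cos_pi_div_three,
    cons_val_zero, cons_val_one, cons_val_fin_one]
  push_cast
  ring

theorem norm_lineForm_ge {j : ZMod 3} (hj : j ≠ 0) (z : Fin 2 → ℂ) :
    √3 / 2 * ‖z 0‖ - 1 / 2 * ‖z 1‖ ≤ ‖lineForm 3 j z‖ := by
  have h0 : ‖((√3 / 2 : ℝ) : ℂ) * z 0‖ = √3 / 2 * ‖z 0‖ := by
    rw [norm_mul, Complex.norm_real, Real.norm_of_nonneg (by positivity)]
  have h1 : ‖(1 / 2 : ℂ) * z 1‖ = 1 / 2 * ‖z 1‖ := by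
    rw [norm_mul]; norm_num
  rw [← h0, ← h1]
  have hj' : j = 1 ∨ j = 2 := by revert j; decide
  rcases hj' with rfl | rfl
  · rw [lineForm_one, neg_mul, neg_add_eq_sub, norm_sub_rev]
    exact norm_sub_norm_le _ _
  · rw [lineForm_two, neg_mul, ← neg_add', norm_neg]
    exact norm_sub_le_norm_add _ _

theorem inChamber_iff {p : Fin 2 → ℝ} : InChamber 3 p ↔ 0 < p 1 ∧ p 1 < √3 * p 0 := by
  rw [InChamber]
  push_cast
  rw [Real.sin_pi_div_three, Real.cos_pi_div_three]
  constructor <;> rintro ⟨h1, h2⟩ <;> exact ⟨h1, by linarith⟩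

theorem InChamber.pos {p : Fin 2 → ℝ} (hp : InChamber 3 p) : 0 < p 0 := by
  obtain ⟨h1, h2⟩ := inChamber_iff.1 hp
  have : 0 < √3 := by positivity
  by_contra! h
  nlinarith

theorem halfTurn_zero (p : Fin 2 → ℝ) (t : ℝ) :
    halfTurn 3 p 0 t = ![(p 0 : ℂ), Complex.exp (π * Complex.I * t) * p 1] := by
  ext a
  rw [halfTurn, lineForm_zero]
  fin_cases a
  · simp [lineNormal, lineAngle]
  · simp [lineNormal, lineAngle]
    ring

theorem hasDerivAt_halfTurn_zero (p : Fin 2 → ℝ) (t : ℝ) :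
    HasDerivAt (halfTurn 3 p 0)
      ![0, Complex.exp (π * Complex.I * t) * (π * Complex.I) * p 1] t := by
  have h : halfTurn 3 p 0 = fun t : ℝ => ![(p 0 : ℂ), Complex.exp (π * Complex.I * t) * p 1] :=
    funext (halfTurn_zero p)
  rw [h]
  refine hasDerivAt_pi.2 fun a => ?_
  fin_cases a
  · exact hasDerivAt_const t _
  · have h1 : HasDerivAt (fun t : ℝ => (π * Complex.I * t : ℂ)) (π * Complex.I) t := by
      simpa using (Complex.ofRealCLM.hasDerivAt (x := t)).const_mul (π * Complex.I : ℂ)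
    exact h1.cexp.mul_const _

theorem norm_exp_pi_mul_I (t : ℝ) : ‖Complex.exp (π * Complex.I * t)‖ = 1 := by
  have : (π * Complex.I * t : ℂ) = ((π * t : ℝ) : ℂ) * Complex.I := by push_cast; ring
  rw [this, Complex.norm_exp_ofReal_mul_I]

theorem exp_pi_mul_I (t : ℝ) :
    Complex.exp (π * Complex.I * t) = ⟨Real.cos (π * t), Real.sin (π * t)⟩ := by
  have : (π * Complex.I * t : ℂ) = ((π * t : ℝ) : ℂ) * Complex.I := by push_cast; ring
  rw [this]
  apply Complex.ext
  · rw [Complex.exp_ofReal_mul_I_re]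
  · rw [Complex.exp_ofReal_mul_I_im]

/-- The half-turn around `H_0` stays in the closed unit disc of the coordinate `w`. -/
theorem halfTurn_zero_mem {p : Fin 2 → ℝ} (hp : InChamber 3 p) {t : ℝ} (ht : t ∈ Icc (0 : ℝ) 1) :
    coordV (halfTurn 3 p 0 t) ∈ Complex.slitPlane ∧
      coordU (halfTurn 3 p 0 t) / coordV (halfTurn 3 p 0 t) ∈ slitDomain := by
  have hp0 := hp.pos
  obtain ⟨hp1, hp2⟩ := inChamber_iff.1 hp
  have hsin : 0 ≤ Real.sin (π * t) := Real.sin_nonneg_of_nonneg_of_le_pi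
    (mul_nonneg Real.pi_pos.le ht.1) (mul_le_of_le_one_right Real.pi_pos.le ht.2)
  have hV : coordV (halfTurn 3 p 0 t) =
      ⟨p 0 + Real.sin (π * t) * p 1, -(Real.cos (π * t) * p 1)⟩ := by
    rw [halfTurn_zero, coordV, exp_pi_mul_I]
    apply Complex.ext <;> simp
  have hU : coordU (halfTurn 3 p 0 t) =
      ⟨p 0 - Real.sin (π * t) * p 1, Real.cos (π * t) * p 1⟩ := by
    rw [halfTurn_zero, coordU, exp_pi_mul_I]
    apply Complex.ext <;> simp [sub_eq_add_neg]
  have hv : coordV (halfTurn 3 p 0 t) ∈ Complex.slitPlane := by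
    rw [hV, Complex.mem_slitPlane_iff]
    left
    exact add_pos_of_pos_of_nonneg hp0 (mul_nonneg hsin hp1.le)
  refine ⟨hv, mem_slitDomain_of_norm_le ?_ fun j =>
    (lineForm_ne_zero_iff (Complex.slitPlane_ne_zero hv)).1 ?_⟩
  · rw [norm_div]
    refine div_le_one_of_le₀ ?_ (norm_nonneg _)
    rw [← sq_le_sq₀ (norm_nonneg _) (norm_nonneg _), Complex.sq_norm, Complex.sq_norm, hU, hV,
      Complex.normSq_mk, Complex.normSq_mk]
    have : 0 ≤ p 0 * (Real.sin (π * t) * p 1) := by positivity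
    nlinarith
  · by_cases hj : j = 0
    · subst hj
      rw [lineForm_zero, halfTurn_zero]
      simpa using hp1.ne'
    · rw [← norm_pos_iff]
      refine lt_of_lt_of_le ?_ (norm_lineForm_ge hj _)
      rw [halfTurn_zero]
      simp only [cons_val_zero, cons_val_one, cons_val_fin_one, norm_mul, norm_exp_pi_mul_I,
        Complex.norm_real, Real.norm_of_nonneg hp0.le, Real.norm_of_nonneg hp1.le]
      linarith

/-! ### The monodromy of the two half-turns -/

/-- The coordinate `w = u / v` of a real point. -/
noncomputable def realPt (p : Fin 2 → ℝ) : ℂ :=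
  (p 0 + Complex.I * p 1) / (p 0 - Complex.I * p 1)

theorem realPt_den_ne_zero {p : Fin 2 → ℝ} (hp : p 0 ≠ 0) :
    (p 0 + Complex.I * p 1 : ℂ) ≠ 0 ∧ (p 0 - Complex.I * p 1 : ℂ) ≠ 0 := by
  constructor <;> intro h <;> exact hp (by simpa using congrArg Complex.re h)

theorem realPt_mem_sector {p : Fin 2 → ℝ} (hp : InChamber 3 p) : realPt p ∈ sector := by
  have hp0 := hp.pos
  obtain ⟨hp1, hp2⟩ := inChamber_iff.1 hp
  have hN : 0 < p 0 * p 0 + p 1 * p 1 := by positivity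
  have hw : realPt p = ⟨(p 0 * p 0 - p 1 * p 1) / (p 0 * p 0 + p 1 * p 1),
      2 * p 0 * p 1 / (p 0 * p 0 + p 1 * p 1)⟩ := by
    rw [realPt, div_eq_iff (realPt_den_ne_zero hp0.ne').2]
    apply Complex.ext <;> simp <;> field_simp <;> ring
  refine ⟨?_, ?_⟩
  · rw [hw]
    positivity
  · rw [div_cubeRoot_im, hw]
    have h3 := Real.mul_self_sqrt (show (0:ℝ) ≤ 3 by norm_num)
    have h4 : (√3 / 2 * ((p 0 * p 0 - p 1 * p 1) / (p 0 * p 0 + p 1 * p 1)) +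
        2 * p 0 * p 1 / (p 0 * p 0 + p 1 * p 1) / 2) =
        1 / 2 * (√3 * p 0 - p 1) * (p 0 + √3 * p 1) / (p 0 * p 0 + p 1 * p 1) := by
      field_simp
      linear_combination (-p 0 * p 1) * h3
    simp only [h4]
    rw [neg_lt_zero]
    refine div_pos (mul_pos (mul_pos (by norm_num) (by linarith)) ?_) hN
    positivity

/-- `log w = log v̄ - log v` on the chamber, where both logarithms have small imaginary part. -/
theorem log_realPt {p : Fin 2 → ℝ} (hp : 0 < p 0) :
    Complex.log (realPt p) =
      Complex.log (p 0 + Complex.I * p 1) - Complex.log (p 0 - Complex.I * p 1) := by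
  obtain ⟨h1, h2⟩ := realPt_den_ne_zero (p := p) hp.ne'
  have a1 : |Complex.arg (p 0 + Complex.I * p 1)| < π / 2 :=
    Complex.abs_arg_lt_pi_div_two_iff.2 (Or.inl (by simpa using hp))
  have a2 : |Complex.arg (p 0 - Complex.I * p 1)| < π / 2 :=
    Complex.abs_arg_lt_pi_div_two_iff.2 (Or.inl (by simpa using hp))
  rw [abs_lt] at a1 a2
  rw [← Complex.log_exp (x := Complex.log (p 0 + Complex.I * p 1) -
    Complex.log (p 0 - Complex.I * p 1))]
  · rw [Complex.exp_sub, Complex.exp_log h1, Complex.exp_log h2, realPt]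
  · rw [Complex.sub_im, Complex.log_im, Complex.log_im]; linarith
  · rw [Complex.sub_im, Complex.log_im, Complex.log_im]; linarith

theorem log_midPt : Complex.log midPt = π / 3 * Complex.I := by
  rw [midPt, Complex.log_exp]
  · simp; linarith [Real.pi_pos]
  · simp; linarith [Real.pi_pos]

/-- The scalar `ζ = exp(iπμ/3)`, with `μ = κ (k - α)`. -/
noncomputable def zetaPar (k α κ : ℂ) : ℂ := Complex.exp (κ * (k - α) * (π / 3 * Complex.I))

theorem zetaPar_ne_zero (k α κ : ℂ) : zetaPar k α κ ≠ 0 := Complex.exp_ne_zero _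

section Monodromy

variable {k α κ : ℂ} {Y Z : ℂ → Matrix (ZMod 3) (ZMod 3) ℂ} {p : Fin 2 → ℝ}

/-- The reflection `ι(s_2)` of the fibre over `midPt`, which is fixed by `w ↦ ω / w`, transported to
the centre of the disc. -/
noncomputable def midRefl (Y Z : ℂ → Matrix (ZMod 3) (ZMod 3) ℂ) : Matrix (ZMod 3) (ZMod 3) ℂ :=
  Z midPt * reflPerm 3 2 * Y midPt

theorem IsFundamental.midRefl_mul_self (h : IsFundamental k α κ Y Z) :
    midRefl Y Z * midRefl Y Z = 1 := by
  have hm := sector_subset midPt_mem_sector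
  calc midRefl Y Z * midRefl Y Z =
      Z midPt * (reflPerm 3 2 * (Y midPt * Z midPt) * reflPerm 3 2) * Y midPt := by
        simp only [midRefl, mul_assoc]
    _ = 1 := by rw [h.Y_mul_Z hm, mul_one, reflPerm_mul_self, mul_one, h.Z_mul_Y hm]

theorem isTransport_halfTurn_zero_iff (h : IsFundamental k α κ Y Z) (hp : InChamber 3 p)
    {P : Matrix (ZMod 3) (ZMod 3) ℂ} :
    IsTransport (lkForm 3 k α κ) (halfTurn 3 p 0) P ↔
      P = flatSection (κ * (k - α)) Y (halfTurn 3 p 0 1) *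
        flatSection (-(κ * (k - α))) Z (halfTurn 3 p 0 0) := by
  have hd := fun t (ht : t ∈ Icc (0 : ℝ) 1) =>
    h.hasDerivAt_flatSection (hasDerivAt_halfTurn_zero p t).differentiableAt.hasDerivAt
      (halfTurn_zero_mem hp ht).1 (halfTurn_zero_mem hp ht).2
  exact isTransport_iff (fun t ht => (hd t ht).1) (fun t ht => (hd t ht).2)
    fun t ht => h.flatSection_mul (halfTurn_zero_mem hp ht).2

/-- The monodromy of the half-turn around `H_0`. -/
theorem reflPerm_zero_mul_transport (h : IsFundamental k α κ Y Z) (hp : InChamber 3 p) :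
    reflPerm 3 0 * (flatSection (κ * (k - α)) Y (halfTurn 3 p 0 1) *
        flatSection (-(κ * (k - α))) Z (halfTurn 3 p 0 0)) =
      zetaPar k α κ • (Y (realPt p) * (midRefl Y Z * rotPerm) * Z (realPt p)) := by
  have hS := realPt_mem_sector hp
  have hw0 := ne_zero_of_mem_sector hS
  have e1 : Complex.exp (π * Complex.I * (1 : ℝ)) = -1 := by
    rw [Complex.ofReal_one, mul_one, Complex.exp_pi_mul_I]
  have hU1 : coordU (halfTurn 3 p 0 1) = p 0 - Complex.I * p 1 := by
    rw [halfTurn_zero, e1, coordU]; simp; ring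
  have hV1 : coordV (halfTurn 3 p 0 1) = p 0 + Complex.I * p 1 := by
    rw [halfTurn_zero, e1, coordV]; simp
  have hU0 : coordU (halfTurn 3 p 0 0) = p 0 + Complex.I * p 1 := by
    rw [halfTurn_zero, coordU]; simp
  have hV0 : coordV (halfTurn 3 p 0 0) = p 0 - Complex.I * p 1 := by
    rw [halfTurn_zero, coordV]; simp
  have hw1 : (p 0 - Complex.I * p 1 : ℂ) / (p 0 + Complex.I * p 1) = (realPt p)⁻¹ := by
    rw [realPt, inv_div]
  have hinv : (realPt p)⁻¹ ∈ slitDomain := by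
    have := (halfTurn_zero_mem hp (t := 1) (by simp)).2
    rwa [hU1, hV1, hw1] at this
  have hrefl : reflPerm 3 2 * Y (cubeRoot / realPt p) =
      Complex.exp (-(κ * (k - α) * (Complex.log (realPt p) - Complex.log midPt))) •
        (Y (realPt p) * midRefl Y Z) := by
    rw [midRefl, h.Y_refl hS, smul_smul, ← Complex.exp_add, neg_add_cancel, Complex.exp_zero,
      one_smul]
  have hY1 : reflPerm 3 0 * Y (realPt p)⁻¹ = reflPerm 3 2 * Y (cubeRoot / realPt p) * rotPerm := by
    rw [reflPerm_zero_eq, mul_assoc, ← h.Y_rot hinv, ← mul_assoc, div_eq_mul_inv]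
  rw [flatSection, flatSection, hU1, hV1, hU0, hV0, hw1, smul_mul_smul_comm, mul_smul_comm,
    ← mul_assoc, hY1, hrefl, smul_mul_assoc, smul_mul_assoc, smul_smul, ← Complex.exp_add,
    ← Complex.exp_add]
  change _ • (_ * Z (realPt p)) = _
  rw [zetaPar, ← log_midPt, log_realPt hp.pos]
  congr 2
  · ring
  · simp only [mul_assoc]

/-- The isometry `-s_2` of the plane, which exchanges `H_0` and `H_1` and preserves the chamber. -/
noncomputable def chamberFlip (z : Fin 2 → ℂ) : Fin 2 → ℂ :=
  ![1 / 2 * z 0 + (√3 / 2 : ℝ) * z 1, (√3 / 2 : ℝ) * z 0 - 1 / 2 * z 1]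

/-- The restriction of `-s_2` to the real plane. -/
noncomputable def chamberFlipReal (p : Fin 2 → ℝ) : Fin 2 → ℝ :=
  ![1 / 2 * p 0 + √3 / 2 * p 1, √3 / 2 * p 0 - 1 / 2 * p 1]

theorem inChamber_flip (hp : InChamber 3 p) : InChamber 3 (chamberFlipReal p) := by
  obtain ⟨hp1, hp2⟩ := inChamber_iff.1 hp
  have h3 := Real.mul_self_sqrt (show (0:ℝ) ≤ 3 by norm_num)
  refine inChamber_iff.2 ⟨?_, ?_⟩
  · simp [chamberFlipReal]; linarith
  · simp [chamberFlipReal]; nlinarith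

theorem sqrt_three_half_sq : ((√3 / 2 : ℝ) : ℂ) * ((√3 / 2 : ℝ) : ℂ) = 3 / 4 := by
  rw [← Complex.ofReal_mul]
  have h3 := Real.mul_self_sqrt (show (0:ℝ) ≤ 3 by norm_num)
  have : √3 / 2 * (√3 / 2) = 3 / 4 := by linarith
  rw [this]
  push_cast
  rfl

theorem midPt_eq : midPt = 1 / 2 + (√3 / 2 : ℝ) * Complex.I := by
  have h : (π / 3 * Complex.I : ℂ) = ((π / 3 : ℝ) : ℂ) * Complex.I := by push_cast; ring
  rw [midPt, h, Complex.exp_mul_I, ← Complex.ofReal_cos, ← Complex.ofReal_sin,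
    Real.cos_pi_div_three, Real.sin_pi_div_three]
  push_cast
  ring

theorem realPt_flip (hp : InChamber 3 p) : realPt (chamberFlipReal p) = cubeRoot / realPt p := by
  obtain ⟨h1, h2⟩ := realPt_den_ne_zero (p := p) hp.pos.ne'
  have hr := sqrt_three_half_sq
  have hI := Complex.I_mul_I
  have e0 : ((chamberFlipReal p 0 : ℝ) : ℂ) = 1 / 2 * p 0 + (√3 / 2 : ℝ) * p 1 := by
    simp [chamberFlipReal]
  have e1 : ((chamberFlipReal p 1 : ℝ) : ℂ) = (√3 / 2 : ℝ) * p 0 - 1 / 2 * p 1 := by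
    simp [chamberFlipReal]
  have hu : (chamberFlipReal p 0 + Complex.I * chamberFlipReal p 1 : ℂ) =
      midPt * (p 0 - Complex.I * p 1) := by
    rw [e0, e1, midPt_eq]
    linear_combination (((√3 / 2 : ℝ) : ℂ) * p 1) * hI
  have hv : midPt * (chamberFlipReal p 0 - Complex.I * chamberFlipReal p 1 : ℂ) =
      p 0 + Complex.I * p 1 := by
    rw [e0, e1, midPt_eq]
    linear_combination (-(((√3 / 2 : ℝ) : ℂ) * ((√3 / 2 : ℝ) : ℂ)) * p 0 +
      ((√3 / 2 : ℝ) : ℂ) * p 1 / 2) * hI + (p 0 + Complex.I * p 1) * hr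
  have h3 : (chamberFlipReal p 0 - Complex.I * chamberFlipReal p 1 : ℂ) ≠ 0 :=
    (realPt_den_ne_zero (inChamber_flip hp).pos.ne').2
  rw [realPt, hu, ← midPt_sq, realPt, ← hv]
  have := midPt_ne_zero
  field_simp

theorem lineForm_flip (j : ZMod 3) (z : Fin 2 → ℂ) :
    lineForm 3 j (chamberFlip z) = (if j = 2 then 1 else -1) * lineForm 3 (2 * 2 - j) z := by
  have h3 : j = 0 ∨ j = 1 ∨ j = 2 := by revert j; decide
  have hr := sqrt_three_half_sq
  rcases h3 with rfl | rfl | rfl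
  · have e : (2 * 2 - 0 : ZMod 3) = 1 := by decide
    have e' : (0 : ZMod 3) ≠ 2 := by decide
    rw [e, if_neg e', lineForm_zero, lineForm_one]
    simp only [chamberFlip, cons_val_one, cons_val_fin_one]
    ring
  · have e : (2 * 2 - 1 : ZMod 3) = 0 := by decide
    have e' : (1 : ZMod 3) ≠ 2 := by decide
    rw [e, if_neg e', lineForm_zero, lineForm_one]
    simp only [chamberFlip, cons_val_zero, cons_val_one, cons_val_fin_one]
    linear_combination -z 1 * hr
  · have e : (2 * 2 - 2 : ZMod 3) = 2 := by decide
    rw [e, if_pos rfl, lineForm_two, lineForm_two]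
    simp only [chamberFlip, cons_val_zero, cons_val_one, cons_val_fin_one]
    linear_combination -z 1 * hr

/-- The connection form is invariant under `-s_2`. -/
theorem lkForm_flip (k α κ : ℂ) (z d : Fin 2 → ℂ) :
    lkForm 3 k α κ (chamberFlip z) (chamberFlip d) =
      reflPerm 3 2 * lkForm 3 k α κ z d * reflPerm 3 2 := by
  rw [lkForm, lkForm, mul_smul_comm, smul_mul_assoc, Finset.mul_sum, Finset.sum_mul,
    ← Equiv.sum_comp (Equiv.subLeft (2 * 2 : ZMod 3))]
  congr 1
  refine Finset.sum_congr rfl fun j _ => ?_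
  rw [Equiv.subLeft_apply, mul_smul_comm, smul_mul_assoc]
  change _ • lkRes k α _ = _ • (_ * lkRes k α j * _)
  rw [reflPerm_mul_lkRes, mul_assoc, reflPerm_mul_self, mul_one, lineForm_flip, lineForm_flip,
    sub_sub_cancel, mul_div_mul_left]
  split_ifs <;> norm_num

theorem halfTurn_one (p : Fin 2 → ℝ) (t : ℝ) :
    halfTurn 3 p 1 t = chamberFlip (halfTurn 3 (chamberFlipReal p) 0 t) := by
  have hr := sqrt_three_half_sq
  have e0 : ((chamberFlipReal p 0 : ℝ) : ℂ) = 1 / 2 * p 0 + (√3 / 2 : ℝ) * p 1 := by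
    simp [chamberFlipReal]
  have e1 : ((chamberFlipReal p 1 : ℝ) : ℂ) = (√3 / 2 : ℝ) * p 0 - 1 / 2 * p 1 := by
    simp [chamberFlipReal]
  rw [halfTurn_zero]
  ext a
  rw [halfTurn, lineForm_one, e0, e1]
  fin_cases a
  · simp only [lineNormal, lineAngle_one, Real.sin_pi_div_three, Real.cos_pi_div_three,
      chamberFlip, Fin.zero_eta, cons_val_zero, cons_val_one, cons_val_fin_one]
    rw [Complex.ofReal_neg]
    linear_combination (-p 0) * hr
  · simp only [lineNormal, lineAngle_one, Real.sin_pi_div_three, Real.cos_pi_div_three,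
      chamberFlip, Fin.mk_one, cons_val_zero, cons_val_one, cons_val_fin_one]
    push_cast
    push_cast at hr
    linear_combination (-p 1) * hr

theorem hasDerivAt_flip {γ : ℝ → Fin 2 → ℂ} {d : Fin 2 → ℂ} {t : ℝ} (h : HasDerivAt γ d t) :
    HasDerivAt (fun t => chamberFlip (γ t)) (chamberFlip d) t := by
  have h0 := hasDerivAt_pi.1 h 0
  have h1 := hasDerivAt_pi.1 h 1
  refine hasDerivAt_pi.2 fun a => ?_
  fin_cases a
  · exact (h0.const_mul (1 / 2)).add (h1.const_mul _)
  · exact (h0.const_mul _).sub (h1.const_mul (1 / 2))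

theorem isTransport_halfTurn_one_iff (h : IsFundamental k α κ Y Z) (hp : InChamber 3 p)
    {P : Matrix (ZMod 3) (ZMod 3) ℂ} :
    IsTransport (lkForm 3 k α κ) (halfTurn 3 p 1) P ↔
      P = reflPerm 3 2 * flatSection (κ * (k - α)) Y (halfTurn 3 (chamberFlipReal p) 0 1) *
        (flatSection (-(κ * (k - α))) Z (halfTurn 3 (chamberFlipReal p) 0 0) * reflPerm 3 2) := by
  have hp' := inChamber_flip hp
  have hγ : halfTurn 3 p 1 = fun t => chamberFlip (halfTurn 3 (chamberFlipReal p) 0 t) :=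
    funext (halfTurn_one p)
  have hd := fun t (ht : t ∈ Icc (0 : ℝ) 1) =>
    h.hasDerivAt_flatSection (hasDerivAt_halfTurn_zero (chamberFlipReal p) t)
      (halfTurn_zero_mem hp' ht).1 (halfTurn_zero_mem hp' ht).2
  have hJ := reflPerm_mul_self 2
  have hform : ∀ t, lkForm 3 k α κ (halfTurn 3 p 1 t) (deriv (halfTurn 3 p 1) t) =
      reflPerm 3 2 * lkForm 3 k α κ (halfTurn 3 (chamberFlipReal p) 0 t)
        ![0, Complex.exp (π * Complex.I * t) * (π * Complex.I) * chamberFlipReal p 1] *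
        reflPerm 3 2 := fun t => by
    rw [hγ, (hasDerivAt_flip (hasDerivAt_halfTurn_zero (chamberFlipReal p) t)).deriv, lkForm_flip]
  refine isTransport_iff
    (F := fun t => reflPerm 3 2 *
      flatSection (κ * (k - α)) Y (halfTurn 3 (chamberFlipReal p) 0 t))
    (G := fun t => flatSection (-(κ * (k - α))) Z (halfTurn 3 (chamberFlipReal p) 0 t) *
      reflPerm 3 2)
    (fun t ht => ?_) (fun t ht => ?_) fun t ht => ?_
  · rw [hform]
    refine ((hd t ht).1.const_mul (reflPerm 3 2)).congr_deriv ?_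
    generalize lkForm 3 k α κ _ _ = Ω
    rw [mul_assoc (reflPerm 3 2 * _), ← mul_assoc (reflPerm 3 2) (reflPerm 3 2), hJ, one_mul,
      mul_assoc]
  · rw [hform]
    refine ((hd t ht).2.mul_const (reflPerm 3 2)).congr_deriv ?_
    generalize lkForm 3 k α κ _ _ = Ω
    rw [mul_assoc (reflPerm 3 2), mul_assoc (flatSection _ _ _), ← mul_assoc (reflPerm 3 2), hJ,
      one_mul, neg_mul, ← mul_assoc]
  · rw [mul_assoc, ← mul_assoc (reflPerm 3 2), hJ, one_mul]
    exact h.flatSection_mul (halfTurn_zero_mem hp' ht).2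

/-- The two monodromy operators, in the frame of the fundamental solution. -/
theorem isLKMonodromy_iff (h : IsFundamental k α κ Y Z) (hp : InChamber 3 p)
    {T : Matrix (ZMod 3) (ZMod 3) ℂ} :
    (IsLKMonodromy 3 k α κ p 0 T ↔
      T = zetaPar k α κ • (Y (realPt p) * (midRefl Y Z * rotPerm) * Z (realPt p))) ∧
    (IsLKMonodromy 3 k α κ p 1 T ↔
      T = zetaPar k α κ • (Y (realPt p) * (rotPerm * midRefl Y Z) * Z (realPt p))) := by
  have c0 : (((0 : Fin 2).val : ℕ) : ZMod 3) = 0 := rfl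
  have c1 : (((1 : Fin 2).val : ℕ) : ZMod 3) = 1 := rfl
  have hS := realPt_mem_sector hp
  have hwD := sector_subset hS
  have hwD' := sector_subset (cubeRoot_div_mem_sector hS)
  constructor
  · rw [IsLKMonodromy, c0]
    simp only [isTransport_halfTurn_zero_iff h hp, exists_eq_left]
    rw [reflPerm_zero_mul_transport h hp]
  · rw [IsLKMonodromy, c1]
    simp only [isTransport_halfTurn_one_iff h hp, exists_eq_left]
    have key := reflPerm_zero_mul_transport h (inChamber_flip hp)
    rw [realPt_flip hp] at key
    set F := flatSection (κ * (k - α)) Y (halfTurn 3 (chamberFlipReal p) 0 1)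
    set G := flatSection (-(κ * (k - α))) Z (halfTurn 3 (chamberFlipReal p) 0 0)
    set w := realPt p
    set c := Complex.exp (κ * (k - α) * (Complex.log w - Complex.log midPt)) with hc
    have hc0 : c ≠ 0 := Complex.exp_ne_zero _
    have hY : reflPerm 3 2 * Y (cubeRoot / w) = c⁻¹ • (Y w * midRefl Y Z) := by
      rw [midRefl, h.Y_refl hS, smul_smul, inv_mul_cancel₀ hc0, one_smul]
    have hZ : Z (cubeRoot / w) * reflPerm 3 2 = c • (midRefl Y Z * Z w) := by
      have e1 : Z (cubeRoot / w) * reflPerm 3 2 * (reflPerm 3 2 * Y (cubeRoot / w)) = 1 := by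
        rw [mul_assoc, ← mul_assoc (reflPerm 3 2), reflPerm_mul_self, one_mul, h.Z_mul_Y hwD']
      have e2 : reflPerm 3 2 * Y (cubeRoot / w) * (c • (midRefl Y Z * Z w)) = 1 := by
        rw [hY, smul_mul_smul_comm, inv_mul_cancel₀ hc0, one_smul, mul_assoc,
          ← mul_assoc (midRefl Y Z), h.midRefl_mul_self, one_mul, h.Y_mul_Z hwD]
      exact left_inv_eq_right_inv e1 e2
    have hR : reflPerm 3 1 * reflPerm 3 2 = reflPerm 3 2 * reflPerm 3 0 := by
      rw [reflPerm_one_mul, reflPerm_zero_eq, ← mul_assoc, reflPerm_mul_self, one_mul]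
    have : reflPerm 3 1 * (reflPerm 3 2 * F * (G * reflPerm 3 2)) =
        zetaPar k α κ • (Y w * (rotPerm * midRefl Y Z) * Z w) := by
      calc reflPerm 3 1 * (reflPerm 3 2 * F * (G * reflPerm 3 2)) =
          reflPerm 3 1 * reflPerm 3 2 * (F * G) * reflPerm 3 2 := by simp only [mul_assoc]
        _ = reflPerm 3 2 * (reflPerm 3 0 * (F * G)) * reflPerm 3 2 := by
          rw [hR]; simp only [mul_assoc]
        _ = zetaPar k α κ • ((reflPerm 3 2 * Y (cubeRoot / w)) * (midRefl Y Z * rotPerm) *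
              (Z (cubeRoot / w) * reflPerm 3 2)) := by
          rw [key]; simp only [mul_smul_comm, smul_mul_assoc, mul_assoc]
        _ = zetaPar k α κ •
              (Y w * (midRefl Y Z * midRefl Y Z) * (rotPerm * midRefl Y Z) * Z w) := by
          rw [hY, hZ, smul_mul_assoc, smul_mul_smul_comm, inv_mul_cancel₀ hc0, one_smul]
          simp only [mul_assoc]
        _ = _ := by rw [h.midRefl_mul_self, mul_one]
    rw [this]

end Monodromy

open Filter Topology

/-! ### The eigenvalues of the local monodromy -/

theorem exp_mul_of_mul_eq_smul {A M : Matrix (ZMod 3) (ZMod 3) ℂ} {c : ℂ} (h : A * M = c • M) :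
    NormedSpace.exp A * M = Complex.exp c • M := by
  have hpow : ∀ n : ℕ, A ^ n * M = c ^ n • M := fun n => by
    induction n with
    | zero => simp
    | succ n ih => rw [pow_succ, mul_assoc, h, mul_smul_comm, ih, smul_smul, pow_succ, mul_comm c]
  have h1 := (NormedSpace.exp_series_hasSum_exp' (𝕂 := ℂ) A).mul_right M
  have h2 := (NormedSpace.exp_series_hasSum_exp' (𝕂 := ℂ) c).smul_const M
  rw [Complex.exp_eq_exp_ℂ]
  have h3 : (fun n : ℕ => ((n.factorial : ℂ)⁻¹ • A ^ n) * M) =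
      fun n : ℕ => ((n.factorial : ℂ)⁻¹ • c ^ n) • M := funext fun n => by
    rw [smul_mul_assoc, hpow, smul_smul, smul_eq_mul]
  rw [h3] at h1
  exact h1.unique h2

theorem mul_exp_of_mul_eq_smul {A M : Matrix (ZMod 3) (ZMod 3) ℂ} {c : ℂ} (h : M * A = c • M) :
    M * NormedSpace.exp A = Complex.exp c • M := by
  have hpow : ∀ n : ℕ, M * A ^ n = c ^ n • M := fun n => by
    induction n with
    | zero => simp
    | succ n ih => rw [pow_succ, ← mul_assoc, ih, smul_mul_assoc, h, smul_smul, pow_succ]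
  have h1 := (NormedSpace.exp_series_hasSum_exp' (𝕂 := ℂ) A).mul_left M
  have h2 := (NormedSpace.exp_series_hasSum_exp' (𝕂 := ℂ) c).smul_const M
  rw [Complex.exp_eq_exp_ℂ]
  have h3 : (fun n : ℕ => M * ((n.factorial : ℂ)⁻¹ • A ^ n)) =
      fun n : ℕ => ((n.factorial : ℂ)⁻¹ • c ^ n) • M := funext fun n => by
    rw [mul_smul_comm, hpow, smul_smul, smul_eq_mul]
  rw [h3] at h1
  exact h1.unique h2

/-- The characteristic polynomial of `ι(s_0) exp(c A_0)`, where `A_0` is the residue along `H_0`.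
The vectors `v_0` and `v_1 - v_2` are eigenvectors, and so is the covector `v_1^* + v_2^*`; this
covers the resonant case in which `A_0` is not diagonalizable. -/
theorem det_sub_reflPerm_mul_exp (k α c x : ℂ) :
    (x • (1 : Matrix (ZMod 3) (ZMod 3) ℂ) -
      reflPerm 3 0 * NormedSpace.exp (c • lkRes k α 0)).det =
    (x - Complex.exp (c * (k - α))) * (x - Complex.exp (c * k)) * (x + Complex.exp (-(c * k))) := by
  set E := NormedSpace.exp (c • lkRes k α 0) with hE
  have hsum : ∀ f : ZMod 3 → ℂ, ∑ i, f i = f 0 + f 1 + f 2 := fun f => Fin.sum_univ_three f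
  have hall : ∀ a : ZMod 3, a = 0 ∨ a = 1 ∨ a = 2 := by decide
  have h1 : E * Matrix.of (fun a _ => if a = 0 then 1 else 0) =
      Complex.exp (c * (k - α)) • Matrix.of (fun a _ => if a = 0 then 1 else 0) := by
    refine exp_mul_of_mul_eq_smul ?_
    ext a b
    rw [smul_mul_assoc, Matrix.smul_apply, Matrix.mul_apply, hsum, lkRes_apply, lkRes_apply,
      lkRes_apply]
    rcases hall a with rfl | rfl | rfl <;> simp +decide
  have h2 : E * Matrix.of (fun a _ => if a = 1 then 1 else if a = 2 then -1 else 0) =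
      Complex.exp (-(c * k)) • Matrix.of (fun a _ => if a = 1 then 1 else if a = 2 then -1 else 0)
      := by
    refine exp_mul_of_mul_eq_smul ?_
    ext a b
    rw [smul_mul_assoc, Matrix.smul_apply, Matrix.mul_apply, hsum, lkRes_apply, lkRes_apply,
      lkRes_apply]
    rcases hall a with rfl | rfl | rfl <;> simp +decide
  have h3 : Matrix.of (fun _ b => if b = 0 then 0 else 1) * E =
      Complex.exp (c * k) • Matrix.of (fun _ b => if b = 0 then 0 else 1) := by
    refine mul_exp_of_mul_eq_smul ?_
    ext a b
    rw [mul_smul_comm, Matrix.smul_apply, Matrix.mul_apply, hsum, lkRes_apply, lkRes_apply,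
      lkRes_apply]
    rcases hall b with rfl | rfl | rfl <;> simp +decide
  have e1 : ∀ a, E a 0 = Complex.exp (c * (k - α)) * if a = 0 then 1 else 0 := fun a => by
    have := congrFun (congrFun h1 a) 0
    rw [Matrix.mul_apply, hsum] at this
    simpa +decide using this
  have e2 : ∀ a, E a 1 - E a 2 =
      Complex.exp (-(c * k)) * if a = 1 then 1 else if a = 2 then -1 else 0 := fun a => by
    have := congrFun (congrFun h2 a) 0
    rw [Matrix.mul_apply, hsum] at this
    simpa +decide [sub_eq_add_neg] using this
  have e3 : ∀ b, E 1 b + E 2 b = Complex.exp (c * k) * if b = 0 then 0 else 1 := fun b => by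
    have := congrFun (congrFun h3 0) b
    rw [Matrix.mul_apply, hsum] at this
    simpa +decide using this
  have hdet : ∀ M : Matrix (ZMod 3) (ZMod 3) ℂ, M.det =
      M 0 0 * M 1 1 * M 2 2 - M 0 0 * M 1 2 * M 2 1 - M 0 1 * M 1 0 * M 2 2 +
        M 0 1 * M 1 2 * M 2 0 + M 0 2 * M 1 0 * M 2 1 - M 0 2 * M 1 1 * M 2 0 :=
    fun M => Matrix.det_fin_three M
  have hqq : Complex.exp (c * k) * Complex.exp (-(c * k)) = 1 := by
    rw [← Complex.exp_add, add_neg_cancel, Complex.exp_zero]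
  have a1 : (2 * 0 - 1 : ZMod 3) = 2 := by decide
  have a2 : (2 * 0 - 2 : ZMod 3) = 1 := by decide
  have a0 : (2 * 0 - 0 : ZMod 3) = 0 := by decide
  have n1 : (1 : ZMod 3) ≠ 0 := by decide
  have n2 : (2 : ZMod 3) ≠ 0 := by decide
  have n3 : (1 : ZMod 3) ≠ 2 := by decide
  have f10 := e1 1
  have f20 := e1 2
  have f00 := e1 0
  have g1 := e2 1
  have g2 := e2 2
  have k1 := e3 1
  have k2 := e3 2
  simp only [n1, n2, n3.symm, if_false, if_true, mul_zero, mul_one] at f10 f20 f00 g1 g2 k1 k2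
  rw [hdet]
  simp only [Matrix.sub_apply, Matrix.smul_apply, Matrix.one_apply, reflPerm_mul_apply, a0, a1, a2,
    smul_eq_mul, n1, n2, n3, n1.symm, n2.symm, n3.symm, if_false, if_true, f10, f20, f00]
  have g1' : E 1 2 = E 1 1 - Complex.exp (-(c * k)) := by linear_combination -g1
  have k1' : E 2 1 = Complex.exp (c * k) - E 1 1 := by linear_combination k1
  have k2' : E 2 2 = Complex.exp (c * k) - E 1 1 + Complex.exp (-(c * k)) := by
    linear_combination k2 - g1'
  rw [g1', k1', k2']
  ring

/-- Close to `H_0` the connection along the half-turn is `iπκ A_0` up to a term of the order of the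
radius of the half-turn. -/
theorem norm_lkForm_halfTurn_sub_le (k α κ : ℂ) {r : ℝ} (hr : 0 < r) (hr1 : r ≤ 1 / 2) (t : ℝ) :
    ‖lkForm 3 k α κ (halfTurn 3 ![1, r] 0 t) (deriv (halfTurn 3 ![1, r] 0) t) -
        (κ * (π * Complex.I)) • lkRes k α 0‖ ≤
      ‖κ‖ * (2 * π * ∑ j, ‖lkRes k α j‖) * r := by
  have hpi := Real.pi_pos
  rw [(hasDerivAt_halfTurn_zero _ t).deriv, halfTurn_zero]
  set e := Complex.exp (π * Complex.I * t) with he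
  have he1 : ‖e‖ = 1 := norm_exp_pi_mul_I t
  have he0 : e ≠ 0 := Complex.exp_ne_zero _
  have hr0 : (r : ℂ) ≠ 0 := by exact_mod_cast hr.ne'
  simp only [cons_val_zero, cons_val_one, cons_val_fin_one]
  set z : Fin 2 → ℂ := ![((1 : ℝ) : ℂ), e * r] with hz
  set d : Fin 2 → ℂ := ![0, e * (π * Complex.I) * r] with hd
  have hratio0 : lineForm 3 0 d / lineForm 3 0 z = π * Complex.I := by
    rw [lineForm_zero, lineForm_zero]
    simp only [hz, hd, cons_val_one, cons_val_fin_one]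
    field_simp
  have hratio : ∀ j ≠ 0, ‖lineForm 3 j d / lineForm 3 j z‖ ≤ 2 * π * r := by
    intro j hj
    have h1 : ‖lineForm 3 j d‖ = 1 / 2 * (π * r) := by
      have hd0 : d 0 = 0 := rfl
      have hd1 : ‖(1 / 2 : ℂ) * d 1‖ = 1 / 2 * (π * r) := by
        have : d 1 = e * (π * Complex.I) * r := rfl
        rw [this, norm_mul, norm_mul, norm_mul, norm_mul, he1, Complex.norm_I, Complex.norm_real,
          Complex.norm_real, Real.norm_of_nonneg hr.le, Real.norm_of_nonneg hpi.le]
        norm_num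
      have hj' : j = 1 ∨ j = 2 := by revert j; decide
      rcases hj' with rfl | rfl
      · rw [lineForm_one, hd0, mul_zero, zero_add, hd1]
      · rw [lineForm_two, hd0, mul_zero, zero_sub, norm_neg, hd1]
    have h2 : 1 / 4 ≤ ‖lineForm 3 j z‖ := by
      refine le_trans ?_ (norm_lineForm_ge hj z)
      have h3 : ‖z 0‖ = 1 := by simp [hz]
      have h4 : ‖z 1‖ = r := by
        have : z 1 = e * r := rfl
        rw [this, norm_mul, he1, one_mul, Complex.norm_real, Real.norm_of_nonneg hr.le]
      have h5 : (1 : ℝ) ≤ √3 := Real.one_le_sqrt.2 (by norm_num)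
      rw [h3, h4]
      linarith
    rw [norm_div, h1, div_le_iff₀ (by linarith)]
    have : 0 ≤ π * r := by positivity
    nlinarith
  have hsplit : lkForm 3 k α κ z d - (κ * (π * Complex.I)) • lkRes k α 0 =
      κ • ∑ j, (if j = 0 then 0 else lineForm 3 j d / lineForm 3 j z) • lkRes k α j := by
    have : ∑ j, (lineForm 3 j d / lineForm 3 j z) • lkRes k α j =
        (π * Complex.I) • lkRes k α 0 +
          ∑ j, (if j = 0 then 0 else lineForm 3 j d / lineForm 3 j z) • lkRes k α j := by
      rw [Fintype.sum_eq_add_sum_compl (0 : ZMod 3), hratio0,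
        Fintype.sum_eq_add_sum_compl (0 : ZMod 3) (fun j => (if j = 0 then (0 : ℂ) else _) • _),
        if_pos rfl, zero_smul, zero_add]
      refine congrArg _ (Finset.sum_congr rfl fun j hj => ?_)
      rw [if_neg (by simpa using hj)]
    change κ • ∑ j, _ • lkRes k α j - _ = _
    rw [this, smul_add, smul_smul]
    abel
  rw [hsplit, norm_smul, mul_assoc]
  refine mul_le_mul_of_nonneg_left ?_ (norm_nonneg κ)
  refine (norm_sum_le _ _).trans ?_
  have hconst : 2 * π * (∑ j, ‖lkRes k α j‖) * r = ∑ j, 2 * π * r * ‖lkRes k α j‖ := by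
    rw [← Finset.mul_sum]
    ring
  rw [hconst]
  refine Finset.sum_le_sum fun j _ => ?_
  rw [norm_smul]
  refine mul_le_mul_of_nonneg_right ?_ (norm_nonneg _)
  split_ifs with hj
  · rw [norm_zero]
    positivity
  · exact hratio j hj

/-- Transport along the half-turn around `H_0` tends to `exp(iπκ A_0)`, with `A_0` the residue, as
the base point approaches `H_0`. -/
theorem tendsto_transport_halfTurn {k α κ : ℂ} {Y Z : ℂ → Matrix (ZMod 3) (ZMod 3) ℂ}
    (h : IsFundamental k α κ Y Z) :
    Tendsto (fun r : ℝ => flatSection (κ * (k - α)) Y (halfTurn 3 ![1, r] 0 1) *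
        flatSection (-(κ * (k - α))) Z (halfTurn 3 ![1, r] 0 0)) (𝓝[>] 0)
      (𝓝 (NormedSpace.exp ((κ * (π * Complex.I)) • lkRes k α 0))) := by
  set B := (κ * (π * Complex.I)) • lkRes k α 0 with hB
  set C := ‖κ‖ * (2 * π * ∑ j, ‖lkRes k α j‖) with hC
  have hC0 : 0 ≤ C := by
    have := Real.pi_pos
    positivity
  have hderiv : ∀ t : ℝ, HasDerivAt (fun t : ℝ => NormedSpace.exp ((t : ℂ) • B))
      (B * NormedSpace.exp ((t : ℂ) • B)) t := fun t => by
    have h1 := (hasDerivAt_exp_smul_const' (𝕂 := ℂ) B (t : ℂ)).scomp t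
      (Complex.ofRealCLM.hasDerivAt (x := t))
    refine h1.congr_deriv ?_
    rw [Complex.ofRealCLM_apply, Complex.ofReal_one, one_smul]
    rfl
  have hcont : Continuous fun t : ℝ => NormedSpace.exp ((t : ℂ) • B) :=
    continuous_iff_continuousAt.2 fun t => (hderiv t).continuousAt
  obtain ⟨M, hM⟩ := (isCompact_Icc (a := (0 : ℝ)) (b := 1)).bddAbove_image hcont.norm.continuousOn
  replace hM : ∀ t ∈ Icc (0 : ℝ) 1, ‖NormedSpace.exp ((t : ℂ) • B)‖ ≤ M :=
    fun t ht => hM (mem_image_of_mem _ ht)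
  set K : NNReal := ⟨‖B‖ + C, by positivity⟩ with hK
  -- Grönwall's inequality compares the flat sections with the exponential
  have hbound : ∀ r ∈ Ioc (0 : ℝ) (1 / 2),
      dist (flatSection (κ * (k - α)) Y (halfTurn 3 ![1, r] 0 1) *
        flatSection (-(κ * (k - α))) Z (halfTurn 3 ![1, r] 0 0))
        (NormedSpace.exp B) ≤ gronwallBound 0 K (0 + C * r * M) 1 := by
    intro r hr
    have hp : InChamber 3 ![1, r] := by
      have h5 : (1 : ℝ) ≤ √3 := Real.one_le_sqrt.2 (by norm_num)
      refine inChamber_iff.2 ⟨by simpa using hr.1, ?_⟩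
      simp
      linarith [hr.2]
    have hnear := norm_lkForm_halfTurn_sub_le k α κ hr.1 hr.2
    set Ω : ℝ → Matrix (ZMod 3) (ZMod 3) ℂ := fun t =>
      lkForm 3 k α κ (halfTurn 3 ![1, r] 0 t) (deriv (halfTurn 3 ![1, r] 0) t) with hΩ
    set G := flatSection (-(κ * (k - α))) Z (halfTurn 3 ![1, r] 0 0) with hG
    set f : ℝ → Matrix (ZMod 3) (ZMod 3) ℂ := fun t =>
      flatSection (κ * (k - α)) Y (halfTurn 3 ![1, r] 0 t) * G with hf
    have hfd : ∀ t ∈ Icc (0 : ℝ) 1, HasDerivAt f (Ω t * f t) t := fun t ht => by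
      have := (h.hasDerivAt_flatSection (hasDerivAt_halfTurn_zero _ t).differentiableAt.hasDerivAt
        (halfTurn_zero_mem hp ht).1 (halfTurn_zero_mem hp ht).2).1.mul_const G
      refine this.congr_deriv ?_
      rw [mul_assoc]
    have hf0 : f 0 = 1 :=
      mul_eq_one_comm.1 (h.flatSection_mul (halfTurn_zero_mem hp (t := 0) (by simp)).2)
    have hΩK : ∀ t, ‖Ω t‖ ≤ K := fun t => by
      have h1 : C * r ≤ C := mul_le_of_le_one_right hC0 (by linarith [hr.2])
      have h2 : ‖Ω t‖ ≤ ‖B‖ + ‖Ω t - B‖ := by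
        have := norm_add_le B (Ω t - B)
        rwa [add_sub_cancel] at this
      exact h2.trans (add_le_add le_rfl ((hnear t).trans h1))
    have key := dist_le_of_approx_trajectories_ODE (v := fun t X => Ω t * X) (K := K)
      (f := f) (f' := fun t => Ω t * f t) (g := fun t => NormedSpace.exp ((t : ℂ) • B))
      (g' := fun t => B * NormedSpace.exp ((t : ℂ) • B)) (a := 0) (b := 1) (εf := 0)
      (εg := C * r * M) (δ := 0)
      (fun t => LipschitzWith.of_dist_le_mul fun X X' => by
        rw [dist_eq_norm, dist_eq_norm, ← mul_sub]
        exact (norm_mul_le _ _).trans (mul_le_mul_of_nonneg_right (hΩK t) (norm_nonneg _)))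
      (fun t ht => (hfd t ht).continuousAt.continuousWithinAt)
      (fun t ht => (hfd t (Ico_subset_Icc_self ht)).hasDerivWithinAt)
      (fun t _ => by rw [dist_self])
      hcont.continuousOn
      (fun t _ => (hderiv t).hasDerivWithinAt)
      (fun t ht => by
        rw [dist_comm, dist_eq_norm, ← sub_mul]
        exact (norm_mul_le _ _).trans (mul_le_mul (hnear t) (hM t (Ico_subset_Icc_self ht))
          (norm_nonneg _) (mul_nonneg hC0 hr.1.le)))
      (by simp [hf0]) 1 (by simp)
    simpa using key
  refine tendsto_iff_dist_tendsto_zero.2 ?_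
  have hlim : Tendsto (fun r : ℝ => gronwallBound 0 K (0 + C * r * M) 1) (𝓝[>] 0) (𝓝 0) := by
    have h1 : Continuous fun r : ℝ => gronwallBound 0 K (0 + C * r * M) 1 :=
      (gronwallBound_continuous_ε 0 K 1).comp (by fun_prop)
    have h2 := h1.tendsto 0
    simp only [mul_zero, zero_mul, add_zero, gronwallBound_ε0_δ0] at h2
    exact h2.mono_left nhdsWithin_le_nhds
  refine squeeze_zero' (Eventually.of_forall fun _ => dist_nonneg) ?_ hlim
  filter_upwards [Ioc_mem_nhdsGT (show (0 : ℝ) < 1 / 2 by norm_num)] with r hr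
  exact hbound r hr

/-- The characteristic polynomial of the monodromy does not depend on the base point, and is found
by letting the base point approach `H_0`. -/
theorem det_sub_monodromy {k α κ : ℂ} {Y Z : ℂ → Matrix (ZMod 3) (ZMod 3) ℂ}
    (h : IsFundamental k α κ Y Z) (x : ℂ) :
    (x • (1 : Matrix (ZMod 3) (ZMod 3) ℂ) - zetaPar k α κ • (midRefl Y Z * rotPerm)).det =
      (x - (lPar k α κ)⁻¹) * (x - qPar k κ) * (x + (qPar k κ)⁻¹) := by
  have e1 : Complex.exp (κ * (π * Complex.I) * (k - α)) = (lPar k α κ)⁻¹ := by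
    rw [lPar, qPar, ← Complex.exp_sub, ← Complex.exp_neg]
    congr 1
    ring
  have e2 : Complex.exp (κ * (π * Complex.I) * k) = qPar k κ := by
    rw [qPar]; congr 1; ring
  have e3 : Complex.exp (-(κ * (π * Complex.I) * k)) = (qPar k κ)⁻¹ := by
    rw [Complex.exp_neg, e2]
  rw [← e1, ← e3, ← e2, ← det_sub_reflPerm_mul_exp]
  have hcont : Continuous fun P : Matrix (ZMod 3) (ZMod 3) ℂ =>
      (x • (1 : Matrix (ZMod 3) (ZMod 3) ℂ) - reflPerm 3 0 * P).det := by
    refine Continuous.matrix_det ?_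
    fun_prop
  have hlim := (hcont.tendsto _).comp (tendsto_transport_halfTurn h)
  refine tendsto_nhds_unique (tendsto_const_nhds.congr' ?_) hlim
  filter_upwards [Ioc_mem_nhdsGT (show (0 : ℝ) < 1 by norm_num)] with r hr
  have hp : InChamber 3 ![1, r] := by
    have h5 : (1 : ℝ) < √3 := Real.lt_sqrt_of_sq_lt (by norm_num)
    refine inChamber_iff.2 ⟨by simpa using hr.1, ?_⟩
    simp
    linarith [hr.2]
  have hY := h.Y_mul_Z (sector_subset (realPt_mem_sector hp))
  rw [Function.comp_apply, reflPerm_zero_mul_transport h hp]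
  generalize midRefl Y Z * rotPerm = N
  generalize Y (realPt ![1, r]) = G at *
  generalize Z (realPt ![1, r]) = G' at *
  have : x • (1 : Matrix (ZMod 3) (ZMod 3) ℂ) - zetaPar k α κ • (G * N * G') =
      G * (x • 1 - zetaPar k α κ • N) * G' := by
    simp only [mul_sub, sub_mul, mul_smul_comm, smul_mul_assoc, mul_one, hY]
  rw [this, det_mul, det_mul, mul_right_comm, ← det_mul, hY, det_one, one_mul]

/-! ### The monodromy is a representation of the BMW algebra -/

/-- A conjugate of a reflection projection is a reflection projection. -/
theorem IsReflectionProj.conj {Q G G' : Matrix (ZMod 3) (ZMod 3) ℂ} (hQ : IsReflectionProj Q)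
    (hG : G' * G = 1) : IsReflectionProj (G * Q * G') where
  trace := by rw [trace_mul_comm, ← mul_assoc, hG, one_mul, hQ.trace]
  mul_mul M := by
    have h1 : G * Q * G' * M * (G * Q * G') = G * (Q * (G' * M * G) * Q) * G' := by
      simp only [mul_assoc]
    have h2 : (Q * (G' * M * G)).trace = (G * Q * G' * M).trace := by
      rw [← mul_assoc, trace_mul_comm]
      simp only [mul_assoc]
    rw [h1, hQ.mul_mul, h2, mul_smul_comm, smul_mul_assoc]

section Representation

variable {k α κ : ℂ} {p : Fin 2 → ℝ}

theorem isLKMonodromy_iff_eq_lkT (hp : InChamber 3 p) (i : Fin 2)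
    (T : Matrix (ZMod 3) (ZMod 3) ℂ) : IsLKMonodromy 3 k α κ p i T ↔ T = lkT 3 k α κ p i := by
  obtain ⟨Y, Z, h⟩ := exists_isFundamental k α κ
  obtain ⟨T', hT'⟩ : ∃ T', ∀ T, IsLKMonodromy 3 k α κ p i T ↔ T = T' := by
    fin_cases i
    · exact ⟨_, fun T => (isLKMonodromy_iff h hp).1⟩
    · exact ⟨_, fun T => (isLKMonodromy_iff h hp).2⟩
  have hex : ∃ T, IsLKMonodromy 3 k α κ p i T := ⟨T', (hT' T').2 rfl⟩
  have : lkT 3 k α κ p i = T' := by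
    rw [lkT, dif_pos hex]
    exact (hT' _).1 hex.choose_spec
  rw [this, hT']

theorem lkE_eq_bmwE (i : Fin 2) :
    lkE 3 k α κ p i = bmwE (qPar k κ) (lPar k α κ) (lkT 3 k α κ p i) := rfl

/-- The operators `T_i` have eigenvalues `l⁻¹`, `q`, `-q⁻¹`, and together with the `e_i` they
satisfy the relations of `B_3(q, l)`. -/
theorem isBMWPair_lkT (hp : InChamber 3 p) (hq : qPar k κ ^ 2 ≠ 1)
    (hlq : lPar k α κ * qPar k κ ≠ 1) (hlq' : lPar k α κ ≠ -qPar k κ) :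
    (∀ i, HasBMWEigenvalues (qPar k κ) (lPar k α κ) (lkT 3 k α κ p i)) ∧
      IsBMWPair (qPar k κ) (lPar k α κ) (lkT 3 k α κ p 0) (lkT 3 k α κ p 1) (lkE 3 k α κ p 0)
        (lkE 3 k α κ p 1) := by
  obtain ⟨Y, Z, h⟩ := exists_isFundamental k α κ
  have h0 := (isLKMonodromy_iff h hp).1.1 ((isLKMonodromy_iff_eq_lkT hp 0 _).2 rfl)
  have h1 := (isLKMonodromy_iff h hp).2.1 ((isLKMonodromy_iff_eq_lkT hp 1 _).2 rfl)
  have hdet := det_sub_monodromy h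
  have hw := sector_subset (realPt_mem_sector hp)
  have hm := sector_subset midPt_mem_sector
  have hY := h.Y_mul_Z hw
  have hZ := h.Z_mul_Y hw
  have hYm := h.Y_mul_Z hm
  have hZm := h.Z_mul_Y hm
  -- the reflection and the rotation, transported from the axis and the centre to the base point
  set G := Y (realPt p)
  set G' := Z (realPt p)
  set Q := G * Z midPt * ((1 / 2 : ℂ) • (1 - reflPerm 3 2)) * (Y midPt * G') with hQdef
  have hQ : IsReflectionProj Q := by
    refine isReflectionProj_reflPerm.conj ?_
    rw [mul_assoc, ← mul_assoc G', hZ, one_mul, hYm]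
  have hJ : 1 - (2 : ℂ) • Q = G * midRefl Y Z * G' := by
    have e1 : G * Z midPt * (Y midPt * G') = 1 := by
      rw [mul_assoc, ← mul_assoc (Z midPt), hZm, one_mul, hY]
    have e2 : (2 : ℂ) • Q = G * Z midPt * (1 - reflPerm 3 2) * (Y midPt * G') := by
      rw [hQdef, mul_smul_comm, smul_mul_assoc, smul_smul]
      norm_num
    rw [e2, mul_sub, sub_mul, mul_one, e1, sub_sub_cancel, midRefl]
    simp only [mul_assoc]
  have hmul : ∀ A B, G * A * G' * (G * B * G') = G * (A * B) * G' := fun A B => by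
    rw [mul_assoc, ← mul_assoc G', ← mul_assoc G', hZ, one_mul]
    simp only [mul_assoc]
  have htr : ∀ A, (G * A * G').trace = A.trace := fun A => by
    rw [trace_mul_comm, ← mul_assoc, hZ, one_mul]
  set C := G * rotPerm * G' with hCdef
  have hC : C * C * C = 1 := by
    rw [hmul, hmul, rotPerm_pow_three, mul_one, hY]
  have hC1 : C.trace = 0 := by rw [htr, trace_rotPerm]
  have hC2 : (C * C).trace = 0 := by rw [hmul, htr, trace_rotPerm_sq]
  rw [← hmul, ← hJ] at h0 h1
  have hev : HasBMWEigenvalues (qPar k κ) (lPar k α κ)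
      (zetaPar k α κ • ((1 - (2 : ℂ) • Q) * C)) := by
    refine ⟨qPar_ne_zero k κ, lPar_ne_zero k α κ, nuPar_ne_zero (qPar_ne_zero k κ) hq, hlq, hlq',
      fun x => ?_⟩
    have : x • (1 : Matrix (ZMod 3) (ZMod 3) ℂ) - zetaPar k α κ • ((1 - (2 : ℂ) • Q) * C) =
        G * (x • 1 - zetaPar k α κ • (midRefl Y Z * rotPerm)) * G' := by
      rw [hJ, hmul]
      simp only [mul_sub, sub_mul, mul_smul_comm, smul_mul_assoc, mul_one, hY]
    rw [this, det_mul, det_mul, mul_right_comm, ← det_mul, hY, det_one, one_mul, hdet]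
  obtain ⟨hev1, hpair⟩ := isBMWPair_of_reflection hQ hC hC1 hC2 (zetaPar_ne_zero k α κ) hev
  rw [← h0] at hev hpair
  rw [← h1] at hev1 hpair
  exact ⟨Fin.forall_fin_two.2 ⟨hev, hev1⟩, hpair⟩

theorem lkE_mul_mul_eq_smul_iff
    (h : ∀ i, HasBMWEigenvalues (qPar k κ) (lPar k α κ) (lkT 3 k α κ p i))
    (i : Fin 2) (w : FreeMonoid (Letter (Fin 2))) (c : ℂ) :
    lkE 3 k α κ p i * evalWord (lkT 3 k α κ p) (lkE 3 k α κ p) w * lkE 3 k α κ p i =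
      c • lkE 3 k α κ p i ↔ c = Phi 3 k α κ p i w := by
  have hex : ∃ c : ℂ, lkE 3 k α κ p i * evalWord (lkT 3 k α κ p) (lkE 3 k α κ p) w *
      lkE 3 k α κ p i = c • lkE 3 k α κ p i := ⟨_, (h i).e_mul_e _⟩
  have hspec := hex.choose_spec
  rw [Phi, dif_pos hex]
  refine ⟨fun hc => ?_, fun hc => by rw [hc]; exact hspec⟩
  exact smul_left_injective ℂ (h i).e_ne_zero (hc.symm.trans hspec)

end Representation

end DihedralBMW

theorem proposition4p2 (k α κ : ℂ) (p : Fin 2 → ℝ) (hp : InChamber 3 p)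
    (hq : qPar k κ ^ 2 ≠ 1)
    (hlq : lPar k α κ * qPar k κ ≠ 1)
    (hlq' : lPar k α κ ≠ -qPar k κ)
    (hlν : 1 + lPar k α κ * ((qPar k κ)⁻¹ - qPar k κ) ≠ 0) :
    -- the Lawrence–Krammer monodromy operators exist and are unique
    (∀ i : Fin 2, ∀ T, IsLKMonodromy 3 k α κ p i T ↔ T = lkT 3 k α κ p i) ∧
    -- the scalars `Φ^i(w)` are well defined
    (∀ (i : Fin 2) (w : FreeMonoid (Letter (Fin 2))) (c : ℂ),
      lkE 3 k α κ p i * evalWord (lkT 3 k α κ p) (lkE 3 k α κ p) w * lkE 3 k α κ p i =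
        c • lkE 3 k α κ p i ↔ c = Phi 3 k α κ p i w) ∧
    -- in `B_3(q, l)`, `E_i w E_i` is a scalar multiple of `E_i`, and the scalar is `Φ^i(w)`
    (∀ (i : Fin 2) (w : FreeMonoid (Letter (Fin 2))) (c : ℂ),
      cE (qPar k κ) (lPar k α κ) i *
          evalWord (cX (qPar k κ) (lPar k α κ)) (cE (qPar k κ) (lPar k α κ)) w *
          cE (qPar k κ) (lPar k α κ) i =
        c • cE (qPar k κ) (lPar k α κ) i ↔ c = Phi 3 k α κ p i w) ∧
    -- the two algebras are isomorphic, generator to generator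
    (∃ φ : DihedralAlg 3 k α κ p ≃ₐ[ℂ] BMW3 (qPar k κ) (lPar k α κ), ∀ i : Fin 2,
      φ (dX 3 k α κ p i) = cX (qPar k κ) (lPar k α κ) i ∧
      φ (dE 3 k α κ p i) = cE (qPar k κ) (lPar k α κ) i) := by
  obtain ⟨hev, hpair⟩ := isBMWPair_lkT hp hq hlq hlq'
  have hν := nuPar_ne_zero (qPar_ne_zero k κ) hq
  have hl := lPar_ne_zero k α κ
  have hPhi := lkE_mul_mul_eq_smul_iff hev
  -- the monodromy representation of `B_3(q, l)`
  obtain ⟨ρ, hρX, hρE⟩ := exists_algHom_of_isBMWPair hpair hν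
  have hcE : ∀ i, cE (qPar k κ) (lPar k α κ) i ≠ 0 := fun i h0 =>
    (hev i).e_ne_zero (by rw [← lkE_eq_bmwE, ← hρE, h0, map_zero])
  have hsand : ∀ (i : Fin 2) (w : FreeMonoid (Letter (Fin 2))),
      cE (qPar k κ) (lPar k α κ) i *
          evalWord (cX (qPar k κ) (lPar k α κ)) (cE (qPar k κ) (lPar k α κ)) w *
          cE (qPar k κ) (lPar k α κ) i =
        Phi 3 k α κ p i w • cE (qPar k κ) (lPar k α κ) i := fun i w => by
    have hij : i ≠ i + 1 := by omega
    obtain ⟨c, hc⟩ := exists_sandwich_eq_smul hij (isBMWPair_generators _ _ hij) hl hν hlν w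
    have := congrArg ρ hc
    rw [map_mul, map_mul, map_smul, map_evalWord] at this
    simp only [hρX, hρE] at this
    rw [hc, (hPhi i w c).1 this]
  refine ⟨fun i T => isLKMonodromy_iff_eq_lkT hp i T, hPhi,
    fun i w c => ⟨fun hc => ?_, fun hc => ?_⟩,
    exists_algEquiv_dihedral hsand (fun i => ?_) (fun i j hij => ?_) hν⟩
  · exact smul_left_injective ℂ (hcE i) (hc.symm.trans (hsand i w))
  · rw [hc, hsand]
  · refine ((hPhi i 1 _).1 ?_).symm
    rw [evalWord_one, mul_one, ← pow_two, lkE_eq_bmwE, (hev i).e_sq]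
  · refine ((hPhi i _ _).1 ?_).symm
    rw [evalWord_of_X]
    have hcases : i = 0 ∧ j = 1 ∨ i = 1 ∧ j = 0 := by omega
    rcases hcases with ⟨rfl, rfl⟩ | ⟨rfl, rfl⟩
    · exact hpair.eye
    · exact hpair.fxf
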